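/- **Theorem (Rough Rolling and Unrolling I).** *Setting.* Let $0<T<\infty$, $p\in[2,3)$, and let $\omega$ be a control on $[0,T]$: a continuous, non-negative, superadditive function of $(s,t)$, $0\le s\le t\le T$, which is zero on the diagonal and positive off it. For $S\in[0,T]$ and functions $g,h$ of $(s,t)$, $0\le s\le t\le S$, with values in a finite-dimensional normed space, write $g_{s,t}\simeq h_{s,t}$ over $[0,S]$ if there are $\delta>0$ and $C$ with $|g_{s,t}-h_{s,t}|\le C\,\omega(s,t)^{3/p}$ whenever $0\le s\le t\le S$ and $t-s\le\delta$. Write $x_{s,t}=x_t-x_s$. For a bilinear map $B$ and $A\in V\otimes V$, $B(a,b)|_{a\otimes b=A}$ denotes the value at $A$ of the induced linear map on $V\otimes V$. *Rough paths.* For a Euclidean space $V$, $WG_p([0,S],V)$ is the set of pairs $\mathbf X=(x,\mathbb X)$ of continuous functions $x:[0,S]\to V$ and $\mathbb X:\{0\le s\le t\le S\}\to V\otimes V$ such that $\mathbb X_{s,t}=\mathbb X_{s,u}+\mathbb X_{u,t}+x_{s,u}\otimes x_{u,t}$ for $s\le u\le t$, $\sup_{s<t}|x_{s,t}|\,\omega(s,t)^{-1/p}<\infty$,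 $\sup_{s<t}|\mathbb X_{s,t}|\,\omega(s,t)^{-2/p}<\infty$, and the symmetric part of $\mathbb X_{s,t}$ is $\frac12x_{s,t}\otimes x_{s,t}$. If $\alpha$ is a smooth $W$-valued one-form on an open subset of $V$ containing the trace of $x$, then $\int\alpha(d\mathbf X)$ is the element $\mathbf Z=(z,\mathbb Z)$ of $WG_p([0,S],W)$ with $z_0=0$, $z_{s,t}\simeq\alpha(x_s)x_{s,t}+\alpha'(x_s)\mathbb X_{s,t}$ and $\mathbb Z_{s,t}\simeq(\alpha(x_s)\otimes\alpha(x_s))\mathbb X_{s,t}$, where $\alpha'(x)[a\otimes b]=(\partial_a\alpha)(x)b$. *Manifold.* Let $M\subset E=\mathbb R^N$ be an embedded submanifold of dimension $d\in\{1,\dots,N\}$, and let $o\in M$. $WG_p([0,S],M)$ is the set of $\mathbf X\in WG_p([0,S],E)$ with $x_t\in M$ for all $t$ and $\int\alpha(d\mathbf X)=0$ for every smooth one-form $\alpha$ on $E$, with values in a finite-dimensional space, that vanishes on $TM$; $WG_p([0,S],M,o)$ is the subset with $x_0=o$, and $WG_p([0,S],\mathbb R^d,0)$ is the set of $\mathbf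 Z\in WG_p([0,S],\mathbb R^d)$ with $z_0=0$. For a smooth one-form $\alpha$ on $M$ and $\mathbf X\in WG_p([0,S],M)$, $\int\alpha(d\mathbf X):=\int\tilde\alpha(d\mathbf X)$, where $\tilde\alpha$ is any extension of $\alpha$ to a smooth one-form on an open neighbourhood of $M$ in $E$. *Parallelism and equation.* Let $Y$ be a parallelism of $M$: a linear map $a\mapsto Y_a$ from $\mathbb R^d$ to the smooth vector fields on $M$ such that $Y(m):a\mapsto Y_a(m)$ is a linear isomorphism $\mathbb R^d\to T_mM$ for every $m\in M$. Let $\theta^Y(v_m)=Y(m)^{-1}v$ for $v\in T_mM$. For $\mathbf Z\in WG_p([0,T],\mathbb R^d,0)$, a solution over $[0,S]$ of $$d\mathbf X=Y_{d\mathbf Z}(x),\qquad x_0=o \tag{1}$$ is an $\mathbf X\in WG_p([0,S],M)$ with $x_0=o$ and, over $[0,S]$, $$x_{s,t}\simeq Y_{z_{s,t}}(x_s)+(\partial_{Y_a}Y_b)(x_s)|_{a\otimes b=\mathbb Z_{s,t}},\qquad \mathbb X_{s,t}\simeq Y_a(x_s)\otimes Y_b(x_s)|_{a\otimes b=\mathbb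 Z_{s,t}} .$$ A solution of (1) up to explosion is a pair $(J,\mathbf X)$ in which $J=[0,T]$ (no explosion) or $J=[0,\tau)$ with $0<\tau\le T$ ($\tau$ is the explosion time), $\mathbf X$ restricts to a solution over $[0,S]$ for each $S\in J$, and (1) has no solution over $[0,S]$ for $S\in[0,T]\setminus J$. *Claim.* 1. For every $\mathbf X\in WG_p([0,T],M,o)$ the integral $\int_0^\cdot\theta^Y(d\mathbf X)$ exists, is unique, and belongs to $WG_p([0,T],\mathbb R^d,0)$. 2. Let $\mathbf Z\in WG_p([0,T],\mathbb R^d,0)$. Then (1) has a solution up to explosion, and any two solutions of (1) over the same interval $[0,S]$, $S\le T$, coincide. If $(J,\mathbf X)$ is the solution up to explosion then, for every $S\in J$, $\mathbf X$ restricted to $[0,S]$ is in $WG_p([0,S],M,o)$, and $\int_0^\cdot\theta^Y(d\mathbf X)=\mathbf Z$ over $[0,S]$. 3. Let $\mathbf X\in WG_p([0,T],M,o)$ and $\mathbf Z=\int_0^\cdot\theta^Y(d\mathbf X)$. Then $\mathbf X$ solves (1) over $[0,T]$ with this $\mathbf Z$, and the solution $\mathbf W$ up to explosion of this equation agrees with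 $\mathbf X$ on its interval of existence. -/

import Mathlib

open Set
open scoped TensorProduct ContDiff

namespace RoughManifold

/-- The Euclidean space `ℝⁿ`. -/
abbrev Eu (n : ℕ) : Type := EuclideanSpace ℝ (Fin n)

/-! ### Controls and rough paths -/

/-- The simplex of all `(s, t)` with `0 ≤ s ≤ t ≤ S`. -/
def simplex (S : ℝ) : Set (ℝ × ℝ) := {q | 0 ≤ q.1 ∧ q.1 ≤ q.2 ∧ q.2 ≤ S}

/-- A control on `[0, T]`: continuous, non-negative, superadditive, zero on the diagonal and
positive off the diagonal. Values outside the simplex are irrelevant. -/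
structure IsControl (T : ℝ) (w : ℝ → ℝ → ℝ) : Prop where
  continuousOn : ContinuousOn (fun q : ℝ × ℝ => w q.1 q.2) (simplex T)
  nonneg : ∀ s t, 0 ≤ s → s ≤ t → t ≤ T → 0 ≤ w s t
  superadditive : ∀ s u t, 0 ≤ s → s ≤ u → u ≤ t → t ≤ T → w s u + w u t ≤ w s t
  diagonal : ∀ s, 0 ≤ s → s ≤ T → w s s = 0
  pos : ∀ s t, 0 ≤ s → s < t → t ≤ T → 0 < w s t

/-- `g_{s,t} ≃ h_{s,t}` over `[0, S]`: for some `δ > 0` and some constant `C`,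
`|g_{s,t} - h_{s,t}| ≤ C w(s,t)^{3/p}` whenever `0 ≤ s ≤ t ≤ S` and `t - s ≤ δ`. -/
def Approx {W : Type*} [NormedAddCommGroup W] (p : ℝ) (w : ℝ → ℝ → ℝ) (S : ℝ)
    (g h : ℝ → ℝ → W) : Prop :=
  ∃ δ : ℝ, 0 < δ ∧ ∃ C : ℝ, ∀ s t : ℝ, 0 ≤ s → s ≤ t → t ≤ S → t - s ≤ δ →
    ‖g s t - h s t‖ ≤ C * (w s t) ^ (3 / p)

/-- The raw data `(x, 𝕏)` of a level two rough path: a path `x_t` and a two-parameter function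
`𝕏_{s,t}` with values in `V ⊗ V`. Only the values on the time interval under
consideration matter; see `EqUpTo`. -/
structure PathData (V : Type*) [NormedAddCommGroup V] [InnerProductSpace ℝ V] where
  path : ℝ → V
  area : ℝ → ℝ → V ⊗[ℝ] V

/-- The zero rough path. -/
def PathData.zero (V : Type*) [NormedAddCommGroup V] [InnerProductSpace ℝ V] : PathData V where
  path := fun _ => 0
  area := fun _ _ => 0

/-- The increment `x_{s,t} = x_t - x_s`. -/
def PathData.incr {V : Type*} [NormedAddCommGroup V] [InnerProductSpace ℝ V]
    (X : PathData V) (s t : ℝ) : V := X.path t - X.path s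

/-- Two rough paths coincide over the time interval `[0, S]`. -/
def EqUpTo {V : Type*} [NormedAddCommGroup V] [InnerProductSpace ℝ V] (S : ℝ)
    (X X' : PathData V) : Prop :=
  (∀ t, 0 ≤ t → t ≤ S → X.path t = X'.path t) ∧
    ∀ s t, 0 ≤ s → s ≤ t → t ≤ S → X.area s t = X'.area s t

/-- `X` is an `w`-controlled weakly geometric `p`-rough path over `[0, S]` with values in `V`.
The norm on `V ⊗ V` is the Hilbert tensor norm. -/
structure IsWG {V : Type*} [NormedAddCommGroup V] [InnerProductSpace ℝ V]
    (p : ℝ) (w : ℝ → ℝ → ℝ) (S : ℝ) (X : PathData V) : Prop where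
  path_continuous : ContinuousOn X.path (Icc 0 S)
  area_continuous : ContinuousOn (fun q : ℝ × ℝ => X.area q.1 q.2) (simplex S)
  /-- Chen's identity. -/
  chen : ∀ s u t, 0 ≤ s → s ≤ u → u ≤ t → t ≤ S →
    X.area s t = X.area s u + X.area u t + X.incr s u ⊗ₜ[ℝ] X.incr u t
  /-- `p`-variation regularity, first level. -/
  path_bound : ∃ C : ℝ, ∀ s t, 0 ≤ s → s < t → t ≤ S →
    ‖X.incr s t‖ ≤ C * (w s t) ^ (1 / p)
  /-- `p`-variation regularity, second level. -/
  area_bound : ∃ C : ℝ, ∀ s t, 0 ≤ s → s < t → t ≤ S →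
    ‖X.area s t‖ ≤ C * (w s t) ^ (2 / p)
  /-- The symmetric part of `𝕏_{s,t}` is `½ x_{s,t} ⊗ x_{s,t}`. -/
  symm : ∀ s t, 0 ≤ s → s ≤ t → t ≤ S →
    (1 / 2 : ℝ) • (X.area s t + TensorProduct.comm ℝ V V (X.area s t)) =
      (1 / 2 : ℝ) • (X.incr s t ⊗ₜ[ℝ] X.incr s t)

/-- The linear map `V ⊗ V → W` induced by a bilinear map `A`, so that `a ⊗ b ↦ A a b`. -/
noncomputable def tensorLift {V W : Type*} [NormedAddCommGroup V] [InnerProductSpace ℝ V]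
    [NormedAddCommGroup W] [InnerProductSpace ℝ W] (A : V →L[ℝ] V →L[ℝ] W) :
    V ⊗[ℝ] V →ₗ[ℝ] W :=
  TensorProduct.lift A.toLinearMap₁₂

/-- `Z = ∫ α(dX)` over `[0, S]`, for a one-form `α` on (an open subset of) `V` with values in
`W`: `Z` is the weakly geometric `p`-rough path started at `0` such that
`z_{s,t} ≃ α(x_s) x_{s,t} + α'(x_s) 𝕏_{s,t}` and `ℤ_{s,t} ≃ (α(x_s) ⊗ α(x_s)) 𝕏_{s,t}`,
where `α'(x)(a ⊗ b) = (∂_a α)(x) b`. -/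
structure IsRoughIntegral {V W : Type*} [NormedAddCommGroup V] [InnerProductSpace ℝ V]
    [NormedAddCommGroup W] [InnerProductSpace ℝ W] (p : ℝ) (w : ℝ → ℝ → ℝ) (S : ℝ)
    (α : V → V →L[ℝ] W) (X : PathData V) (Z : PathData W) : Prop where
  isWG : IsWG p w S Z
  start : Z.path 0 = 0
  level_one : Approx p w S Z.incr
    (fun s t => α (X.path s) (X.incr s t) +
      tensorLift (fderiv ℝ α (X.path s)) (X.area s t))
  level_two : Approx p w S Z.area
    (fun s t => TensorProduct.map (α (X.path s)).toLinearMap (α (X.path s)).toLinearMap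
      (X.area s t))

/-! ### Embedded submanifolds -/

/-- `F : U → ℝ^{N-d}` is a local defining function of the subset `M` of `ℝ^N`. -/
structure IsLocalDefining {N : ℕ} (d : ℕ) (M U : Set (Eu N)) (F : Eu N → Eu (N - d)) : Prop where
  isOpen : IsOpen U
  smooth : ContDiffOn ℝ ∞ F U
  zero_set : U ∩ M = {x | x ∈ U ∧ F x = 0}
  surjective : ∀ x ∈ U, Function.Surjective (fderiv ℝ F x)

/-- `M` is a `d`-dimensional embedded submanifold of `ℝ^N`, `1 ≤ d ≤ N`. -/
structure IsEmbeddedSubmanifold {N : ℕ} (d : ℕ) (M : Set (Eu N)) : Prop where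
  one_le : 1 ≤ d
  le : d ≤ N
  locally_defined : ∀ m ∈ M, ∃ (U : Set (Eu N)) (F : Eu N → Eu (N - d)),
    m ∈ U ∧ IsLocalDefining d M U F

/-- The tangent space `T_m M`, the kernel of `F'(m)` for a local defining function `F` near `m`
(it does not depend on the choice of `F`). -/
def tangentVectors {N : ℕ} (d : ℕ) (M : Set (Eu N)) (m : Eu N) : Set (Eu N) :=
  {v | ∃ (U : Set (Eu N)) (F : Eu N → Eu (N - d)),
    m ∈ U ∧ IsLocalDefining d M U F ∧ fderiv ℝ F m v = 0}

/-- `f` is smooth as a function on the embedded submanifold `M`: near every point of `M` it is the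
restriction to `M` of a smooth function on an open set. -/
def SmoothAlong {N : ℕ} {W : Type*} [NormedAddCommGroup W] [NormedSpace ℝ W]
    (M : Set (Eu N)) (f : Eu N → W) : Prop :=
  ∀ m ∈ M, ∃ (U : Set (Eu N)) (g : Eu N → W),
    IsOpen U ∧ m ∈ U ∧ ContDiffOn ℝ ∞ g U ∧ EqOn f g (M ∩ U)

/-- `f` is a smooth vector field on `M` (its values off `M` are irrelevant). -/
def IsVectorField {N : ℕ} (d : ℕ) (M : Set (Eu N)) (f : Eu N → Eu N) : Prop :=
  SmoothAlong M f ∧ ∀ m ∈ M, f m ∈ tangentVectors d M m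

/-- `Y` is a parallelism of `M`: for each `a`, `Y_a = Y(·) a` is a smooth vector field on `M`, and
for each `m ∈ M` the map `a ↦ Y_a(m)` is a linear isomorphism of `ℝ^d` onto `T_m M`. -/
structure IsParallelism {N : ℕ} (d : ℕ) (M : Set (Eu N)) (Y : Eu N → Eu d →L[ℝ] Eu N) :
    Prop where
  vectorField : ∀ a : Eu d, IsVectorField d M (fun m => Y m a)
  injective : ∀ m ∈ M, Function.Injective (Y m)
  range_eq : ∀ m ∈ M, Set.range (Y m) = tangentVectors d M m

/-- The `ℝ^d`-valued one-form `θ^Y(v_m) = Y(m)⁻¹ v`, for `m ∈ M` and `v ∈ T_m M` (all other values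
are irrelevant). -/
noncomputable def parallelForm {N d : ℕ} (Y : Eu N → Eu d →L[ℝ] Eu N) (m v : Eu N) : Eu d :=
  Function.invFun (Y m) v

/-- The smooth one-form `β` on the open neighbourhood `U` of `M` extends the one-form
`α` on `M`. Here `α m v` is the value at the tangent vector `v ∈ T_m M`. -/
structure IsExtension {N : ℕ} (d : ℕ) {W : Type*} [NormedAddCommGroup W] [NormedSpace ℝ W]
    (M : Set (Eu N)) (α : Eu N → Eu N → W) (U : Set (Eu N)) (β : Eu N → Eu N →L[ℝ] W) :
    Prop where
  isOpen : IsOpen U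
  subset : M ⊆ U
  smooth : ContDiffOn ℝ ∞ β U
  agree : ∀ m ∈ M, ∀ v ∈ tangentVectors d M m, β m v = α m v

/-! ### Rough paths on a submanifold, integrals of one-forms, differential equations -/

/-- `X ∈ WG_p([0, S], M)`: `X` is a weakly geometric `p`-rough path in `ℝ^N` whose trace lies in
`M` and such that `∫ α(dX) = 0` for every smooth one-form `α` on `ℝ^N` with values in a finite
dimensional vector space which vanishes on `TM`. -/
structure IsWGOn {N : ℕ} (d : ℕ) (p : ℝ) (w : ℝ → ℝ → ℝ) (M : Set (Eu N)) (S : ℝ)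
    (X : PathData (Eu N)) : Prop where
  isWG : IsWG p w S X
  trace_mem : ∀ t, 0 ≤ t → t ≤ S → X.path t ∈ M
  integral_zero : ∀ (k : ℕ) (α : Eu N → Eu N →L[ℝ] Eu k), ContDiff ℝ ∞ α →
    (∀ m ∈ M, ∀ v ∈ tangentVectors d M m, α m v = 0) →
    IsRoughIntegral p w S α X (PathData.zero (Eu k))

/-- `Z = ∫ α(dX)` over `[0, S]` for a one-form `α` on `M`: the one-form has a smooth
extension to an open neighbourhood of `M`, and `Z` is the rough integral along `X` of any such
extension. -/
def IsIntegralOn {N : ℕ} (d : ℕ) {W : Type*} [NormedAddCommGroup W] [InnerProductSpace ℝ W]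
    (p : ℝ) (w : ℝ → ℝ → ℝ) (M : Set (Eu N)) (S : ℝ) (α : Eu N → Eu N → W)
    (X : PathData (Eu N)) (Z : PathData W) : Prop :=
  (∃ (U : Set (Eu N)) (β : Eu N → Eu N →L[ℝ] W), IsExtension d M α U β) ∧
    ∀ (U : Set (Eu N)) (β : Eu N → Eu N →L[ℝ] W), IsExtension d M α U β →
      IsRoughIntegral p w S β X Z

/-- The linear map `ℝ^d ⊗ ℝ^d → ℝ^N` with `a ⊗ b ↦ (∂_{Y_a} Y_b)(x)`. The derivative is taken along
`M`: as `Y_a(x)` is tangent to `M`, `fderivWithin ℝ Y M x (Y x a)` is the derivative at `0` of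
`Y ∘ σ` for any curve `σ` in `M` with `σ 0 = x` and `σ' 0 = Y_a(x)`. -/
noncomputable def dirDeriv {N d : ℕ} (M : Set (Eu N)) (Y : Eu N → Eu d →L[ℝ] Eu N) (x : Eu N) :
    Eu d ⊗[ℝ] Eu d →ₗ[ℝ] Eu N :=
  TensorProduct.lift ((fderivWithin ℝ Y M x).comp (Y x)).toLinearMap₁₂

/-- `X ∈ WG_p([0, S], M)` solves the rough differential equation `dX = Y_{dZ}(x)`, `x_0 = o`, over
`[0, S]`. -/
structure SolvesRDE {N d : ℕ} (p : ℝ) (w : ℝ → ℝ → ℝ) (M : Set (Eu N))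
    (Y : Eu N → Eu d →L[ℝ] Eu N) (o : Eu N) (Z : PathData (Eu d)) (S : ℝ)
    (X : PathData (Eu N)) : Prop where
  isWGOn : IsWGOn d p w M S X
  start : X.path 0 = o
  level_one : Approx p w S X.incr
    (fun s t => Y (X.path s) (Z.incr s t) + dirDeriv M Y (X.path s) (Z.area s t))
  level_two : Approx p w S X.area
    (fun s t => TensorProduct.map (Y (X.path s)).toLinearMap (Y (X.path s)).toLinearMap
      (Z.area s t))

/-- `X` is the solution of `dX = Y_{dZ}(x)`, `x_0 = o`, up to its explosion time, and `J` is its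
interval of existence: either `J = [0, T]` (no explosion), or `J = [0, τ)` where `τ` is the explosion
time; `X` solves the equation over `[0, S]` for each `S ∈ J`, and the equation has no solution
over `[0, S]` when `S ∈ [0, T]` is not in `J`. -/
structure IsMaximalSolution {N d : ℕ} (T p : ℝ) (w : ℝ → ℝ → ℝ) (M : Set (Eu N))
    (Y : Eu N → Eu d →L[ℝ] Eu N) (o : Eu N) (Z : PathData (Eu d)) (J : Set ℝ)
    (X : PathData (Eu N)) : Prop where
  interval : J = Icc 0 T ∨ ∃ τ, 0 < τ ∧ τ ≤ T ∧ J = Ico 0 τ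
  solves : ∀ S ∈ J, SolvesRDE p w M Y o Z S X
  maximal : ∀ S, 0 ≤ S → S ≤ T → ∀ X', SolvesRDE p w M Y o Z S X' → S ∈ J

end RoughManifold

/-!
The rolling map `Z ↦ X` and the unrolling map `X ↦ Z` are inverse to each other because `θ^Y` and
`Y` are pointwise inverse: substituting the local expansion of `Z` in terms of `X` into that of `X`
in terms of `Z` gives identities up to terms of order `ω(s,t)^{3/p}`, and increments of additive
functions are determined by their values up to such terms (`IsO.eq_zero_of_additive`).

*Calculus of orders.* With `rho = ω^{1/p}`, the relation `≃` means that the difference is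
`O(rho ^ 3)` near the diagonal (`IsO`, `IsControl.approx_iff`); orders add up under products. As
`p < 3`, halving the control shrinks `rho ^ 3` by more than a factor of two. This yields the sewing
lemma for almost flows `exists_path_of_almostFlow`, which is applied to produce rough integrals
(`exists_roughIntegral`), second levels (`exists_lift`) and, with the second order Euler scheme as
almost flow, local solutions of rough differential equations with compactly supported coefficients
(`exists_local_solution`); uniqueness is `eq_of_solution`.

*Unrolling.* A one-form near `M` which vanishes on `TM` has a negligible germ along a rough path
`X` on `M`, and multiplying it by coordinate functions shows that `𝕏` is tangent to `M` in both
factors up to negligible terms. Hence integrals depend only on the restriction of the one-form to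
`TM` (`IsWGOn.isRoughIntegral_of_agree`). With smooth extensions `f` of `Y` and `β` of `θ^Y`
(`IsParallelism.exists_pair`), the one-form `1 - f β` vanishes on `TM`; this is the assertion that
`X` solves the equation driven by `∫ θ^Y(dX)` (`IsWGOn.isO_of_integral`).

*Rolling.* Differentiating `α Y = const` along `M` shows that along a solution the germ of a
one-form `α` with `α Y` constant is this constant applied to the germ of `Z`
(`IsParallelism.isRoughIntegral_of_solution`). The constant `0` says that solutions are rough paths
on `M`, and the constant `1` that they integrate back to `Z`. Thus a solution amounts to its first
level, a path in `M`, whose uniqueness follows from the compactly supported case. Such a path can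
always be continued (`IsPathSolution.exists_continuation`): the vector fields are extended near a
point of `M` so as to be tangent to the level sets of a defining function `F` of `M`, and `F` is
then constant along solutions (`eq_of_tangent`) since `Z` is weakly geometric.
-/

namespace RoughManifold
open Filter Topology Asymptotics

/-! ### Controls -/

section Control

variable {T p : ℝ} {w : ℝ → ℝ → ℝ}

lemma IsControl.mono (hw : IsControl T w) {s s' t' t : ℝ} (h0 : 0 ≤ s) (h1 : s ≤ s')
    (h2 : s' ≤ t') (h3 : t' ≤ t) (h4 : t ≤ T) : w s' t' ≤ w s t := by
  have a1 := hw.superadditive s s' t h0 h1 (h2.trans h3) h4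
  have a2 := hw.superadditive s' t' t (h0.trans h1) h2 h3 h4
  have a3 := hw.nonneg s s' h0 h1 (by linarith)
  have a4 := hw.nonneg t' t (by linarith) h3 h4
  linarith

/-- Every interval can be split into two parts each carrying at most half of the control. -/
lemma IsControl.exists_mid (hw : IsControl T w) {s t : ℝ} (h0 : 0 ≤ s) (h1 : s ≤ t) (h2 : t ≤ T) :
    ∃ u, s ≤ u ∧ u ≤ t ∧ w s u ≤ w s t / 2 ∧ w u t ≤ w s t / 2 := by
  have hc : ContinuousOn (fun u => w s u) (Icc s t) :=
    hw.continuousOn.comp (f := fun u : ℝ => (s, u)) (by fun_prop)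
      (fun u hu => ⟨h0, hu.1, hu.2.trans h2⟩)
  have hss := hw.diagonal s h0 (h1.trans h2)
  have hst := hw.nonneg s t h0 h1 h2
  obtain ⟨u, hu, hu'⟩ := intermediate_value_Icc h1 hc (show w s t / 2 ∈ Icc (w s s) (w s t) from
    ⟨by rw [hss]; linarith, by linarith⟩)
  have := hw.superadditive s u t h0 hu.1 hu.2 h2
  simp only at hu'
  exact ⟨u, hu.1, hu.2, hu'.le, by linarith⟩

/-- The size `w(s,t)^{1/p}` of first order increments; estimates of order `k` are in terms of its
`k`-th power. -/
noncomputable def rho (w : ℝ → ℝ → ℝ) (p s t : ℝ) : ℝ := (w s t) ^ (1 / p)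

lemma IsControl.rho_nonneg (hw : IsControl T w) {s t : ℝ} (h0 : 0 ≤ s) (h1 : s ≤ t)
    (h2 : t ≤ T) : 0 ≤ rho w p s t := Real.rpow_nonneg (hw.nonneg s t h0 h1 h2) _

lemma IsControl.rho_pos (hw : IsControl T w) {s t : ℝ} (h0 : 0 ≤ s) (h1 : s < t)
    (h2 : t ≤ T) : 0 < rho w p s t := Real.rpow_pos_of_pos (hw.pos s t h0 h1 h2) _

lemma IsControl.rho_mono (hw : IsControl T w) (hp : 0 < p) {s s' t' t : ℝ} (h0 : 0 ≤ s)
    (h1 : s ≤ s') (h2 : s' ≤ t') (h3 : t' ≤ t) (h4 : t ≤ T) : rho w p s' t' ≤ rho w p s t :=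
  Real.rpow_le_rpow (hw.nonneg _ _ (h0.trans h1) h2 (h3.trans h4)) (hw.mono h0 h1 h2 h3 h4)
    (by positivity)

lemma IsControl.rho_diag (hw : IsControl T w) (hp : 0 < p) {s : ℝ} (h0 : 0 ≤ s)
    (h1 : s ≤ T) : rho w p s s = 0 := by
  rw [rho, hw.diagonal s h0 h1, Real.zero_rpow (by positivity)]

lemma IsControl.rpow_eq (hw : IsControl T w) (k : ℕ) {s t : ℝ} (h0 : 0 ≤ s)
    (h1 : s ≤ t) (h2 : t ≤ T) : (w s t) ^ ((k : ℝ) / p) = rho w p s t ^ k := by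
  rw [rho, ← Real.rpow_natCast, ← Real.rpow_mul (hw.nonneg _ _ h0 h1 h2)]
  congr 1
  ring

lemma IsControl.rho_continuousOn (hw : IsControl T w) (hp : 0 < p) :
    ContinuousOn (fun q : ℝ × ℝ => rho w p q.1 q.2) (simplex T) :=
  hw.continuousOn.rpow_const fun _ _ => Or.inr (by positivity)

/-- The factor by which the third power of `rho` shrinks when the control is halved. -/
noncomputable def halving (p : ℝ) : ℝ := (1 / 2 : ℝ) ^ (3 / p)

lemma halving_pos : 0 < halving p := Real.rpow_pos_of_pos (by norm_num) _

lemma halving_lt (hp : 0 < p) (hp3 : p < 3) : halving p < 1 / 2 := by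
  have h : (1 : ℝ) < 3 / p := by rw [lt_div_iff₀ hp]; linarith
  simpa [halving] using Real.rpow_lt_rpow_of_exponent_gt (x := (1 / 2 : ℝ)) (by norm_num)
    (by norm_num) h

lemma IsControl.rho_halving (hw : IsControl T w) (hp : 0 < p) {s t s' t' : ℝ} (h0 : 0 ≤ s)
    (h1 : s ≤ t) (h2 : t ≤ T) (h0' : 0 ≤ s') (h1' : s' ≤ t') (h2' : t' ≤ T)
    (h : w s' t' ≤ w s t / 2) : rho w p s' t' ^ 3 ≤ halving p * rho w p s t ^ 3 := by
  have e1 := hw.rpow_eq (p := p) 3 h0 h1 h2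
  have e2 := hw.rpow_eq (p := p) 3 h0' h1' h2'
  push_cast at e1 e2
  rw [← e1, ← e2, halving, ← Real.mul_rpow (by norm_num) (hw.nonneg _ _ h0 h1 h2)]
  refine Real.rpow_le_rpow (hw.nonneg _ _ h0' h1' h2') (by linarith) (by positivity)

lemma IsControl.exists_rho_mid (hw : IsControl T w) (hp : 0 < p) {s t : ℝ} (h0 : 0 ≤ s)
    (h1 : s ≤ t) (h2 : t ≤ T) :
    ∃ u, s ≤ u ∧ u ≤ t ∧ rho w p s u ^ 3 ≤ halving p * rho w p s t ^ 3 ∧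
      rho w p u t ^ 3 ≤ halving p * rho w p s t ^ 3 := by
  obtain ⟨u, a, b, c, d⟩ := hw.exists_mid h0 h1 h2
  exact ⟨u, a, b, hw.rho_halving hp h0 h1 h2 h0 a (b.trans h2) c,
    hw.rho_halving hp h0 h1 h2 (h0.trans a) b h2 d⟩

end Control

/-! ### Estimates near the diagonal -/

lemma isCompact_triangle (a b : ℝ) : IsCompact {q : ℝ × ℝ | a ≤ q.1 ∧ q.1 ≤ q.2 ∧ q.2 ≤ b} := by
  refine (isCompact_Icc (a := ((a, a) : ℝ × ℝ)) (b := (b, b))).of_isClosed_subset ?_ ?_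
  · exact (isClosed_le continuous_const continuous_fst).inter
      ((isClosed_le continuous_fst continuous_snd).inter
        (isClosed_le continuous_snd continuous_const))
  · rintro ⟨s, t⟩ ⟨h1, h2, h3⟩
    simp only at h1 h2 h3
    exact ⟨⟨h1, h1.trans h2⟩, ⟨h2.trans h3, h3⟩⟩

/-- The pairs `a ≤ s ≤ t ≤ b` with `t - s → 0`. -/
def nearDiag (a b : ℝ) : Filter (ℝ × ℝ) :=
  comap (fun q : ℝ × ℝ => q.2 - q.1) (𝓝 0) ⊓ 𝓟 {q | a ≤ q.1 ∧ q.1 ≤ q.2 ∧ q.2 ≤ b}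

lemma eventually_nearDiag {a b : ℝ} {P : ℝ × ℝ → Prop} :
    (∀ᶠ q in nearDiag a b, P q) ↔
      ∃ δ > 0, ∀ s t, a ≤ s → s ≤ t → t ≤ b → t - s ≤ δ → P (s, t) := by
  rw [nearDiag, eventually_inf_principal, eventually_comap]
  rw [Metric.nhds_basis_closedBall.eventually_iff]
  constructor
  · rintro ⟨δ, hδ, h⟩
    refine ⟨δ, hδ, fun s t h1 h2 h3 h4 => h (x := t - s) ?_ (s, t) rfl ⟨h1, h2, h3⟩⟩
    rw [mem_closedBall_zero_iff, Real.norm_eq_abs, abs_of_nonneg (by linarith)]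
    exact h4
  · rintro ⟨δ, hδ, h⟩
    refine ⟨δ, hδ, fun x hx q hq hq' => h q.1 q.2 hq'.1 hq'.2.1 hq'.2.2 ?_⟩
    rw [mem_closedBall_zero_iff, Real.norm_eq_abs] at hx
    rw [hq]
    exact (le_abs_self _).trans hx

lemma eventually_nearDiag_mem (a b : ℝ) :
    ∀ᶠ q in nearDiag a b, a ≤ q.1 ∧ q.1 ≤ q.2 ∧ q.2 ≤ b :=
  eventually_nearDiag.2 ⟨1, one_pos, fun _ _ h1 h2 h3 _ => ⟨h1, h2, h3⟩⟩

lemma nearDiag_mono {a b a' b' : ℝ} (h : a ≤ a') (h' : b' ≤ b) : nearDiag a' b' ≤ nearDiag a b :=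
  inf_le_inf_left _ (principal_mono.2 fun _ hq => ⟨h.trans hq.1, hq.2.1, hq.2.2.trans h'⟩)

/-- `g_{s,t} = O(w(s,t)^{k/p})` as `t - s → 0`, uniformly over `a ≤ s ≤ t ≤ b`. -/
def IsO {W : Type*} [NormedAddCommGroup W] (w : ℝ → ℝ → ℝ) (p : ℝ) (a b : ℝ) (k : ℕ)
    (g : ℝ → ℝ → W) : Prop :=
  (fun q : ℝ × ℝ => g q.1 q.2) =O[nearDiag a b] fun q => rho w p q.1 q.2 ^ k

section Estimates

variable {T p a b S : ℝ} {w : ℝ → ℝ → ℝ}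
variable {W W₁ W₂ : Type*} [NormedAddCommGroup W] [NormedAddCommGroup W₁] [NormedAddCommGroup W₂]

lemma IsControl.isO_iff (hw : IsControl T w) (ha : 0 ≤ a) (hb : b ≤ T) {k : ℕ} {g : ℝ → ℝ → W} :
    IsO w p a b k g ↔ ∃ δ > 0, ∃ C, ∀ s t, a ≤ s → s ≤ t → t ≤ b → t - s ≤ δ →
      ‖g s t‖ ≤ C * rho w p s t ^ k := by
  rw [IsO, isBigO_iff]
  simp only [eventually_nearDiag]
  constructor
  · rintro ⟨C, δ, hδ, h⟩
    refine ⟨δ, hδ, C, fun s t h1 h2 h3 h4 => (h s t h1 h2 h3 h4).trans_eq ?_⟩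
    rw [Real.norm_of_nonneg (pow_nonneg (hw.rho_nonneg (ha.trans h1) h2 (h3.trans hb)) _)]
  · rintro ⟨δ, hδ, C, h⟩
    refine ⟨C, δ, hδ, fun s t h1 h2 h3 h4 => (h s t h1 h2 h3 h4).trans_eq ?_⟩
    rw [Real.norm_of_nonneg (pow_nonneg (hw.rho_nonneg (ha.trans h1) h2 (h3.trans hb)) _)]

lemma IsControl.isO_of_bound (hw : IsControl T w) (ha : 0 ≤ a) (hb : b ≤ T) {k : ℕ}
    {g : ℝ → ℝ → W} (C : ℝ)
    (h : ∀ s t, a ≤ s → s ≤ t → t ≤ b → ‖g s t‖ ≤ C * rho w p s t ^ k) : IsO w p a b k g :=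
  (hw.isO_iff ha hb).2 ⟨1, one_pos, C, fun s t h1 h2 h3 _ => h s t h1 h2 h3⟩

lemma IsControl.approx_iff (hw : IsControl T w) (hS : S ≤ T) {g h : ℝ → ℝ → W} :
    Approx p w S g h ↔ IsO w p 0 S 3 (fun s t => g s t - h s t) := by
  rw [hw.isO_iff le_rfl hS, Approx]
  refine exists_congr fun δ => and_congr_right fun _ => exists_congr fun C =>
    forall₂_congr fun s t => forall₄_congr fun h1 h2 h3 _ => ?_
  have := hw.rpow_eq (p := p) 3 h1 h2 (h3.trans hS)
  push_cast at this
  rw [this]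

lemma IsO.mono_interval {k : ℕ} {g : ℝ → ℝ → W} (h : IsO w p a b k g) {a' b' : ℝ} (ha : a ≤ a')
    (hb : b' ≤ b) : IsO w p a' b' k g := IsBigO.mono h (nearDiag_mono ha hb)

lemma IsO.congr {k : ℕ} {g g' : ℝ → ℝ → W} (h : IsO w p a b k g)
    (hg : ∀ s t, a ≤ s → s ≤ t → t ≤ b → g s t = g' s t) : IsO w p a b k g' :=
  IsBigO.congr' h ((eventually_nearDiag_mem a b).mono fun _ hq => hg _ _ hq.1 hq.2.1 hq.2.2)
    EventuallyEq.rfl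

lemma IsO.add {k : ℕ} {g g' : ℝ → ℝ → W} (h : IsO w p a b k g) (h' : IsO w p a b k g') :
    IsO w p a b k (fun s t => g s t + g' s t) := IsBigO.add h h'

lemma IsO.sub {k : ℕ} {g g' : ℝ → ℝ → W} (h : IsO w p a b k g) (h' : IsO w p a b k g') :
    IsO w p a b k (fun s t => g s t - g' s t) := IsBigO.sub h h'

lemma isO_zero {k : ℕ} : IsO w p a b k (fun _ _ => (0 : W)) := isBigO_zero _ _

lemma IsO.of_le {k : ℕ} {g : ℝ → ℝ → W} {g' : ℝ → ℝ → W₁} (h : IsO w p a b k g) (C : ℝ)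
    (hg : ∀ s t, a ≤ s → s ≤ t → t ≤ b → ‖g' s t‖ ≤ C * ‖g s t‖) : IsO w p a b k g' :=
  IsBigO.trans (IsBigO.of_bound C
    ((eventually_nearDiag_mem a b).mono fun _ hq => hg _ _ hq.1 hq.2.1 hq.2.2)) h

/-- Orders add up under products of norms. -/
lemma IsO.of_le_mul {k l : ℕ} {g : ℝ → ℝ → W} {g₁ : ℝ → ℝ → W₁} {g₂ : ℝ → ℝ → W₂}
    (h₁ : IsO w p a b k g₁) (h₂ : IsO w p a b l g₂) (C : ℝ)
    (hg : ∀ s t, a ≤ s → s ≤ t → t ≤ b → ‖g s t‖ ≤ C * (‖g₁ s t‖ * ‖g₂ s t‖)) :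
    IsO w p a b (k + l) g := by
  have h := IsBigO.mul (IsBigO.norm_left h₁) (IsBigO.norm_left h₂)
  simp only [← pow_add] at h
  refine IsBigO.trans (IsBigO.of_bound C
    ((eventually_nearDiag_mem a b).mono fun q hq => ?_)) h
  simpa using hg _ _ hq.1 hq.2.1 hq.2.2

lemma isO_of_bounded {g : ℝ → ℝ → W} (C : ℝ) (h : ∀ s t, a ≤ s → s ≤ t → t ≤ b → ‖g s t‖ ≤ C) :
    IsO w p a b 0 g := by
  simp only [IsO, pow_zero]
  exact IsBigO.of_bound C ((eventually_nearDiag_mem a b).mono fun q hq => by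
    simpa using h _ _ hq.1 hq.2.1 hq.2.2)

lemma IsControl.tendsto_nearDiag (hw : IsControl T w) (hp : 0 < p) (ha : 0 ≤ a) (hb : b ≤ T) :
    Tendsto (fun q : ℝ × ℝ => rho w p q.1 q.2) (nearDiag a b) (𝓝 0) := by
  have hK : IsCompact (simplex T) := isCompact_triangle 0 T
  have hu := hK.uniformContinuousOn_of_continuous (hw.rho_continuousOn hp)
  rw [Metric.uniformContinuousOn_iff] at hu
  rw [Metric.tendsto_nhds]
  intro ε hε
  obtain ⟨δ, hδ, h⟩ := hu ε hε
  refine eventually_nearDiag.2 ⟨δ / 2, by positivity, fun s t h1 h2 h3 h4 => ?_⟩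
  have := h (s, t) ⟨ha.trans h1, h2, h3.trans hb⟩ (s, s)
    ⟨ha.trans h1, le_rfl, (h2.trans h3).trans hb⟩ (by
      rw [Prod.dist_eq]
      simp only [dist_self, Real.dist_eq]
      rw [abs_of_nonneg (by linarith), max_eq_right (by linarith)]
      linarith)
  simpa [hw.rho_diag hp (ha.trans h1) ((h2.trans h3).trans hb)] using this

lemma IsO.weaken (hw : IsControl T w) (hp : 0 < p) (ha : 0 ≤ a) (hb : b ≤ T) {k l : ℕ}
    (hkl : l ≤ k) {g : ℝ → ℝ → W} (h : IsO w p a b k g) : IsO w p a b l g := by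
  refine IsBigO.trans h ?_
  obtain ⟨m, rfl⟩ := Nat.exists_eq_add_of_le hkl
  simp only [pow_add]
  have h1 : (fun q : ℝ × ℝ => rho w p q.1 q.2 ^ m) =O[nearDiag a b] fun _ => (1 : ℝ) :=
    ((hw.tendsto_nearDiag hp ha hb).pow m).isBigO_one ℝ
  simpa using (isBigO_refl (fun q : ℝ × ℝ => rho w p q.1 q.2 ^ l) (nearDiag a b)).mul h1

/-- A bounded function of order `k` near the diagonal satisfies the same bound on the whole
simplex, because the control is bounded away from zero away from the diagonal. -/
lemma IsO.exists_bound (hw : IsControl T w) (hp : 0 < p) (ha : 0 ≤ a) (hb : b ≤ T) {k : ℕ}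
    {g : ℝ → ℝ → W} (h : IsO w p a b k g) {B : ℝ}
    (hB : ∀ s t, a ≤ s → s ≤ t → t ≤ b → ‖g s t‖ ≤ B) :
    ∃ C, 0 ≤ C ∧ ∀ s t, a ≤ s → s ≤ t → t ≤ b → ‖g s t‖ ≤ C * rho w p s t ^ k := by
  obtain ⟨δ, hδ, C, hC⟩ := (hw.isO_iff ha hb).1 h
  have hK : IsCompact {q : ℝ × ℝ | a ≤ q.1 ∧ q.1 + δ ≤ q.2 ∧ q.2 ≤ b} := by
    refine (isCompact_Icc (a := ((a, a) : ℝ × ℝ)) (b := (b, b))).of_isClosed_subset ?_ ?_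
    · exact (isClosed_le continuous_const continuous_fst).inter
        ((isClosed_le (by fun_prop) continuous_snd).inter
          (isClosed_le continuous_snd continuous_const))
    · rintro ⟨s, t⟩ ⟨h1, h2, h3⟩
      simp only at h1 h2 h3
      exact ⟨⟨h1, by simp only; linarith⟩, ⟨by simp only; linarith, h3⟩⟩
  have hsub : {q : ℝ × ℝ | a ≤ q.1 ∧ q.1 + δ ≤ q.2 ∧ q.2 ≤ b} ⊆ simplex T := by
    rintro ⟨s, t⟩ ⟨h1, h2, h3⟩
    simp only at h1 h2 h3
    exact ⟨ha.trans h1, by simp only; linarith, h3.trans hb⟩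
  obtain ⟨m, hm, hm'⟩ : ∃ m > 0, ∀ s t, a ≤ s → s + δ ≤ t → t ≤ b → m ≤ rho w p s t ^ k := by
    rcases eq_empty_or_nonempty {q : ℝ × ℝ | a ≤ q.1 ∧ q.1 + δ ≤ q.2 ∧ q.2 ≤ b} with he | hne
    · refine ⟨1, one_pos, fun s t h1 h2 h3 => ?_⟩
      have : (s, t) ∈ (∅ : Set (ℝ × ℝ)) := he ▸ ⟨h1, h2, h3⟩
      exact this.elim
    · obtain ⟨q, hq, hq'⟩ := hK.exists_isMinOn hne
        (((hw.rho_continuousOn (p := p) hp).mono hsub).pow k)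
      refine ⟨rho w p q.1 q.2 ^ k, pow_pos (hw.rho_pos (ha.trans hq.1) (by linarith [hq.2.1])
        (hq.2.2.trans hb)) _, fun s t h1 h2 h3 => hq' (a := (s, t)) ⟨h1, h2, h3⟩⟩
  refine ⟨max C 0 + max B 0 / m, by positivity, fun s t h1 h2 h3 => ?_⟩
  have hr : 0 ≤ rho w p s t ^ k := pow_nonneg (hw.rho_nonneg (ha.trans h1) h2 (h3.trans hb)) _
  rw [add_mul]
  rcases le_total (t - s) δ with h4 | h4
  · have e1 := hC s t h1 h2 h3 h4
    have e2 : C * rho w p s t ^ k ≤ max C 0 * rho w p s t ^ k := by gcongr; exact le_max_left _ _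
    have e3 : 0 ≤ max B 0 / m * rho w p s t ^ k := by positivity
    linarith
  · have e1 := hB s t h1 h2 h3
    have e2 : max B 0 ≤ max B 0 / m * rho w p s t ^ k := by
      rw [div_mul_eq_mul_div, le_div_iff₀ hm]
      gcongr
      exact hm' s t h1 (by linarith) h3
    have e3 : 0 ≤ max C 0 * rho w p s t ^ k := by positivity
    linarith [le_max_left B 0]

/-- A real function that satisfies a contracting inequality under halving of the control and is
bounded by a multiple of `rho ^ 3` satisfies a bound with an explicit constant. -/
lemma IsControl.halving_bound (hw : IsControl T w) (hp : 0 < p)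
    (ha : 0 ≤ a) (hb : b ≤ T) {r : ℝ → ℝ → ℝ} {A m D δ : ℝ} (hA : A * halving p ≤ m) (hA0 : 0 ≤ A)
    (hm : m < 1)
    (hr : ∃ K, ∀ s t, a ≤ s → s ≤ t → t ≤ b → t - s ≤ δ → r s t ≤ K * rho w p s t ^ 3)
    (hstep : ∀ K, 0 ≤ K → ∀ s u t, a ≤ s → s ≤ u → u ≤ t → t ≤ b → t - s ≤ δ →
      r s u ≤ K → r u t ≤ K → r s t ≤ A * K + D * rho w p s t ^ 3) :
    ∀ s t, a ≤ s → s ≤ t → t ≤ b → t - s ≤ δ → r s t ≤ max D 0 / (1 - m) * rho w p s t ^ 3 := by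
  obtain ⟨K₀, hK₀⟩ := hr
  set E := max D 0 / (1 - m) with hE
  have hEm : E = m * E + max D 0 := by
    have : (1 - m) ≠ 0 := by linarith
    rw [hE]; field_simp; ring
  have hE0 : 0 ≤ E := div_nonneg (le_max_right _ _) (by linarith)
  have hm0 : 0 ≤ m := le_trans (mul_nonneg hA0 halving_pos.le) hA
  set K₁ := max K₀ 0 with hK₁
  -- iterating the inequality improves the constant geometrically towards `E`
  have key : ∀ n : ℕ, ∀ s t, a ≤ s → s ≤ t → t ≤ b → t - s ≤ δ →
      r s t ≤ (E + m ^ n * K₁) * rho w p s t ^ 3 := by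
    intro n
    induction n with
    | zero =>
      intro s t h1 h2 h3 h4
      have hr3 : 0 ≤ rho w p s t ^ 3 := pow_nonneg (hw.rho_nonneg (ha.trans h1) h2 (h3.trans hb)) _
      refine (hK₀ s t h1 h2 h3 h4).trans ?_
      gcongr
      rw [pow_zero, one_mul]
      linarith [le_max_left K₀ 0]
    | succ n ih =>
      intro s t h1 h2 h3 h4
      have hr3 : 0 ≤ rho w p s t ^ 3 := pow_nonneg (hw.rho_nonneg (ha.trans h1) h2 (h3.trans hb)) _
      obtain ⟨u, u1, u2, u3, u4⟩ := hw.exists_rho_mid hp (ha.trans h1) h2 (h3.trans hb)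
      have hc : 0 ≤ E + m ^ n * K₁ := by positivity
      have e1 := (ih s u h1 u1 (u2.trans h3) (by linarith)).trans
        (mul_le_mul_of_nonneg_left u3 hc)
      have e2 := (ih u t (h1.trans u1) u2 h3 (by linarith)).trans
        (mul_le_mul_of_nonneg_left u4 hc)
      have hh := (halving_pos (p := p)).le
      refine (hstep _ (by positivity) s u t h1 u1 u2 h3 h4 e1 e2).trans ?_
      calc A * ((E + m ^ n * K₁) * (halving p * rho w p s t ^ 3)) + D * rho w p s t ^ 3
          = (A * halving p * (E + m ^ n * K₁) + D) * rho w p s t ^ 3 := by ring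
        _ ≤ (m * (E + m ^ n * K₁) + max D 0) * rho w p s t ^ 3 := by
          gcongr
          exact le_max_left _ _
        _ = (E + m ^ (n + 1) * K₁) * rho w p s t ^ 3 := by
          rw [pow_succ]; linear_combination (- rho w p s t ^ 3) * hEm
  intro s t h1 h2 h3 h4
  have hlim : Tendsto (fun n : ℕ => (E + m ^ n * K₁) * rho w p s t ^ 3) atTop
      (𝓝 ((E + 0 * K₁) * rho w p s t ^ 3)) :=
    (((tendsto_pow_atTop_nhds_zero_of_lt_one hm0 hm).mul_const _).const_add _).mul_const _
  simpa using ge_of_tendsto' hlim fun n => key n s t h1 h2 h3 h4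

/-- A transitive relation between times that holds over short intervals holds over all intervals. -/
lemma forall_of_forall_short {P : ℝ → ℝ → Prop} {δ : ℝ} (hδ : 0 < δ)
    (hP : ∀ s u t, a ≤ s → s ≤ u → u ≤ t → t ≤ b → P s u → P u t → P s t)
    (h : ∀ s t, a ≤ s → s ≤ t → t ≤ b → t - s ≤ δ → P s t) :
    ∀ s t, a ≤ s → s ≤ t → t ≤ b → P s t := by
  have key : ∀ n : ℕ, ∀ s t, a ≤ s → s ≤ t → t ≤ b → t - s ≤ (n + 1) * δ → P s t := by
    intro n
    induction n with
    | zero => intro s t h1 h2 h3 h4; exact h s t h1 h2 h3 (by simpa using h4)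
    | succ n ih =>
      intro s t h1 h2 h3 h4
      push_cast at h4
      rcases le_total (t - s) δ with h5 | h5
      · exact h s t h1 h2 h3 h5
      · exact hP s (s + δ) t h1 (by linarith) (by linarith) h3
          (h _ _ h1 (by linarith) (by linarith) (by linarith))
          (ih _ _ (by linarith) (by linarith) h3 (by linarith))
  intro s t h1 h2 h3
  obtain ⟨n, hn⟩ := exists_nat_ge ((t - s) / δ)
  refine key n s t h1 h2 h3 ?_
  rw [div_le_iff₀ hδ] at hn
  nlinarith

/-- Uniqueness in the sewing lemma: an additive function of order three vanishes. -/
lemma IsO.eq_zero_of_additive (hw : IsControl T w) (hp : 0 < p) (hp3 : p < 3) (ha : 0 ≤ a)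
    (hb : b ≤ T) {g : ℝ → ℝ → W} (h : IsO w p a b 3 g)
    (hg : ∀ s u t, a ≤ s → s ≤ u → u ≤ t → t ≤ b → g s t = g s u + g u t) :
    ∀ s t, a ≤ s → s ≤ t → t ≤ b → g s t = 0 := by
  obtain ⟨δ, hδ, C, hC⟩ := (hw.isO_iff ha hb).1 h
  refine forall_of_forall_short hδ (P := fun s t => g s t = 0) (fun s u t h1 h2 h3 h4 h5 h6 => by
    rw [hg s u t h1 h2 h3 h4, h5, h6, add_zero]) ?_
  intro s t h1 h2 h3 h4
  have := hw.halving_bound (p := p) hp ha hb (r := fun s t => ‖g s t‖) (A := 2) (m := 2 * halving p)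
    (D := 0) (δ := δ) le_rfl zero_le_two (by linarith [halving_lt hp hp3]) ⟨C, hC⟩
    (fun K _ s u t h1 h2 h3 h4 _ h5 h6 => by
      rw [hg s u t h1 h2 h3 h4]
      linarith [norm_add_le (g s u) (g u t)]) s t h1 h2 h3 h4
  simpa using this

end Estimates

/-! ### The sewing lemma for almost flows -/

section Sewing

variable {T p a b : ℝ} {w : ℝ → ℝ → ℝ} {V : Type*} [NormedAddCommGroup V]

/-- The Euler scheme of `μ` along the times `τ`. -/
def eulerScheme (μ : ℝ → ℝ → V → V) (τ : ℕ → ℝ) (c₀ : V) : ℕ → V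
  | 0 => c₀
  | i + 1 => μ (τ i) (τ (i + 1)) (eulerScheme μ τ c₀ i)

/-- Along any partition the Euler scheme of an almost flow stays close to the one step map, with a
bound that does not depend on the partition. -/
lemma eulerScheme_bound (hw : IsControl T w) (hp : 0 < p) (ha : 0 ≤ a)
    (hb : b ≤ T) {μ : ℝ → ℝ → V → V} {κ C L : ℝ} (hκ : 0 ≤ κ) (hC : 0 ≤ C) (hL0 : 0 ≤ L)
    (hL : (1 + (1 + κ) ^ 2) * halving p * L + (2 + κ) * C ≤ L)
    (hdiag : ∀ s x, a ≤ s → s ≤ b → μ s s x = x)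
    (hlip : ∀ s t, a ≤ s → s ≤ t → t ≤ b → ∀ x y, ‖μ s t x - μ s t y‖ ≤ (1 + κ) * ‖x - y‖)
    (hdef : ∀ s u t, a ≤ s → s ≤ u → u ≤ t → t ≤ b → ∀ x,
      ‖μ u t (μ s u x) - μ s t x‖ ≤ C * rho w p s t ^ 3)
    (τ : ℕ → ℝ) (hτ : Monotone τ) (hτa : ∀ i, a ≤ τ i) (hτb : ∀ i, τ i ≤ b) (c₀ : V) :
    ∀ n i, ‖eulerScheme μ τ c₀ (i + n) - μ (τ i) (τ (i + n)) (eulerScheme μ τ c₀ i)‖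
      ≤ L * rho w p (τ i) (τ (i + n)) ^ 3 := by
  set c := eulerScheme μ τ c₀ with hc
  have h0 : ∀ i, 0 ≤ τ i := fun i => ha.trans (hτa i)
  have hT : ∀ i, τ i ≤ T := fun i => (hτb i).trans hb
  intro n
  induction n using Nat.strong_induction_on with
  | _ n ih =>
    intro i
    have hin : τ i ≤ τ (i + n) := hτ (by omega)
    have hr0 := hw.rho_nonneg (p := p) (h0 i) hin (hT _)
    have hr : 0 ≤ rho w p (τ i) (τ (i + n)) ^ 3 := pow_nonneg hr0 _
    rcases Nat.eq_zero_or_pos n with rfl | hn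
    · simp only [add_zero, hdiag _ _ (hτa i) (hτb i), sub_self, norm_zero] at hr ⊢
      positivity
    -- the step `[τ (i + k), τ (i + k + 1)]` contains the point that halves the control
    obtain ⟨k, hk, hk1, hk2⟩ : ∃ k, k + 1 ≤ n ∧
        w (τ i) (τ (i + k)) ≤ w (τ i) (τ (i + n)) / 2 ∧
        w (τ (i + (k + 1))) (τ (i + n)) ≤ w (τ i) (τ (i + n)) / 2 := by
      have hnn := hw.nonneg _ _ (h0 i) hin (hT _)
      classical
      let P : ℕ → Prop := fun k => w (τ i) (τ (i + k)) ≤ w (τ i) (τ (i + n)) / 2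
      have hP0 : P 0 := by
        simp only [P, add_zero, hw.diagonal _ (h0 i) (hT i)]
        linarith
      have hk := Nat.findGreatest_le (P := P) (n - 1)
      have hPk : P (Nat.findGreatest P (n - 1)) := Nat.findGreatest_spec (Nat.zero_le _) hP0
      refine ⟨Nat.findGreatest P (n - 1), by omega, hPk, ?_⟩
      rcases hk.eq_or_lt with he | hlt
      · rw [he, show n - 1 + 1 = n by omega, hw.diagonal _ (h0 _) (hT _)]
        linarith
      · have hnot := Nat.findGreatest_is_greatest (P := P)
          (Nat.lt_succ_self (Nat.findGreatest P (n - 1))) (by omega)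
        simp only [P, not_le, Nat.succ_eq_add_one] at hnot
        have := hw.superadditive (τ i) (τ (i + (Nat.findGreatest P (n - 1) + 1))) (τ (i + n)) (h0 i)
          (hτ (by omega)) (hτ (by omega)) (hT _)
        linarith
    have m1 : τ i ≤ τ (i + k) := hτ (by omega)
    have m2 : τ (i + k) ≤ τ (i + (k + 1)) := hτ (by omega)
    have m3 : τ (i + (k + 1)) ≤ τ (i + n) := hτ (by omega)
    have e1 := ih k (by omega) i
    have e2 := ih (n - (k + 1)) (by omega) (i + (k + 1))
    rw [show i + (k + 1) + (n - (k + 1)) = i + n by omega] at e2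
    have q1 := hw.rho_halving hp (h0 i) hin (hT _) (h0 i) m1 (hT _) hk1
    have q2 := hw.rho_halving hp (h0 i) hin (hT _) (h0 _) m3 (hT _) hk2
    have hstep : c (i + (k + 1)) = μ (τ (i + k)) (τ (i + (k + 1))) (c (i + k)) := rfl
    set A := μ (τ i) (τ (i + k)) (c i) with hA
    set s1 := τ (i + k) with hs1
    set s2 := τ (i + (k + 1)) with hs2
    have f1 : ‖μ s2 (τ (i + n)) (c (i + (k + 1))) - μ s2 (τ (i + n)) (μ s1 s2 A)‖
        ≤ (1 + κ) * ((1 + κ) * ‖c (i + k) - A‖) := by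
      rw [hstep]
      refine (hlip _ _ (hτa _) m3 (hτb _) _ _).trans ?_
      gcongr
      exact hlip _ _ (hτa _) m2 (hτb _) _ _
    have f2 : ‖μ s2 (τ (i + n)) (μ s1 s2 A) - μ s2 (τ (i + n)) (μ (τ i) s2 (c i))‖
        ≤ (1 + κ) * (C * rho w p (τ i) (τ (i + n)) ^ 3) := by
      refine (hlip _ _ (hτa _) m3 (hτb _) _ _).trans ?_
      gcongr
      refine (hdef _ _ _ (hτa i) m1 m2 (hτb _) _).trans ?_
      gcongr
      · exact hw.rho_nonneg (h0 i) (m1.trans m2) (hT _)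
      · exact hw.rho_mono hp (h0 i) le_rfl (m1.trans m2) m3 (hT _)
    have f3 := hdef _ _ _ (hτa i) (m1.trans m2) m3 (hτb _) (c i)
    have tri : c (i + n) - μ (τ i) (τ (i + n)) (c i) =
        (c (i + n) - μ s2 (τ (i + n)) (c (i + (k + 1)))) +
        (μ s2 (τ (i + n)) (c (i + (k + 1))) - μ s2 (τ (i + n)) (μ s1 s2 A)) +
        (μ s2 (τ (i + n)) (μ s1 s2 A) - μ s2 (τ (i + n)) (μ (τ i) s2 (c i))) +
        (μ s2 (τ (i + n)) (μ (τ i) s2 (c i)) - μ (τ i) (τ (i + n)) (c i)) := by abel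
    rw [tri]
    refine (norm_add_le _ _).trans ?_
    refine (add_le_add_left (norm_add_le _ _) _).trans ?_
    refine (add_le_add_left (add_le_add_left (norm_add_le _ _) _) _).trans ?_
    have g1 := e1.trans (mul_le_mul_of_nonneg_left q1 hL0)
    have g2 := e2.trans (mul_le_mul_of_nonneg_left q2 hL0)
    have g3 : (1 + κ) * ((1 + κ) * ‖c (i + k) - A‖) ≤
        (1 + κ) * ((1 + κ) * (L * (halving p * rho w p (τ i) (τ (i + n)) ^ 3))) := by gcongr
    calc _ ≤ L * (halving p * rho w p (τ i) (τ (i + n)) ^ 3) +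
          (1 + κ) * ((1 + κ) * (L * (halving p * rho w p (τ i) (τ (i + n)) ^ 3))) +
          (1 + κ) * (C * rho w p (τ i) (τ (i + n)) ^ 3) +
          C * rho w p (τ i) (τ (i + n)) ^ 3 := by linarith
      _ = ((1 + (1 + κ) ^ 2) * halving p * L + (2 + κ) * C) *
          rho w p (τ i) (τ (i + n)) ^ 3 := by ring
      _ ≤ L * rho w p (τ i) (τ (i + n)) ^ 3 := by gcongr

/-- The sewing lemma: an almost flow is followed, up to an error of order three, by a path with
any given starting point. The path is a limit along an ultrafilter of Euler schemes over uniform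
partitions. -/
theorem exists_path_of_almostFlow [ProperSpace V] (hw : IsControl T w) (hp : 0 < p)
    (ha : 0 ≤ a) (hab : a ≤ b) (hb : b ≤ T) {μ : ℝ → ℝ → V → V} {κ C : ℝ} (hκ : 0 ≤ κ)
    (hκ1 : (1 + (1 + κ) ^ 2) * halving p < 1)
    (hdiag : ∀ s x, a ≤ s → s ≤ b → μ s s x = x)
    (hlip : ∀ s t, a ≤ s → s ≤ t → t ≤ b → ∀ x y, ‖μ s t x - μ s t y‖ ≤ (1 + κ) * ‖x - y‖)
    (hdef : ∀ s u t, a ≤ s → s ≤ u → u ≤ t → t ≤ b → ∀ x,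
      ‖μ u t (μ s u x) - μ s t x‖ ≤ C * rho w p s t ^ 3)
    (hcont : ∀ x, ContinuousOn (fun q : ℝ × ℝ => μ q.1 q.2 x)
      {q | a ≤ q.1 ∧ q.1 ≤ q.2 ∧ q.2 ≤ b}) (c₀ : V) :
    ∃ c : ℝ → V, c a = c₀ ∧ ∃ L, 0 ≤ L ∧ ∀ s t, a ≤ s → s ≤ t → t ≤ b →
      ‖c t - μ s t (c s)‖ ≤ L * rho w p s t ^ 3 := by
  set C' := max C 0
  set m := (1 + (1 + κ) ^ 2) * halving p with hm
  set L := (2 + κ) * C' / (1 - m) with hLdef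
  have hC' : 0 ≤ C' := le_max_right _ _
  have hL0 : 0 ≤ L := div_nonneg (by positivity) (by linarith)
  have hL : m * L + (2 + κ) * C' ≤ L := by
    have : (1 - m) ≠ 0 := by linarith
    apply le_of_eq
    rw [hLdef]; field_simp; ring
  let h : ℕ → ℝ := fun n => (b - a) / (n + 1)
  have hh0 : ∀ n, 0 ≤ h n := fun n => div_nonneg (by linarith) (by positivity)
  let τ : ℕ → ℕ → ℝ := fun n i => min (a + h n * i) b
  let idx : ℕ → ℝ → ℕ := fun n t => ⌊(t - a) / h n⌋₊
  let σ : ℕ → ℝ → ℝ := fun n t => τ n (idx n t)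
  have hτ : ∀ n, Monotone (τ n) := fun n i j hij => min_le_min_right _ (by
    have := hh0 n
    have : (i : ℝ) ≤ j := by exact_mod_cast hij
    gcongr)
  have hτa : ∀ n i, a ≤ τ n i := fun n i => le_min (by
    have := mul_nonneg (hh0 n) (Nat.cast_nonneg (α := ℝ) i); linarith) hab
  have hτb : ∀ n i, τ n i ≤ b := fun n i => min_le_right _ _
  have hidx : ∀ n s t, s ≤ t → idx n s ≤ idx n t := fun n s t hst => Nat.floor_le_floor (by
    have := hh0 n
    gcongr)
  have hσ1 : ∀ n t, a ≤ t → t ≤ b → σ n t ≤ t := fun n t h1 h2 => by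
    refine (min_le_left _ _).trans ?_
    rcases (hh0 n).eq_or_lt with h3 | h3
    · rw [← h3]; simpa using h1
    · have := Nat.floor_le (a := (t - a) / h n) (div_nonneg (by linarith) h3.le)
      rw [le_div_iff₀ h3] at this
      linarith
  have hσ2 : ∀ n t, a ≤ t → t ≤ b → t - h n ≤ σ n t := fun n t h1 h2 => by
    have hn := hh0 n
    refine le_min ?_ (by linarith)
    rcases hn.eq_or_lt with h3 | h3
    · have : b - a = 0 := by
        have : (b - a) / ((n : ℝ) + 1) = 0 := h3.symm
        rcases div_eq_zero_iff.1 this with h4 | h4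
        · exact h4
        · exact absurd h4 (by positivity)
      rw [← h3]; simp; linarith
    · have := Nat.lt_floor_add_one ((t - a) / h n)
      rw [div_lt_iff₀ h3] at this
      linarith
  have hh : Tendsto h atTop (𝓝 0) :=
    (tendsto_natCast_atTop_atTop.atTop_add tendsto_const_nhds).const_div_atTop _
  have hσ : ∀ t, a ≤ t → t ≤ b → Tendsto (fun n => σ n t) atTop (𝓝 t) := fun t h1 h2 =>
    tendsto_of_tendsto_of_tendsto_of_le_of_le (by simpa using hh.const_sub t) tendsto_const_nhds
      (fun n => hσ2 n t h1 h2) (fun n => hσ1 n t h1 h2)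
  let c : ℕ → ℝ → V := fun n t => eulerScheme μ (τ n) c₀ (idx n t)
  have hbound : ∀ n s t, a ≤ s → s ≤ t → t ≤ b →
      ‖c n t - μ (σ n s) (σ n t) (c n s)‖ ≤ L * rho w p (σ n s) (σ n t) ^ 3 := by
    intro n s t h1 h2 h3
    obtain ⟨k, hk⟩ := Nat.exists_eq_add_of_le (hidx n s t h2)
    have := eulerScheme_bound hw hp ha hb hκ hC' hL0 hL hdiag hlip
      (fun s u t h1 h2 h3 h4 x => (hdef s u t h1 h2 h3 h4 x).trans (by
        have := hw.rho_nonneg (p := p) (ha.trans h1) (h2.trans h3) (h4.trans hb)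
        gcongr
        exact le_max_left _ _)) (τ n) (hτ n) (hτa n) (hτb n) c₀ k (idx n s)
    rw [← hk] at this
    exact this
  have hca : ∀ n, c n a = c₀ := fun n => by simp [c, idx, eulerScheme]
  have hσa : ∀ n, σ n a = a := fun n => le_antisymm (hσ1 n a le_rfl hab) (hτa n _)
  have hK := isCompact_triangle a b
  obtain ⟨B, hB⟩ := hK.exists_bound_of_continuousOn (hcont c₀)
  -- the Euler schemes are uniformly bounded, so that they converge along any ultrafilter
  have hball : ∀ t, a ≤ t → t ≤ b → ∀ n, c n t ∈ Metric.closedBall (0 : V)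
      (B + L * rho w p a b ^ 3) := by
    intro t h1 h2 n
    have e1 := hbound n a t le_rfl h1 h2
    rw [hca, hσa] at e1
    have e2 := hB (a, σ n t) ⟨le_rfl, hτa n _, hτb n _⟩
    have e3 : rho w p a (σ n t) ^ 3 ≤ rho w p a b ^ 3 := by
      gcongr
      · exact hw.rho_nonneg ha (hτa n _) ((hτb n _).trans hb)
      · exact hw.rho_mono hp ha le_rfl (hτa n _) (hτb n _) hb
    have e4 := mul_le_mul_of_nonneg_left e3 hL0
    have e5 := norm_add_le (c n t - μ a (σ n t) c₀) (μ a (σ n t) c₀)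
    rw [sub_add_cancel] at e5
    rw [mem_closedBall_zero_iff]
    simp only at e2
    linarith
  have hlim : ∀ t, ∃ y, a ≤ t → t ≤ b →
      Tendsto (fun n => c n t) (hyperfilter ℕ : Filter ℕ) (𝓝 y) := by
    intro t
    by_cases h1 : a ≤ t ∧ t ≤ b
    · obtain ⟨y, -, hy⟩ := (isCompact_closedBall (0 : V)
        (B + L * rho w p a b ^ 3)).ultrafilter_le_nhds'
        ((hyperfilter ℕ).map (fun n => c n t)) (by
          rw [Ultrafilter.mem_map]
          exact Filter.univ_mem' (hball t h1.1 h1.2))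
      exact ⟨y, fun _ _ => hy⟩
    · exact ⟨0, fun h2 h3 => (h1 ⟨h2, h3⟩).elim⟩
  choose γ hγ using hlim
  have hle : (hyperfilter ℕ : Filter ℕ) ≤ atTop := by
    rw [← Nat.cofinite_eq_atTop]; exact hyperfilter_le_cofinite
  refine ⟨γ, ?_, L, hL0, ?_⟩
  · refine tendsto_nhds_unique (hγ a le_rfl hab) ?_
    simp only [hca]
    exact tendsto_const_nhds
  · intro s t h1 h2 h3
    have hst : Tendsto (fun n => (σ n s, σ n t)) (hyperfilter ℕ : Filter ℕ)
        (𝓝[{q : ℝ × ℝ | a ≤ q.1 ∧ q.1 ≤ q.2 ∧ q.2 ≤ b}] (s, t)) := by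
      refine tendsto_nhdsWithin_iff.2 ⟨?_, Eventually.of_forall fun n => ⟨hτa n _, ?_, hτb n _⟩⟩
      · exact ((hσ s h1 (h2.trans h3)).mono_left hle).prodMk_nhds
          ((hσ t (h1.trans h2) h3).mono_left hle)
      · exact hτ n (hidx n s t h2)
    have t1 : Tendsto (fun n => μ (σ n s) (σ n t) (γ s)) (hyperfilter ℕ : Filter ℕ)
        (𝓝 (μ s t (γ s))) := ((hcont (γ s)) (s, t) ⟨h1, h2, h3⟩).tendsto.comp hst
    have t2 : Tendsto (fun n => μ (σ n s) (σ n t) (c n s) - μ (σ n s) (σ n t) (γ s))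
        (hyperfilter ℕ : Filter ℕ) (𝓝 0) := by
      refine squeeze_zero_norm (fun n => hlip _ _ (hτa n _) (hτ n (hidx n s t h2)) (hτb n _) _ _) ?_
      have := ((hγ s h1 (h2.trans h3)).sub_const (γ s)).norm.const_mul (1 + κ)
      simpa using this
    have t3 : Tendsto (fun n => μ (σ n s) (σ n t) (c n s)) (hyperfilter ℕ : Filter ℕ)
        (𝓝 (μ s t (γ s))) := by simpa using t2.add t1
    have t4 : Tendsto (fun n => rho w p (σ n s) (σ n t)) (hyperfilter ℕ : Filter ℕ)
        (𝓝 (rho w p s t)) := by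
      refine (((hw.rho_continuousOn (p := p) hp) (s, t)
        ⟨ha.trans h1, h2, h3.trans hb⟩).tendsto).comp
        (hst.mono_right (nhdsWithin_mono _ ?_))
      exact fun q hq => ⟨ha.trans hq.1, hq.2.1, hq.2.2.trans hb⟩
    exact le_of_tendsto_of_tendsto ((hγ t (h1.trans h2) h3).sub t3).norm
      ((t4.pow 3).const_mul L) (Eventually.of_forall fun n => hbound n s t h1 h2 h3)

/-- The linear sewing lemma: a continuous almost additive function differs from an additive one
by an error of order three. -/
theorem exists_additive_of_almostAdditive [ProperSpace V] (hw : IsControl T w) (hp : 0 < p)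
    (hp3 : p < 3) (ha : 0 ≤ a) (hab : a ≤ b) (hb : b ≤ T) {ξ : ℝ → ℝ → V} {C : ℝ}
    (hdiag : ∀ s, a ≤ s → s ≤ b → ξ s s = 0)
    (hdef : ∀ s u t, a ≤ s → s ≤ u → u ≤ t → t ≤ b →
      ‖ξ s u + ξ u t - ξ s t‖ ≤ C * rho w p s t ^ 3)
    (hcont : ContinuousOn (fun q : ℝ × ℝ => ξ q.1 q.2) {q | a ≤ q.1 ∧ q.1 ≤ q.2 ∧ q.2 ≤ b}) :
    ∃ c : ℝ → V, c a = 0 ∧ ∃ L, 0 ≤ L ∧ ∀ s t, a ≤ s → s ≤ t → t ≤ b →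
      ‖c t - c s - ξ s t‖ ≤ L * rho w p s t ^ 3 := by
  obtain ⟨c, h1, L, hL, h2⟩ := exists_path_of_almostFlow hw hp ha hab hb
    (μ := fun s t x => x + ξ s t) (κ := 0) (C := C) le_rfl
    (by norm_num; linarith [halving_lt hp hp3])
    (fun s x h1 h2 => by simp [hdiag s h1 h2]) (fun s t _ _ _ x y => by simp)
    (fun s u t h1 h2 h3 h4 x => by
      convert hdef s u t h1 h2 h3 h4 using 2
      abel)
    (fun x => continuousOn_const.add hcont) 0
  refine ⟨c, h1, L, hL, fun s t h3 h4 h5 => ?_⟩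
  rw [sub_sub]
  exact h2 s t h3 h4 h5

end Sewing

/-! ### Bilinear maps and tensors -/

section Tensor

variable {m n : ℕ} {W W₁ W₂ : Type*} [NormedAddCommGroup W] [InnerProductSpace ℝ W]
  [NormedAddCommGroup W₁] [InnerProductSpace ℝ W₁] [NormedAddCommGroup W₂] [InnerProductSpace ℝ W₂]
  {W₃ W₄ : Type*} [NormedAddCommGroup W₃] [InnerProductSpace ℝ W₃]
  [NormedAddCommGroup W₄] [InnerProductSpace ℝ W₄]

@[simp] lemma tensorLift_tmul (A : W₁ →L[ℝ] W₁ →L[ℝ] W) (x y : W₁) :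
    tensorLift A (x ⊗ₜ[ℝ] y) = A x y := by simp [tensorLift]

lemma tensorLift_add (A B : W₁ →L[ℝ] W₁ →L[ℝ] W) (t : W₁ ⊗[ℝ] W₁) :
    tensorLift (A + B) t = tensorLift A t + tensorLift B t := by
  induction t with
  | zero => simp
  | tmul x y => simp
  | add x y hx hy => simp only [map_add, hx, hy]; abel

lemma tensorLift_sub (A B : W₁ →L[ℝ] W₁ →L[ℝ] W) (t : W₁ ⊗[ℝ] W₁) :
    tensorLift (A - B) t = tensorLift A t - tensorLift B t := by
  induction t with
  | zero => simp
  | tmul x y => simp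
  | add x y hx hy => simp only [map_add, hx, hy]; abel

lemma norm_tensorLift_le (A : Eu m →L[ℝ] Eu m →L[ℝ] W) (t : Eu m ⊗[ℝ] Eu m) :
    ‖tensorLift A t‖ ≤ (m : ℝ) ^ 2 * ‖A‖ * ‖t‖ := by
  let e := (EuclideanSpace.basisFun (Fin m) ℝ)
  let b := e.tensorProduct e
  have h1 : ∀ i, ‖tensorLift A (b i)‖ ≤ ‖A‖ := fun ⟨i, j⟩ => by
    rw [OrthonormalBasis.tensorProduct_apply, tensorLift_tmul]
    refine (A.le_opNorm₂ _ _).trans ?_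
    simp
  have h2 : ∀ i, ‖b.repr t i‖ ≤ ‖t‖ := fun i => by
    rw [b.repr_apply_apply]
    refine (norm_inner_le_norm _ _).trans ?_
    simp
  calc ‖tensorLift A t‖ = ‖tensorLift A (∑ i, b.repr t i • b i)‖ := by rw [b.sum_repr]
    _ = ‖∑ i, b.repr t i • tensorLift A (b i)‖ := by simp only [map_sum, map_smul]
    _ ≤ ∑ i, ‖b.repr t i • tensorLift A (b i)‖ := norm_sum_le _ _
    _ ≤ ∑ _i : Fin m × Fin m, ‖t‖ * ‖A‖ := Finset.sum_le_sum fun i _ => by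
        rw [norm_smul]
        have := h1 i
        have := h2 i
        gcongr
    _ = (m : ℝ) ^ 2 * ‖A‖ * ‖t‖ := by simp; ring

lemma norm_map_le (A : W₁ →L[ℝ] W₃) (B : W₂ →L[ℝ] W₄) (t : W₁ ⊗[ℝ] W₂) :
    ‖TensorProduct.map A.toLinearMap B.toLinearMap t‖ ≤ ‖A‖ * ‖B‖ * ‖t‖ := by
  rw [← TensorProduct.mapL_apply]
  exact ((TensorProduct.mapL A B).le_opNorm t).trans
    (mul_le_mul_of_nonneg_right (TensorProduct.norm_mapL_le A B) (norm_nonneg _))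

lemma map_sub_left (A B : W₁ →L[ℝ] W₃) (C : W₂ →L[ℝ] W₄) (t : W₁ ⊗[ℝ] W₂) :
    TensorProduct.map (A - B).toLinearMap C.toLinearMap t =
      TensorProduct.map A.toLinearMap C.toLinearMap t -
      TensorProduct.map B.toLinearMap C.toLinearMap t := by
  induction t with
  | zero => simp
  | tmul x y => simp [TensorProduct.sub_tmul]
  | add x y hx hy => simp only [map_add, hx, hy]; abel

lemma map_sub_right (A : W₁ →L[ℝ] W₃) (B C : W₂ →L[ℝ] W₄) (t : W₁ ⊗[ℝ] W₂) :
    TensorProduct.map A.toLinearMap (B - C).toLinearMap t =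
      TensorProduct.map A.toLinearMap B.toLinearMap t -
      TensorProduct.map A.toLinearMap C.toLinearMap t := by
  induction t with
  | zero => simp
  | tmul x y => simp [TensorProduct.tmul_sub]
  | add x y hx hy => simp only [map_add, hx, hy]; abel

lemma continuousOn_map {α : Type*} [TopologicalSpace α] {s : Set α} {A : α → W₁ →L[ℝ] W}
    {t : α → W₁ ⊗[ℝ] W₁} (hA : ContinuousOn A s) (ht : ContinuousOn t s) :
    ContinuousOn (fun x => TensorProduct.map (A x).toLinearMap (A x).toLinearMap (t x)) s := by
  intro y hy
  refine tendsto_iff_norm_sub_tendsto_zero.2 ?_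
  refine squeeze_zero (fun _ => norm_nonneg _) (g := fun x => ‖A x - A y‖ * ‖A x‖ * ‖t x‖ +
    ‖A y‖ * ‖A x - A y‖ * ‖t x‖ + ‖A y‖ * ‖A y‖ * ‖t x - t y‖) (fun x => ?_) ?_
  · have e : TensorProduct.map (A x).toLinearMap (A x).toLinearMap (t x) -
        TensorProduct.map (A y).toLinearMap (A y).toLinearMap (t y) =
        TensorProduct.map (A x - A y).toLinearMap (A x).toLinearMap (t x) +
        TensorProduct.map (A y).toLinearMap (A x - A y).toLinearMap (t x) +
        TensorProduct.map (A y).toLinearMap (A y).toLinearMap (t x - t y) := by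
      rw [map_sub_left, map_sub_right, map_sub]
      abel
    rw [e]
    exact norm_add₃_le.trans (add_le_add (add_le_add (norm_map_le _ _ _) (norm_map_le _ _ _))
      (norm_map_le _ _ _))
  · have h1 := (hA y hy).tendsto
    have h2 := (ht y hy).tendsto
    have h3 := (h1.sub_const (A y)).norm
    have h4 := (h2.sub_const (t y)).norm
    simp only [sub_self, norm_zero] at h3 h4
    simpa using (((h3.mul h1.norm).mul h2.norm).add ((h3.const_mul ‖A y‖).mul h2.norm)).add
      (h4.const_mul (‖A y‖ * ‖A y‖))

lemma comm_map (A : W₁ →L[ℝ] W₃) (B : W₂ →L[ℝ] W₄) (t : W₁ ⊗[ℝ] W₂) :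
    TensorProduct.comm ℝ W₃ W₄ (TensorProduct.map A.toLinearMap B.toLinearMap t) =
      TensorProduct.map B.toLinearMap A.toLinearMap (TensorProduct.comm ℝ W₁ W₂ t) := by
  induction t with
  | zero => simp
  | tmul x y => simp
  | add x y hx hy => simp only [map_add, hx, hy]

lemma map_map (A : W₁ →L[ℝ] W₃) (B : W₂ →L[ℝ] W₄) (A' : W →L[ℝ] W₁) (B' : W →L[ℝ] W₂)
    (t : W ⊗[ℝ] W) :
    TensorProduct.map A.toLinearMap B.toLinearMap
      (TensorProduct.map A'.toLinearMap B'.toLinearMap t) =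
      TensorProduct.map (A.comp A').toLinearMap (B.comp B').toLinearMap t := by
  induction t with
  | zero => simp
  | tmul x y => simp
  | add x y hx hy => simp only [map_add, hx, hy]

lemma tensorLift_map (A : W₁ →L[ℝ] W₁ →L[ℝ] W) (B C : W₂ →L[ℝ] W₁) (t : W₂ ⊗[ℝ] W₂) :
    tensorLift A (TensorProduct.map B.toLinearMap C.toLinearMap t) =
      tensorLift (A.bilinearComp B C) t := by
  induction t with
  | zero => simp
  | tmul x y => simp
  | add x y hx hy => simp only [map_add, hx, hy]

variable {T p a b S : ℝ} {w : ℝ → ℝ → ℝ}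

lemma IsO.tmul {k l : ℕ} {g : ℝ → ℝ → W} {g' : ℝ → ℝ → W₁} (h : IsO w p a b k g)
    (h' : IsO w p a b l g') :
    IsO w p a b (k + l) (fun s t => g s t ⊗ₜ[ℝ] g' s t) :=
  h.of_le_mul h' 1 fun s t _ _ _ => by rw [one_mul, TensorProduct.norm_tmul]

lemma IsO.clm_apply {k l : ℕ} {W W₁ : Type*} [NormedAddCommGroup W] [NormedSpace ℝ W]
    [NormedAddCommGroup W₁] [NormedSpace ℝ W₁] {g : ℝ → ℝ → W₁ →L[ℝ] W} {g' : ℝ → ℝ → W₁}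
    (h : IsO w p a b k g) (h' : IsO w p a b l g') :
    IsO w p a b (k + l) (fun s t => g s t (g' s t)) :=
  h.of_le_mul h' 1 fun s t _ _ _ => by rw [one_mul]; exact (g s t).le_opNorm _

lemma IsO.tensorLift {k l : ℕ} {g : ℝ → ℝ → Eu m →L[ℝ] Eu m →L[ℝ] W}
    {g' : ℝ → ℝ → Eu m ⊗[ℝ] Eu m} (h : IsO w p a b k g) (h' : IsO w p a b l g') :
    IsO w p a b (k + l) (fun s t => RoughManifold.tensorLift (g s t) (g' s t)) :=
  h.of_le_mul h' ((m : ℝ) ^ 2) fun s t _ _ _ => by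
    rw [← mul_assoc]; exact norm_tensorLift_le _ _

lemma IsO.map {j k l : ℕ} {g : ℝ → ℝ → W₁ →L[ℝ] W₃} {g' : ℝ → ℝ → W₂ →L[ℝ] W₄}
    {t : ℝ → ℝ → W₁ ⊗[ℝ] W₂}
    (h : IsO w p a b j g) (h' : IsO w p a b k g') (ht : IsO w p a b l t) :
    IsO w p a b (j + k + l) (fun u v => TensorProduct.map (g u v).toLinearMap
      (g' u v).toLinearMap (t u v)) :=
  (h.of_le_mul h' (g := fun u v => ‖g u v‖ * ‖g' u v‖) 1
    (fun u v _ _ _ => by simp)).of_le_mul ht 1 fun u v _ _ _ => by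
      rw [one_mul, Real.norm_of_nonneg (by positivity)]; exact norm_map_le _ _ _

lemma IsO.comm {k : ℕ} {g : ℝ → ℝ → W ⊗[ℝ] W₁} (h : IsO w p a b k g) :
    IsO w p a b k (fun s t => TensorProduct.comm ℝ W W₁ (g s t)) :=
  h.of_le 1 fun s t _ _ _ => by
    rw [one_mul]; exact (TensorProduct.norm_comm (𝕜 := ℝ) (E := W) (F := W₁) (g s t)).le

end Tensor

/-! ### Rough paths -/

section RoughPath

variable {m n : ℕ} {T p a b S : ℝ} {w : ℝ → ℝ → ℝ} {W : Type*} [NormedAddCommGroup W]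

lemma continuousOn_of_isO (hw : IsControl T w) (hp : 0 < p) (ha : 0 ≤ a) (hb : b ≤ T) {k : ℕ}
    {g : ℝ → W} (h : IsO w p a b (k + 1) (fun s t => g t - g s)) : ContinuousOn g (Icc a b) := by
  have ht : Tendsto (fun q : ℝ × ℝ => g q.2 - g q.1) (nearDiag a b) (𝓝 0) := by
    refine IsBigO.trans_tendsto h ?_
    simpa using (hw.tendsto_nearDiag hp ha hb).pow (k + 1)
  rw [Metric.continuousOn_iff]
  intro t ht1 ε hε
  obtain ⟨δ, hδ, h⟩ := eventually_nearDiag.1 ((Metric.tendsto_nhds.1 ht) ε hε)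
  refine ⟨δ, hδ, fun s hs hd => ?_⟩
  rw [Real.dist_eq, abs_lt] at hd
  rcases le_total s t with h1 | h1
  · have := h s t hs.1 h1 ht1.2 (by linarith)
    rw [dist_zero_right] at this
    rwa [dist_comm, dist_eq_norm]
  · have := h t s ht1.1 h1 hs.2 (by linarith)
    rw [dist_zero_right] at this
    rwa [dist_eq_norm]

lemma exists_bound_path {g : ℝ → W} (h : ContinuousOn g (Icc a b)) :
    ∃ B, 0 ≤ B ∧ ∀ t, a ≤ t → t ≤ b → ‖g t‖ ≤ B := by
  obtain ⟨B, hB⟩ := isCompact_Icc.exists_bound_of_continuousOn h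
  exact ⟨max B 0, le_max_right _ _, fun t h1 h2 => (hB t ⟨h1, h2⟩).trans (le_max_left _ _)⟩

variable {V : Type*} [NormedAddCommGroup V] [InnerProductSpace ℝ V] {X X' : PathData V}

lemma PathData.incr_add (X : PathData V) (s u t : ℝ) : X.incr s t = X.incr s u + X.incr u t := by
  simp [PathData.incr]

lemma IsWG.area_diag (hX : IsWG p w S X) {s : ℝ} (h0 : 0 ≤ s) (h1 : s ≤ S) : X.area s s = 0 := by
  have := hX.chen s s s h0 le_rfl le_rfl h1
  simpa [PathData.incr] using this

lemma IsWG.mono (hX : IsWG p w S X) {S' : ℝ} (h : S' ≤ S) : IsWG p w S' X where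
  path_continuous := hX.path_continuous.mono (Icc_subset_Icc_right h)
  area_continuous := hX.area_continuous.mono fun _ hq => ⟨hq.1, hq.2.1, hq.2.2.trans h⟩
  chen s u t h1 h2 h3 h4 := hX.chen s u t h1 h2 h3 (h4.trans h)
  path_bound := hX.path_bound.imp fun _ hC s t h1 h2 h3 => hC s t h1 h2 (h3.trans h)
  area_bound := hX.area_bound.imp fun _ hC s t h1 h2 h3 => hC s t h1 h2 (h3.trans h)
  symm s t h1 h2 h3 := hX.symm s t h1 h2 (h3.trans h)

lemma IsWG.symm' (hX : IsWG p w S X) {s t : ℝ} (h0 : 0 ≤ s) (h1 : s ≤ t) (h2 : t ≤ S) :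
    X.area s t + TensorProduct.comm ℝ V V (X.area s t) = X.incr s t ⊗ₜ[ℝ] X.incr s t :=
  smul_right_injective _ (by norm_num : (1 / 2 : ℝ) ≠ 0) (hX.symm s t h0 h1 h2)

/-- The bounds on a rough path, with a common constant and including the diagonal. -/
lemma IsWG.exists_bound (hw : IsControl T w) (hS : S ≤ T) (hX : IsWG p w S X) :
    ∃ K, 0 ≤ K ∧ ∀ s t, 0 ≤ s → s ≤ t → t ≤ S →
      ‖X.incr s t‖ ≤ K * rho w p s t ∧ ‖X.area s t‖ ≤ K * rho w p s t ^ 2 := by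
  obtain ⟨C, hC⟩ := hX.path_bound
  obtain ⟨D, hD⟩ := hX.area_bound
  refine ⟨max 0 (max C D), le_max_left _ _, fun s t h1 h2 h3 => ?_⟩
  have h0 := hw.rho_nonneg (p := p) h1 h2 (h3.trans hS)
  rcases h2.eq_or_lt with rfl | h4
  · constructor
    · simp only [PathData.incr, sub_self, norm_zero]; positivity
    · simp only [hX.area_diag h1 h3, norm_zero]; positivity
  · have e1 := hC s t h1 h4 h3
    have e2 := hD s t h1 h4 h3
    have e3 := hw.rpow_eq (p := p) 2 h1 h2 (h3.trans hS)
    push_cast at e3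
    rw [e3] at e2
    constructor
    · refine e1.trans ?_
      change C * rho w p s t ≤ _
      gcongr
      exact (le_max_left _ _).trans (le_max_right _ _)
    · refine e2.trans ?_
      gcongr
      exact (le_max_right _ _).trans (le_max_right _ _)

lemma IsWG.isO_incr (hw : IsControl T w) (hS : S ≤ T) (hX : IsWG p w S X) :
    IsO w p 0 S 1 X.incr := by
  obtain ⟨K, _, h⟩ := hX.exists_bound hw hS
  exact hw.isO_of_bound le_rfl hS K fun s t h1 h2 h3 => by
    rw [pow_one]; exact (h s t h1 h2 h3).1

lemma IsWG.isO_area (hw : IsControl T w) (hS : S ≤ T) (hX : IsWG p w S X) :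
    IsO w p 0 S 2 X.area := by
  obtain ⟨K, _, h⟩ := hX.exists_bound hw hS
  exact hw.isO_of_bound le_rfl hS K fun s t h1 h2 h3 => (h s t h1 h2 h3).2

/-- The second level of a rough path is determined by its first level and its local
approximation. -/
lemma area_eq_of_approx (hw : IsControl T w) (hp : 0 < p) (hp3 : p < 3) (hS : S ≤ T)
    (hX : IsWG p w S X) (hX' : IsWG p w S X') (hpath : ∀ t, 0 ≤ t → t ≤ S → X.path t = X'.path t)
    {h : ℝ → ℝ → V ⊗[ℝ] V} (h1 : Approx p w S X.area h) (h2 : Approx p w S X'.area h) :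
    ∀ s t, 0 ≤ s → s ≤ t → t ≤ S → X.area s t = X'.area s t := by
  have hd : IsO w p 0 S 3 (fun s t => X.area s t - X'.area s t) :=
    (((hw.approx_iff hS).1 h1).sub ((hw.approx_iff hS).1 h2)).congr fun s t _ _ _ => by abel
  intro s t h3 h4 h5
  refine sub_eq_zero.1 (hd.eq_zero_of_additive hw hp hp3 le_rfl hS ?_ s t h3 h4 h5)
  intro s u t h3 h4 h5 h6
  rw [hX.chen s u t h3 h4 h5 h6, hX'.chen s u t h3 h4 h5 h6]
  simp only [PathData.incr, hpath s h3 (h4.trans (h5.trans h6)), hpath u (h3.trans h4) (h5.trans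
    h6),
    hpath t (h3.trans (h4.trans h5)) h6]
  abel

/-- The germ of the second level of a lift is almost additive. -/
lemma lift_defect (hw : IsControl T w) (hp : 0 < p) (hS : S ≤ T)
    {Y : PathData (Eu m)} (hY : IsWG p w S Y) {L : ℝ → Eu m →L[ℝ] Eu n} {x : ℝ → Eu n}
    {K K' J : ℝ} (hK : 0 ≤ K) (hK'0 : 0 ≤ K') (hJ : 0 ≤ J)
    (hYb : ∀ s t, 0 ≤ s → s ≤ t → t ≤ S →
      ‖Y.incr s t‖ ≤ J * rho w p s t ∧ ‖Y.area s t‖ ≤ J * rho w p s t ^ 2)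
    (hL : ∀ s, 0 ≤ s → s ≤ S → ‖L s‖ ≤ K)
    (hL' : ∀ s t, 0 ≤ s → s ≤ t → t ≤ S → ‖L t - L s‖ ≤ K * rho w p s t)
    (hx : ∀ s t, 0 ≤ s → s ≤ t → t ≤ S → ‖x t - x s - L s (Y.incr s t)‖ ≤ K * rho w p s t ^ 2)
    (hxb : ∀ s t, 0 ≤ s → s ≤ t → t ≤ S → ‖x t - x s‖ ≤ K' * rho w p s t)
    {ξ : ℝ → ℝ → Eu n ⊗[ℝ] Eu n} (hξ : ∀ s t, ξ s t = (x s - x 0) ⊗ₜ[ℝ] (x t - x s) +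
      TensorProduct.map (L s).toLinearMap (L s).toLinearMap (Y.area s t))
    {s u t : ℝ} (h1 : 0 ≤ s) (h2 : s ≤ u) (h3 : u ≤ t) (h4 : t ≤ S) :
    ‖ξ s u + ξ u t - ξ s t‖ ≤ (K * K' + K * J * K + K * J * (K * J) + (K * K * J + K * K * J)) *
      rho w p s t ^ 3 := by
  have hr0 : ∀ s t, 0 ≤ s → s ≤ t → t ≤ S → 0 ≤ rho w p s t := fun s t h1 h2 h3 =>
    hw.rho_nonneg h1 h2 (h3.trans hS)
  have hst := h2.trans h3
  have e0 := hr0 s t h1 hst h4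
  have r1 : rho w p s u ≤ rho w p s t := hw.rho_mono hp h1 le_rfl h2 h3 (h4.trans hS)
  have r2 : rho w p u t ≤ rho w p s t := hw.rho_mono hp h1 h2 h3 le_rfl (h4.trans hS)
  have r10 := hr0 s u h1 h2 (h3.trans h4)
  have r20 := hr0 u t (h1.trans h2) h3 h4
  set r := rho w p s t
  have bx1 := (hx s u h1 h2 (h3.trans h4)).trans
    (mul_le_mul_of_nonneg_left (pow_le_pow_left₀ r10 r1 2) hK)
  have bx2 := (hx u t (h1.trans h2) h3 h4).trans
    (mul_le_mul_of_nonneg_left (pow_le_pow_left₀ r20 r2 2) hK)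
  have bx3 := (hxb u t (h1.trans h2) h3 h4).trans (mul_le_mul_of_nonneg_left r2 hK'0)
  have by1 := (hYb s u h1 h2 (h3.trans h4)).1.trans (mul_le_mul_of_nonneg_left r1 hJ)
  have by2 := (hYb u t (h1.trans h2) h3 h4).1.trans (mul_le_mul_of_nonneg_left r2 hJ)
  have by3 := (hYb u t (h1.trans h2) h3 h4).2.trans
    (mul_le_mul_of_nonneg_left (pow_le_pow_left₀ r20 r2 2) hJ)
  have bL := (hL' s u h1 h2 (h3.trans h4)).trans (mul_le_mul_of_nonneg_left r1 hK)
  have bs := hL s h1 (hst.trans h4)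
  have bu := hL u (h1.trans h2) (h3.trans h4)
  have bLy : ‖L s (Y.incr s u)‖ ≤ K * (J * r) :=
    ((L s).le_opNorm _).trans (mul_le_mul bs by1 (norm_nonneg _) hK)
  have bLd : ‖(L u - L s) (Y.incr u t)‖ ≤ K * r * (J * r) :=
    ((L u - L s).le_opNorm _).trans (mul_le_mul bL by2 (norm_nonneg _) (by positivity))
  have key : ξ s u + ξ u t - ξ s t =
      (x u - x s - L s (Y.incr s u)) ⊗ₜ[ℝ] (x t - x u) +
      L s (Y.incr s u) ⊗ₜ[ℝ] (x t - x u - L u (Y.incr u t)) +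
      L s (Y.incr s u) ⊗ₜ[ℝ] ((L u - L s) (Y.incr u t)) +
      (TensorProduct.map (L u - L s).toLinearMap (L u).toLinearMap (Y.area u t) +
        TensorProduct.map (L s).toLinearMap (L u - L s).toLinearMap (Y.area u t)) := by
    simp only [hξ, hY.chen s u t h1 h2 h3 h4, map_add, TensorProduct.map_tmul,
      map_sub_left, map_sub_right, ContinuousLinearMap.coe_coe, sub_apply,
      TensorProduct.sub_tmul, TensorProduct.tmul_sub]
    abel
  rw [key]
  have n1 : ‖(x u - x s - L s (Y.incr s u)) ⊗ₜ[ℝ] (x t - x u)‖ ≤ K * r ^ 2 * (K' * r) := by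
    rw [TensorProduct.norm_tmul]; gcongr
  have n2 : ‖L s (Y.incr s u) ⊗ₜ[ℝ] (x t - x u - L u (Y.incr u t))‖
      ≤ K * (J * r) * (K * r ^ 2) := by
    rw [TensorProduct.norm_tmul]; gcongr
  have n3 : ‖L s (Y.incr s u) ⊗ₜ[ℝ] ((L u - L s) (Y.incr u t))‖
      ≤ K * (J * r) * (K * r * (J * r)) := by
    rw [TensorProduct.norm_tmul]; gcongr
  have n4 : ‖TensorProduct.map (L u - L s).toLinearMap (L u).toLinearMap (Y.area u t)‖
      ≤ (K * r) * K * (J * r ^ 2) := (norm_map_le _ _ _).trans (by gcongr)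
  have n5 : ‖TensorProduct.map (L s).toLinearMap (L u - L s).toLinearMap (Y.area u t)‖
      ≤ K * (K * r) * (J * r ^ 2) := (norm_map_le _ _ _).trans (by gcongr)
  refine (norm_add_le _ _).trans ((add_le_add (norm_add₃_le.trans
    (add_le_add (add_le_add n1 n2) n3)) ((norm_add_le _ _).trans (add_le_add n4 n5))).trans ?_)
  apply le_of_eq
  ring

/-- The symmetric part of the second level of a lift is determined by the first level: the defect
is additive and of order three. -/
lemma symm_of_isO (hw : IsControl T w) (hp : 0 < p) (hp3 : p < 3) (hS : S ≤ T)
    {Y : PathData (Eu m)} (hY : IsWG p w S Y) {L : ℝ → Eu m →L[ℝ] Eu n}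
    (hL : IsO w p 0 S 0 (fun s _ : ℝ => L s)) {X : PathData (Eu n)}
    (hchen : ∀ s u t, 0 ≤ s → s ≤ u → u ≤ t → t ≤ S →
      X.area s t = X.area s u + X.area u t + X.incr s u ⊗ₜ[ℝ] X.incr u t)
    (hd : IsO w p 0 S 2 (fun s t => X.incr s t - L s (Y.incr s t))) (hi : IsO w p 0 S 1 X.incr)
    (hq : IsO w p 0 S 3 (fun s t => X.area s t -
      TensorProduct.map (L s).toLinearMap (L s).toLinearMap (Y.area s t))) :
    ∀ s t, 0 ≤ s → s ≤ t → t ≤ S → X.area s t + TensorProduct.comm ℝ (Eu n) (Eu n) (X.area s t) =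
      X.incr s t ⊗ₜ[ℝ] X.incr s t := by
  intro s t h1 h2 h3
  refine sub_eq_zero.1 ?_
  refine IsO.eq_zero_of_additive (g := fun s t => X.area s t +
    TensorProduct.comm ℝ (Eu n) (Eu n) (X.area s t) - X.incr s t ⊗ₜ[ℝ] X.incr s t)
    hw hp hp3 le_rfl hS ?_ ?_ s t h1 h2 h3
  · have hLy : IsO w p 0 S 1 (fun s t => L s (Y.incr s t)) :=
      hL.clm_apply (hY.isO_incr hw hS)
    have o1 := (hq.add hq.comm).sub ((hd.tmul hi).add (hLy.tmul hd))
    refine o1.congr fun s t h1 h2 h3 => ?_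
    have e := congrArg (TensorProduct.map (L s).toLinearMap (L s).toLinearMap)
      (hY.symm' h1 h2 h3)
    rw [map_add, ← comm_map, TensorProduct.map_tmul, ContinuousLinearMap.coe_coe] at e
    simp only [map_sub, TensorProduct.sub_tmul, TensorProduct.tmul_sub, ← e]
    abel
  · intro s u t h1 h2 h3 h4
    rw [hchen s u t h1 h2 h3 h4, X.incr_add s u t]
    simp only [map_add, TensorProduct.comm_tmul, TensorProduct.add_tmul, TensorProduct.tmul_add]
    abel

/-- Chen's identity, the symmetry condition and bounds near the diagonal make a weakly geometric
rough path. -/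
lemma isWG_of_isO (hw : IsControl T w) (hp : 0 < p) (hS : S ≤ T)
    {V : Type*} [NormedAddCommGroup V] [InnerProductSpace ℝ V] {X : PathData V}
    (hchen : ∀ s u t, 0 ≤ s → s ≤ u → u ≤ t → t ≤ S →
      X.area s t = X.area s u + X.area u t + X.incr s u ⊗ₜ[ℝ] X.incr u t)
    (hi : IsO w p 0 S 1 X.incr) (ha : IsO w p 0 S 2 X.area)
    (hsymm : ∀ s t, 0 ≤ s → s ≤ t → t ≤ S →
      X.area s t + TensorProduct.comm ℝ V V (X.area s t) = X.incr s t ⊗ₜ[ℝ] X.incr s t) :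
    IsWG p w S X := by
  have hxc : ContinuousOn X.path (Icc 0 S) := continuousOn_of_isO (k := 0) hw hp le_rfl hS hi
  have h0 : IsO w p 0 S 0 (fun s _ : ℝ => X.incr 0 s) := by
    obtain ⟨B, hB, hB'⟩ := exists_bound_path (hxc.sub (continuousOn_const (c := X.path 0)))
    exact isO_of_bounded B fun s t h1 h2 h3 => hB' s h1 (h2.trans h3)
  have hAc : ContinuousOn (fun t => X.area 0 t) (Icc 0 S) := by
    refine continuousOn_of_isO (k := 0) hw hp le_rfl hS ?_
    have h2 := h0.tmul hi
    refine ((ha.weaken hw hp le_rfl hS (l := 1) (by norm_num)).add h2).congr fun s t h1 h2 h3 => ?_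
    rw [hchen 0 s t le_rfl h1 h2 h3]
    abel
  have m1 : MapsTo (fun r : ℝ × ℝ => r.1) (simplex S) (Icc 0 S) :=
    fun r hr => ⟨hr.1, hr.2.1.trans hr.2.2⟩
  have m2 : MapsTo (fun r : ℝ × ℝ => r.2) (simplex S) (Icc 0 S) :=
    fun r hr => ⟨hr.1.trans hr.2.1, hr.2.2⟩
  have c1 := hxc.comp continuousOn_fst m1
  have c2 := hxc.comp continuousOn_snd m2
  have hic : ContinuousOn (fun r : ℝ × ℝ => X.incr r.1 r.2) (simplex S) := c2.sub c1
  have hXc : ContinuousOn (fun r : ℝ × ℝ => X.area r.1 r.2) (simplex S) := by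
    have h1 : ContinuousOn (fun r : ℝ × ℝ => X.incr 0 r.1 ⊗ₜ[ℝ] X.incr r.1 r.2) (simplex S) :=
      (TensorProduct.continuous_tmul (𝕜 := ℝ) (E := V) (F := V)).comp_continuousOn
        ((c1.sub (continuousOn_const (c := X.path 0))).prodMk hic)
    refine (((hAc.comp continuousOn_snd m2).sub (hAc.comp continuousOn_fst m1)).sub h1).congr ?_
    intro r hr
    simp only [Function.comp_apply, Pi.sub_apply]
    rw [hchen 0 r.1 r.2 le_rfl hr.1 hr.2.1 hr.2.2]
    abel
  obtain ⟨B₁, hB₁⟩ := (isCompact_triangle 0 S).exists_bound_of_continuousOn hic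
  obtain ⟨B₂, hB₂⟩ := (isCompact_triangle 0 S).exists_bound_of_continuousOn hXc
  obtain ⟨C₁, -, hC₁⟩ := hi.exists_bound hw hp le_rfl hS
    (fun s t h1 h2 h3 => hB₁ (s, t) ⟨h1, h2, h3⟩)
  obtain ⟨C₂, -, hC₂⟩ := ha.exists_bound hw hp le_rfl hS
    (fun s t h1 h2 h3 => hB₂ (s, t) ⟨h1, h2, h3⟩)
  refine ⟨hxc, hXc, hchen, ⟨C₁, fun s t h1 h2 h3 => ?_⟩, ⟨C₂, fun s t h1 h2 h3 => ?_⟩,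
    fun s t h1 h2 h3 => by rw [hsymm s t h1 h2 h3]⟩
  · have := hC₁ s t h1 h2.le h3
    rwa [pow_one] at this
  · have := hw.rpow_eq (p := p) 2 h1 h2.le (h3.trans hS)
    push_cast at this
    rw [this]
    exact hC₂ s t h1 h2.le h3

/-- Existence of the integrals defining the second level of a lift. -/
lemma exists_lift_aux (hw : IsControl T w) (hp : 0 < p) (hp3 : p < 3) (h0S : 0 ≤ S) (hS : S ≤ T)
    {Y : PathData (Eu m)} (hY : IsWG p w S Y) {L : ℝ → Eu m →L[ℝ] Eu n} {x : ℝ → Eu n} {K : ℝ}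
    (hL : ∀ s, 0 ≤ s → s ≤ S → ‖L s‖ ≤ K)
    (hL' : ∀ s t, 0 ≤ s → s ≤ t → t ≤ S → ‖L t - L s‖ ≤ K * rho w p s t)
    (hx : ∀ s t, 0 ≤ s → s ≤ t → t ≤ S → ‖x t - x s - L s (Y.incr s t)‖ ≤ K * rho w p s t ^ 2) :
    ∃ A : ℝ → Eu n ⊗[ℝ] Eu n, IsO w p 0 S 1 (fun s t => x t - x s) ∧
      IsO w p 0 S 3 (fun s t => A t - A s - ((x s - x 0) ⊗ₜ[ℝ] (x t - x s) +
        TensorProduct.map (L s).toLinearMap (L s).toLinearMap (Y.area s t))) := by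
  have hK : 0 ≤ K := (norm_nonneg _).trans (hL 0 le_rfl h0S)
  obtain ⟨J, hJ, hYb⟩ := hY.exists_bound hw hS
  have hr0 : ∀ s t, 0 ≤ s → s ≤ t → t ≤ S → 0 ≤ rho w p s t := fun s t h1 h2 h3 =>
    hw.rho_nonneg h1 h2 (h3.trans hS)
  have hRS : ∀ s t, 0 ≤ s → s ≤ t → t ≤ S → rho w p s t ≤ rho w p 0 S := fun s t h1 h2 h3 =>
    hw.rho_mono hp le_rfl h1 h2 h3 hS
  obtain ⟨R, hR⟩ : ∃ R, R = rho w p 0 S := ⟨_, rfl⟩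
  rw [← hR] at hRS
  have hR0 : 0 ≤ R := hR ▸ hr0 0 S le_rfl h0S le_rfl
  obtain ⟨K', hK'⟩ : ∃ K', K' = K * J + K * R := ⟨_, rfl⟩
  have hK'0 : 0 ≤ K' := by rw [hK']; positivity
  have hxb : ∀ s t, 0 ≤ s → s ≤ t → t ≤ S → ‖x t - x s‖ ≤ K' * rho w p s t := by
    intro s t h1 h2 h3
    have e0 := hr0 s t h1 h2 h3
    have e1 := hx s t h1 h2 h3
    have e2 : ‖L s (Y.incr s t)‖ ≤ K * (J * rho w p s t) :=
      ((L s).le_opNorm _).trans (mul_le_mul (hL s h1 (h2.trans h3)) (hYb s t h1 h2 h3).1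
        (norm_nonneg _) hK)
    have e3 : K * rho w p s t ^ 2 ≤ K * R * rho w p s t := by
      rw [pow_two, mul_assoc]
      have := hRS s t h1 h2 h3
      gcongr
    have e4 := norm_add_le (x t - x s - L s (Y.incr s t)) (L s (Y.incr s t))
    rw [sub_add_cancel] at e4
    rw [hK']
    linarith
  have hxc : ContinuousOn x (Icc 0 S) := continuousOn_of_isO (k := 0) hw hp le_rfl hS
    (hw.isO_of_bound le_rfl hS K' fun s t h1 h2 h3 => by simpa using hxb s t h1 h2 h3)
  have hLc : ContinuousOn L (Icc 0 S) := continuousOn_of_isO (k := 0) hw hp le_rfl hS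
    (hw.isO_of_bound le_rfl hS K fun s t h1 h2 h3 => by simpa using hL' s t h1 h2 h3)
  let q : ℝ → ℝ → Eu n ⊗[ℝ] Eu n := fun s t =>
    TensorProduct.map (L s).toLinearMap (L s).toLinearMap (Y.area s t)
  let ξ : ℝ → ℝ → Eu n ⊗[ℝ] Eu n := fun s t => (x s - x 0) ⊗ₜ[ℝ] (x t - x s) + q s t
  have m1 : MapsTo (fun r : ℝ × ℝ => r.1) {r : ℝ × ℝ | 0 ≤ r.1 ∧ r.1 ≤ r.2 ∧ r.2 ≤ S} (Icc 0 S) :=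
    fun r hr => ⟨hr.1, hr.2.1.trans hr.2.2⟩
  have m2 : MapsTo (fun r : ℝ × ℝ => r.2) {r : ℝ × ℝ | 0 ≤ r.1 ∧ r.1 ≤ r.2 ∧ r.2 ≤ S} (Icc 0 S) :=
    fun r hr => ⟨hr.1.trans hr.2.1, hr.2.2⟩
  have c1 := hxc.comp continuousOn_fst m1
  have c2 := hxc.comp continuousOn_snd m2
  have c3 := hLc.comp continuousOn_fst m1
  have hqc : ContinuousOn (fun r : ℝ × ℝ => q r.1 r.2)
      {r : ℝ × ℝ | 0 ≤ r.1 ∧ r.1 ≤ r.2 ∧ r.2 ≤ S} := by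
    exact continuousOn_map c3 hY.area_continuous
  have hξc : ContinuousOn (fun r : ℝ × ℝ => ξ r.1 r.2)
      {r : ℝ × ℝ | 0 ≤ r.1 ∧ r.1 ≤ r.2 ∧ r.2 ≤ S} := by
    refine ContinuousOn.add ?_ hqc
    exact (TensorProduct.continuous_tmul (𝕜 := ℝ) (E := Eu n) (F := Eu n)).comp_continuousOn
      ((c1.sub continuousOn_const).prodMk (c2.sub c1))
  have hdef : ∀ s u t, 0 ≤ s → s ≤ u → u ≤ t → t ≤ S →
      ‖ξ s u + ξ u t - ξ s t‖ ≤ (K * K' + K * J * K + K * J * (K * J) + (K * K * J + K * K * J)) *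
        rho w p s t ^ 3 := fun s u t h1 h2 h3 h4 =>
    lift_defect hw hp hS hY hK hK'0 hJ hYb hL hL' hx hxb (fun _ _ => rfl) h1 h2 h3 h4
  obtain ⟨A, -, M, hM, hA⟩ := exists_additive_of_almostAdditive hw hp hp3 le_rfl h0S hS (ξ := ξ)
    (fun s h1 h2 => by simp [ξ, q, hY.area_diag h1 h2]) hdef hξc
  exact ⟨A, hw.isO_of_bound le_rfl hS K' fun s t h1 h2 h3 => by simpa using hxb s t h1 h2 h3,
    hw.isO_of_bound le_rfl hS M hA⟩

/-- A path whose increments are to first order images `L_s y_{s,t}` of the increments of a weakly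
geometric rough path lifts to a weakly geometric rough path, with second level close to
`(L_s ⊗ L_s) 𝕐_{s,t}`. -/
theorem exists_lift (hw : IsControl T w) (hp : 0 < p) (hp3 : p < 3) (h0S : 0 ≤ S) (hS : S ≤ T)
    {Y : PathData (Eu m)} (hY : IsWG p w S Y) {L : ℝ → Eu m →L[ℝ] Eu n} {x : ℝ → Eu n} {K : ℝ}
    (hL : ∀ s, 0 ≤ s → s ≤ S → ‖L s‖ ≤ K)
    (hL' : ∀ s t, 0 ≤ s → s ≤ t → t ≤ S → ‖L t - L s‖ ≤ K * rho w p s t)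
    (hx : ∀ s t, 0 ≤ s → s ≤ t → t ≤ S → ‖x t - x s - L s (Y.incr s t)‖ ≤ K * rho w p s t ^ 2) :
    ∃ X : PathData (Eu n), X.path = x ∧ IsWG p w S X ∧
      Approx p w S X.area (fun s t => TensorProduct.map (L s).toLinearMap (L s).toLinearMap
        (Y.area s t)) := by
  obtain ⟨A, hiO, hA⟩ := exists_lift_aux hw hp hp3 h0S hS hY hL hL' hx
  -- Chen's identity forces this formula, with `A t` in the role of `𝕏_{0,t}`
  obtain ⟨X, hXx, hXA⟩ : ∃ X : PathData (Eu n), X.path = x ∧ ∀ s t, X.area s t =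
      A t - A s - (x s - x 0) ⊗ₜ[ℝ] (x t - x s) := ⟨⟨x, _⟩, rfl, fun _ _ => rfl⟩
  subst hXx
  have hXq : IsO w p 0 S 3 (fun s t => X.area s t -
      TensorProduct.map (L s).toLinearMap (L s).toLinearMap (Y.area s t)) :=
    hA.congr fun s t _ _ _ => by rw [hXA]; abel
  have hLO : IsO w p 0 S 0 (fun s _ : ℝ => L s) :=
    isO_of_bounded K fun s t h1 h2 h3 => hL s h1 (h2.trans h3)
  have hqO := hLO.map hLO (hY.isO_area hw hS)
  have hXO : IsO w p 0 S 2 X.area :=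
    ((hXq.weaken hw hp le_rfl hS (l := 2) (by norm_num)).add hqO).congr fun s t _ _ _ =>
      sub_add_cancel _ _
  have hchen : ∀ s u t, 0 ≤ s → s ≤ u → u ≤ t → t ≤ S →
      X.area s t = X.area s u + X.area u t + X.incr s u ⊗ₜ[ℝ] X.incr u t := by
    intro s u t _ _ _ _
    simp only [hXA, PathData.incr, TensorProduct.sub_tmul, TensorProduct.tmul_sub]
    abel
  exact ⟨X, rfl, isWG_of_isO hw hp hS hchen hiO hXO (symm_of_isO hw hp hp3 hS hY hLO hchen
    (hw.isO_of_bound le_rfl hS K hx) hiO hXq), (hw.approx_iff hS).2 hXq⟩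

end RoughPath

/-! ### Compactly supported smooth functions -/

section Tame

variable {E F : Type*} [NormedAddCommGroup E] [NormedSpace ℝ E]
  [NormedAddCommGroup F] [NormedSpace ℝ F] {φ : E → F}

/-- Smooth functions with compact support; all their derivatives are bounded. -/
structure IsTame (φ : E → F) : Prop where
  smooth : ContDiff ℝ ∞ φ
  compact : HasCompactSupport φ

lemma IsTame.bound (h : IsTame φ) : ∃ K, 0 ≤ K ∧ ∀ x, ‖φ x‖ ≤ K := by
  obtain ⟨K, hK⟩ := h.compact.exists_bound_of_continuous h.smooth.continuous
  exact ⟨max K 0, le_max_right _ _, fun x => (hK x).trans (le_max_left _ _)⟩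

lemma IsTame.fderiv (h : IsTame φ) : IsTame (fderiv ℝ φ) :=
  ⟨h.smooth.fderiv_right (by norm_num), h.compact.fderiv ℝ⟩

lemma IsTame.differentiable (h : IsTame φ) : Differentiable ℝ φ :=
  h.smooth.differentiable (by norm_num)

lemma IsTame.lipschitz (h : IsTame φ) : ∃ K, 0 ≤ K ∧ ∀ x y, ‖φ y - φ x‖ ≤ K * ‖y - x‖ := by
  obtain ⟨K, hK, hb⟩ := h.fderiv.bound
  exact ⟨K, hK, fun x y => convex_univ.norm_image_sub_le_of_norm_fderiv_le
    (fun z _ => h.differentiable z) (fun z _ => hb z) (mem_univ x) (mem_univ y)⟩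

lemma norm_sub_le_of_mem_segment {x y z : E} (hz : z ∈ segment ℝ x y) : ‖z - x‖ ≤ ‖y - x‖ := by
  rw [segment_eq_image'] at hz
  obtain ⟨θ, hθ, rfl⟩ := hz
  rw [add_sub_cancel_left, norm_smul, Real.norm_of_nonneg hθ.1]
  exact mul_le_of_le_one_left (norm_nonneg _) hθ.2

lemma IsTame.taylor (h : IsTame φ) :
    ∃ K, 0 ≤ K ∧ ∀ x y, ‖φ y - φ x - _root_.fderiv ℝ φ x (y - x)‖ ≤ K * ‖y - x‖ ^ 2 := by
  obtain ⟨K, hK, hb⟩ := h.fderiv.lipschitz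
  refine ⟨K, hK, fun x y => ?_⟩
  rw [pow_two, ← mul_assoc]
  refine (convex_segment x y).norm_image_sub_le_of_norm_fderiv_le' (fun z _ => h.differentiable z)
    (fun z hz => (hb x z).trans ?_) (left_mem_segment _ _ _) (right_mem_segment _ _ _)
  exact mul_le_mul_of_nonneg_left (norm_sub_le_of_mem_segment hz) hK

/-- Second order Taylor expansion with a third order remainder. -/
lemma IsTame.taylor_two (h : IsTame φ) :
    ∃ K, 0 ≤ K ∧ ∀ x y, ‖φ y - φ x - _root_.fderiv ℝ φ x (y - x) -
      (1 / 2 : ℝ) • _root_.fderiv ℝ (_root_.fderiv ℝ φ) x (y - x) (y - x)‖ ≤ K * ‖y - x‖ ^ 3 := by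
  obtain ⟨K, hK, hb⟩ := h.fderiv.taylor
  refine ⟨K, hK, fun x y => ?_⟩
  set B := _root_.fderiv ℝ (_root_.fderiv ℝ φ) x with hB
  have hsymm : ∀ u v, B u v = B v u := fun u v =>
    second_derivative_symmetric (f := φ) (f' := _root_.fderiv ℝ φ)
      (fun z => (h.differentiable z).hasFDerivAt)
      (h.fderiv.differentiable x).hasFDerivAt u v
  have hd : ∀ z, HasFDerivAt (fun z => φ z - φ x - _root_.fderiv ℝ φ x (z - x) -
      (1 / 2 : ℝ) • B (z - x) (z - x))
      (_root_.fderiv ℝ φ z - _root_.fderiv ℝ φ x - B (z - x)) z := by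
    intro z
    have h1 := (h.differentiable z).hasFDerivAt
    have h0 : HasFDerivAt (fun z => z - x) (ContinuousLinearMap.id ℝ E) z :=
      (hasFDerivAt_id z).sub_const x
    have h2 := (_root_.fderiv ℝ φ x).hasFDerivAt.comp z h0
    have h3 := (B.hasFDerivAt.comp z h0).clm_apply h0
    refine (((h1.sub_const (φ x)).sub h2).sub (h3.const_smul (1 / 2 : ℝ))).congr_fderiv ?_
    ext v
    simp only [FunLike.coe_sub, Pi.sub_apply, ContinuousLinearMap.coe_comp,
      Function.comp_apply, ContinuousLinearMap.coe_id', id_eq, FunLike.coe_smul,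
      Pi.smul_apply, add_apply, ContinuousLinearMap.flip_apply]
    rw [hsymm v (z - x), ← two_smul ℝ (B (z - x) v), smul_smul]
    norm_num
  have := (convex_segment x y).norm_image_sub_le_of_norm_hasFDerivWithin_le
    (C := K * ‖y - x‖ ^ 2) (fun z _ => (hd z).hasFDerivWithinAt) (fun z hz => (hb x z).trans ?_)
    (left_mem_segment ℝ x y) (right_mem_segment ℝ x y)
  · simp only [sub_self, map_zero, smul_zero, sub_zero] at this
    refine this.trans_eq ?_
    ring
  · have := norm_sub_le_of_mem_segment hz
    gcongr

lemma IsTame.hasFDerivAt_add (h : IsTame φ) (z r : E) :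
    HasFDerivAt (fun z => φ (z + r)) (_root_.fderiv ℝ φ (z + r)) z := by
  have h1 := (h.differentiable (z + r)).hasFDerivAt.comp z ((hasFDerivAt_id z).add_const r)
  rw [ContinuousLinearMap.comp_id] at h1
  exact h1

/-- The four point estimate: the increment of `φ` over `r` is Lipschitz in `r` and in the base
point, with a gain of `‖r'‖` in the latter. -/
lemma IsTame.four_point (h : IsTame φ) :
    ∃ K, 0 ≤ K ∧ ∀ a r a' r', ‖(φ (a + r) - φ a) - (φ (a' + r') - φ a')‖ ≤
      K * (‖r - r'‖ + ‖a - a'‖ * ‖r'‖) := by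
  obtain ⟨K, hK, hb⟩ := h.lipschitz
  obtain ⟨K', hK', hb'⟩ := h.fderiv.lipschitz
  refine ⟨max K K', hK.trans (le_max_left _ _), fun a r a' r' => ?_⟩
  have h1 : ‖φ (a + r) - φ (a + r')‖ ≤ max K K' * ‖r - r'‖ := by
    refine (hb _ _).trans ?_
    rw [add_sub_add_left_eq_sub]
    gcongr
    exact le_max_left _ _
  have hd : ∀ z, HasFDerivAt (fun z => φ (z + r') - φ z)
      (_root_.fderiv ℝ φ (z + r') - _root_.fderiv ℝ φ z) z := fun z =>
    (h.hasFDerivAt_add z r').sub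
      (h.differentiable z).hasFDerivAt
  have h2 := convex_univ.norm_image_sub_le_of_norm_hasFDerivWithin_le (C := K' * ‖r'‖)
    (fun z _ => (hd z).hasFDerivWithinAt) (fun z _ => (hb' z (z + r')).trans (by simp))
    (mem_univ a') (mem_univ a)
  have h3 : K' * ‖r'‖ * ‖a - a'‖ ≤ max K K' * (‖a - a'‖ * ‖r'‖) := by
    rw [mul_assoc, mul_comm ‖r'‖]
    gcongr
    exact le_max_right _ _
  have e : (φ (a + r) - φ a) - (φ (a' + r') - φ a') =
      (φ (a + r) - φ (a + r')) + ((φ (a + r') - φ a) - (φ (a' + r') - φ a')) := by abel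
  rw [e, mul_add]
  exact (norm_add_le _ _).trans (add_le_add h1 (h2.trans h3))

/-- The first order Taylor remainder is Lipschitz in the base point and in the increment. -/
lemma IsTame.remainder (h : IsTame φ) :
    ∃ K, 0 ≤ K ∧ ∀ x y u v B, ‖u‖ ≤ B → ‖v‖ ≤ B →
      ‖(φ (x + u) - φ x - _root_.fderiv ℝ φ x u) - (φ (y + v) - φ y - _root_.fderiv ℝ φ y v)‖ ≤
      K * (B ^ 2 * ‖x - y‖ + B * ‖u - v‖) := by
  obtain ⟨K, hK, hb⟩ := h.fderiv.lipschitz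
  obtain ⟨K', hK', hb'⟩ := h.fderiv.taylor
  refine ⟨max K K', hK.trans (le_max_left _ _), fun x y u v B hu hv => ?_⟩
  have hB : 0 ≤ B := (norm_nonneg _).trans hu
  have hd : ∀ z, HasFDerivAt (fun z => φ (z + u) - φ z - _root_.fderiv ℝ φ z u)
      (_root_.fderiv ℝ φ (z + u) - _root_.fderiv ℝ φ z -
        (_root_.fderiv ℝ (_root_.fderiv ℝ φ) z).flip u) z := fun z =>
    ((h.hasFDerivAt_add z u).sub
      (h.differentiable z).hasFDerivAt).sub
      (by simpa using (h.fderiv.differentiable z).hasFDerivAt.clm_apply (hasFDerivAt_const u z))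
  have hsymm : ∀ z u v, _root_.fderiv ℝ (_root_.fderiv ℝ φ) z u v =
      _root_.fderiv ℝ (_root_.fderiv ℝ φ) z v u := fun z u v =>
    second_derivative_symmetric (f := φ) (f' := _root_.fderiv ℝ φ)
      (fun z => (h.differentiable z).hasFDerivAt)
      (h.fderiv.differentiable z).hasFDerivAt u v
  have h1 := convex_univ.norm_image_sub_le_of_norm_hasFDerivWithin_le (C := K' * ‖u‖ ^ 2)
    (fun z _ => (hd z).hasFDerivWithinAt) (fun z _ => by
      have e : (_root_.fderiv ℝ (_root_.fderiv ℝ φ) z).flip u =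
          _root_.fderiv ℝ (_root_.fderiv ℝ φ) z u := by
        ext v; exact hsymm z v u
      have := hb' z (z + u)
      rw [add_sub_cancel_left] at this
      rwa [e]) (mem_univ y) (mem_univ x)
  have hd2 : ∀ z, HasFDerivAt (fun z => φ (y + z) - φ y - _root_.fderiv ℝ φ y z)
      (_root_.fderiv ℝ φ (y + z) - _root_.fderiv ℝ φ y) z := fun z =>
    ((by simpa only [add_comm y] using h.hasFDerivAt_add z y :
      HasFDerivAt (fun z => φ (y + z)) (_root_.fderiv ℝ φ (y + z)) z).sub_const _).sub
      (_root_.fderiv ℝ φ y).hasFDerivAt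
  have h2 := (convex_closedBall (0 : E) B).norm_image_sub_le_of_norm_hasFDerivWithin_le
    (C := K * B) (fun z _ => (hd2 z).hasFDerivWithinAt) (fun z hz => (hb y (y + z)).trans (by
      rw [add_sub_cancel_left]
      rw [mem_closedBall_zero_iff] at hz
      gcongr)) (mem_closedBall_zero_iff.2 hv) (mem_closedBall_zero_iff.2 hu)
  have e : (φ (x + u) - φ x - _root_.fderiv ℝ φ x u) - (φ (y + v) - φ y - _root_.fderiv ℝ φ y v) =
      ((φ (x + u) - φ x - _root_.fderiv ℝ φ x u) - (φ (y + u) - φ y - _root_.fderiv ℝ φ y u)) +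
      ((φ (y + u) - φ y - _root_.fderiv ℝ φ y u) - (φ (y + v) - φ y - _root_.fderiv ℝ φ y v)) := by
    abel
  rw [e, mul_add]
  refine (norm_add_le _ _).trans (add_le_add (h1.trans ?_) (h2.trans ?_))
  · rw [mul_assoc]
    gcongr
    exact le_max_right _ _
  · rw [mul_assoc]
    gcongr
    exact le_max_left _ _

end Tame

/-! ### Rough integrals of compactly supported one-forms -/

section Integral

variable {m n : ℕ} {T p S : ℝ} {w : ℝ → ℝ → ℝ}

lemma continuousOn_tensorLift {W : Type*} [NormedAddCommGroup W] [InnerProductSpace ℝ W]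
    {α : Type*} [TopologicalSpace α] {s : Set α} {A : α → Eu m →L[ℝ] Eu m →L[ℝ] W}
    {t : α → Eu m ⊗[ℝ] Eu m} (hA : ContinuousOn A s) (ht : ContinuousOn t s) :
    ContinuousOn (fun x => tensorLift (A x) (t x)) s := by
  intro y hy
  refine tendsto_iff_norm_sub_tendsto_zero.2 ?_
  refine squeeze_zero (fun _ => norm_nonneg _) (g := fun x => (m : ℝ) ^ 2 * ‖A x - A y‖ * ‖t x‖ +
    (m : ℝ) ^ 2 * ‖A y‖ * ‖t x - t y‖) (fun x => ?_) ?_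
  · have e : tensorLift (A x) (t x) - tensorLift (A y) (t y) =
        tensorLift (A x - A y) (t x) + tensorLift (A y) (t x - t y) := by
      rw [tensorLift_sub, map_sub]
      abel
    rw [e]
    exact (norm_add_le _ _).trans (add_le_add (norm_tensorLift_le _ _) (norm_tensorLift_le _ _))
  · have h1 := Tendsto.norm (E := Eu m →L[ℝ] Eu m →L[ℝ] W) (hA y hy).tendsto
    have h2 := (ht y hy).tendsto
    have h3 := (tendsto_iff_norm_sub_tendsto_zero (E := Eu m →L[ℝ] Eu m →L[ℝ] W)).1 (hA y hy)
    have h4 := (h2.sub_const (t y)).norm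
    simp only [sub_self, norm_zero] at h4
    simpa using ((h3.const_mul ((m : ℝ) ^ 2)).mul h2.norm).add
      (h4.const_mul ((m : ℝ) ^ 2 * ‖A y‖))

/-- The rough integral of a compactly supported one-form exists. -/
theorem exists_roughIntegral (hw : IsControl T w) (hp : 0 < p) (hp3 : p < 3) (h0S : 0 ≤ S)
    (hS : S ≤ T) {β : Eu m → Eu m →L[ℝ] Eu n} (hβ : IsTame β) {X : PathData (Eu m)}
    (hX : IsWG p w S X) : ∃ Z, IsRoughIntegral p w S β X Z := by
  obtain ⟨J, hJ, hXb⟩ := hX.exists_bound hw hS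
  obtain ⟨K₀, hK₀, hβ0⟩ := hβ.bound
  obtain ⟨K₁, hK₁, hβ1⟩ := hβ.lipschitz
  obtain ⟨K₂, hK₂, hβ2⟩ := hβ.taylor
  obtain ⟨K₃, hK₃, hβ3⟩ := hβ.fderiv.bound
  obtain ⟨K₄, hK₄, hβ4⟩ := hβ.fderiv.lipschitz
  let ξ : ℝ → ℝ → Eu n := fun s t => β (X.path s) (X.incr s t) +
    tensorLift (fderiv ℝ β (X.path s)) (X.area s t)
  -- by Chen's identity the terms of order two in the defect of additivity of the germ cancel
  have hdef : ∀ s u t, 0 ≤ s → s ≤ u → u ≤ t → t ≤ S →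
      ‖ξ s u + ξ u t - ξ s t‖ ≤ (K₂ * J ^ 2 * J + (m : ℝ) ^ 2 * (K₄ * J) * J) *
        rho w p s t ^ 3 := by
    intro s u t h1 h2 h3 h4
    have r1 : rho w p s u ≤ rho w p s t := hw.rho_mono hp h1 le_rfl h2 h3 (h4.trans hS)
    have r2 : rho w p u t ≤ rho w p s t := hw.rho_mono hp h1 h2 h3 le_rfl (h4.trans hS)
    have r10 := hw.rho_nonneg (p := p) h1 h2 (h3.trans (h4.trans hS))
    have r20 := hw.rho_nonneg (p := p) (h1.trans h2) h3 (h4.trans hS)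
    have r0 := r10.trans r1
    set r := rho w p s t
    have b1 := (hXb s u h1 h2 (h3.trans h4)).1.trans (mul_le_mul_of_nonneg_left r1 hJ)
    have b2 := (hXb u t (h1.trans h2) h3 h4).1.trans (mul_le_mul_of_nonneg_left r2 hJ)
    have b3 := (hXb u t (h1.trans h2) h3 h4).2.trans
      (mul_le_mul_of_nonneg_left (pow_le_pow_left₀ r20 r2 2) hJ)
    have e : ξ s u + ξ u t - ξ s t =
        (β (X.path u) - β (X.path s) - fderiv ℝ β (X.path s) (X.incr s u)) (X.incr u t) +
        tensorLift (fderiv ℝ β (X.path u) - fderiv ℝ β (X.path s)) (X.area u t) := by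
      simp only [ξ, hX.chen s u t h1 h2 h3 h4, X.incr_add s u t, map_add, tensorLift_tmul,
        tensorLift_sub, sub_apply]
      abel
    have t1 : ‖β (X.path u) - β (X.path s) - fderiv ℝ β (X.path s) (X.incr s u)‖ ≤
        K₂ * (J * r) ^ 2 := (hβ2 _ _).trans (by gcongr; exact b1)
    have t2 : ‖fderiv ℝ β (X.path u) - fderiv ℝ β (X.path s)‖ ≤ K₄ * (J * r) :=
      (hβ4 _ _).trans (by gcongr; exact b1)
    have n1 := ((β (X.path u) - β (X.path s) -
      fderiv ℝ β (X.path s) (X.incr s u)).le_opNorm (X.incr u t)).trans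
      (mul_le_mul t1 b2 (norm_nonneg _) (by positivity))
    have n2 : ‖tensorLift (fderiv ℝ β (X.path u) - fderiv ℝ β (X.path s)) (X.area u t)‖ ≤
        (m : ℝ) ^ 2 * (K₄ * (J * r)) * (J * r ^ 2) :=
      (norm_tensorLift_le _ _).trans (by gcongr)
    rw [e]
    refine (norm_add_le _ _).trans ((add_le_add n1 n2).trans_eq ?_)
    ring
  have m1 : MapsTo (fun r : ℝ × ℝ => r.1) {r : ℝ × ℝ | 0 ≤ r.1 ∧ r.1 ≤ r.2 ∧ r.2 ≤ S} (Icc 0 S) :=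
    fun r hr => ⟨hr.1, hr.2.1.trans hr.2.2⟩
  have m2 : MapsTo (fun r : ℝ × ℝ => r.2) {r : ℝ × ℝ | 0 ≤ r.1 ∧ r.1 ≤ r.2 ∧ r.2 ≤ S} (Icc 0 S) :=
    fun r hr => ⟨hr.1.trans hr.2.1, hr.2.2⟩
  have c1 := hX.path_continuous.comp continuousOn_fst m1
  have c2 := hX.path_continuous.comp continuousOn_snd m2
  have hξc : ContinuousOn (fun r : ℝ × ℝ => ξ r.1 r.2)
      {r : ℝ × ℝ | 0 ≤ r.1 ∧ r.1 ≤ r.2 ∧ r.2 ≤ S} :=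
    ((hβ.smooth.continuous.comp_continuousOn c1).clm_apply (c2.sub c1)).add
      (continuousOn_tensorLift (hβ.fderiv.smooth.continuous.comp_continuousOn c1)
        hX.area_continuous)
  obtain ⟨z, hz0, M, hM, hz⟩ := exists_additive_of_almostAdditive hw hp hp3 le_rfl h0S hS (ξ := ξ)
    (fun s h1 h2 => by simp [ξ, hX.area_diag h1 h2, PathData.incr]) hdef hξc
  have hr0 : ∀ s t, 0 ≤ s → s ≤ t → t ≤ S → 0 ≤ rho w p s t ∧ rho w p s t ≤ rho w p 0 S :=
    fun s t h1 h2 h3 =>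
      ⟨hw.rho_nonneg h1 h2 (h3.trans hS), hw.rho_mono hp le_rfl h1 h2 h3 hS⟩
  have hR0 := (hr0 0 S le_rfl h0S le_rfl).1
  set R := rho w p 0 S
  obtain ⟨K, hK⟩ : ∃ K, K = K₀ + K₁ * J + (M * R + (m : ℝ) ^ 2 * K₃ * J) := ⟨_, rfl⟩
  have p1 : 0 ≤ K₁ * J := by positivity
  have p2 : 0 ≤ M * R + (m : ℝ) ^ 2 * K₃ * J := by positivity
  obtain ⟨Z, hZz, hZ, hZ2⟩ := exists_lift hw hp hp3 h0S hS hX (L := fun s => β (X.path s)) (x := z)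
    (K := K) (fun s _ _ => (hβ0 _).trans (by linarith)) (fun s t h1 h2 h3 => by
      refine (hβ1 _ _).trans ?_
      have h4 := (hr0 s t h1 h2 h3).1
      calc K₁ * ‖X.path t - X.path s‖ ≤ K₁ * (J * rho w p s t) := by
            gcongr; exact (hXb s t h1 h2 h3).1
        _ = (K₁ * J) * rho w p s t := by ring
        _ ≤ K * rho w p s t := by gcongr; linarith)
    (fun s t h1 h2 h3 => by
      have h4 := (hr0 s t h1 h2 h3)
      have e : z t - z s - β (X.path s) (X.incr s t) = (z t - z s - ξ s t) +
          tensorLift (fderiv ℝ β (X.path s)) (X.area s t) := by simp only [ξ]; abel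
      have n2 : ‖tensorLift (fderiv ℝ β (X.path s)) (X.area s t)‖ ≤
          (m : ℝ) ^ 2 * K₃ * (J * rho w p s t ^ 2) :=
        (norm_tensorLift_le _ _).trans (by
          have := hβ3 (X.path s)
          have := (hXb s t h1 h2 h3).2
          gcongr)
      have n1 : M * rho w p s t ^ 3 ≤ M * (R * rho w p s t ^ 2) := by
        rw [pow_succ' _ 2]
        have := h4.1
        have := h4.2
        gcongr
      rw [e]
      calc _ ≤ M * (R * rho w p s t ^ 2) + (m : ℝ) ^ 2 * K₃ * (J * rho w p s t ^ 2) :=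
            (norm_add_le _ _).trans (add_le_add ((hz s t h1 h2 h3).trans n1) n2)
        _ = (M * R + (m : ℝ) ^ 2 * K₃ * J) * rho w p s t ^ 2 := by ring
        _ ≤ K * rho w p s t ^ 2 := by gcongr; linarith)
  refine ⟨Z, hZ, by rw [hZz, hz0], (hw.approx_iff hS).2 (hw.isO_of_bound le_rfl hS M ?_), hZ2⟩
  intro s t h1 h2 h3
  rw [PathData.incr, hZz]
  exact hz s t h1 h2 h3

lemma Approx.path_eq (hw : IsControl T w) (hp : 0 < p) (hp3 : p < 3) (hS : S ≤ T)
    {V : Type*} [NormedAddCommGroup V] [InnerProductSpace ℝ V] {Z Z' : PathData V}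
    (h0 : Z.path 0 = Z'.path 0) {h : ℝ → ℝ → V}
    (h1 : Approx p w S Z.incr h) (h2 : Approx p w S Z'.incr h) :
    ∀ t, 0 ≤ t → t ≤ S → Z.path t = Z'.path t := by
  have hd : IsO w p 0 S 3 (fun s t => Z.incr s t - Z'.incr s t) :=
    (((hw.approx_iff hS).1 h1).sub ((hw.approx_iff hS).1 h2)).congr fun s t _ _ _ => by abel
  intro t h3 h4
  have := hd.eq_zero_of_additive hw hp hp3 le_rfl hS (fun s u t _ _ _ _ => by
    rw [Z.incr_add s u t, Z'.incr_add s u t]; abel) 0 t le_rfl h3 h4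
  simp only [PathData.incr, h0] at this
  simpa [sub_eq_zero] using this

lemma IsRoughIntegral.eqUpTo (hw : IsControl T w) (hp : 0 < p) (hp3 : p < 3) (hS : S ≤ T)
    {V W : Type*} [NormedAddCommGroup V] [InnerProductSpace ℝ V]
    [NormedAddCommGroup W] [InnerProductSpace ℝ W] {β : V → V →L[ℝ] W} {X : PathData V}
    {Z Z' : PathData W} (h : IsRoughIntegral p w S β X Z) (h' : IsRoughIntegral p w S β X Z') :
    EqUpTo S Z Z' := by
  have hp := Approx.path_eq hw hp hp3 hS (by rw [h.start, h'.start]) h.level_one h'.level_one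
  exact ⟨hp, area_eq_of_approx hw ‹_› hp3 hS h.isWG h'.isWG hp h.level_two h'.level_two⟩

end Integral

/-! ### Rough differential equations with compactly supported coefficients -/

section RDE

variable {d N : ℕ} {T p a b : ℝ} {w : ℝ → ℝ → ℝ}

/-- The bilinear map `(a, b) ↦ ∂_{f_a} f_b (x)`. -/
noncomputable def secondOrder (f : Eu N → Eu d →L[ℝ] Eu N) (x : Eu N) :
    Eu d →L[ℝ] Eu d →L[ℝ] Eu N := (fderiv ℝ f x).comp (f x)

/-- The increment of the second order Euler scheme for `dx = f(x) dZ`. -/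
noncomputable def eulerIncr (f : Eu N → Eu d →L[ℝ] Eu N) (Z : PathData (Eu d)) (s t : ℝ)
    (x : Eu N) : Eu N := f x (Z.incr s t) + tensorLift (secondOrder f x) (Z.area s t)

lemma IsTame.secondOrder {f : Eu N → Eu d →L[ℝ] Eu N} (hf : IsTame f) : IsTame (secondOrder f) :=
  ⟨hf.fderiv.smooth.clm_comp hf.smooth, hf.compact.mono fun x hx hx' => hx (by
    simp only [RoughManifold.secondOrder, hx', ContinuousLinearMap.comp_zero])⟩

variable {f : Eu N → Eu d →L[ℝ] Eu N} {Z : PathData (Eu d)}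

/-- The bounds satisfied by the increments of the Euler scheme: they are of order one, together
with their first and second differences, and the scheme is consistent up to order three. -/
structure EulerBounds (w : ℝ → ℝ → ℝ) (p T H : ℝ) (f : Eu N → Eu d →L[ℝ] Eu N)
    (Z : PathData (Eu d)) : Prop where
  nonneg : 0 ≤ H
  bound : ∀ s t, 0 ≤ s → s ≤ t → t ≤ T → rho w p s t ≤ 1 → ∀ x,
    ‖eulerIncr f Z s t x‖ ≤ H * rho w p s t
  four_point : ∀ s t, 0 ≤ s → s ≤ t → t ≤ T → rho w p s t ≤ 1 → ∀ x u y v,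
    ‖(eulerIncr f Z s t (x + u) - eulerIncr f Z s t x) -
      (eulerIncr f Z s t (y + v) - eulerIncr f Z s t y)‖ ≤
      H * rho w p s t * (‖u - v‖ + ‖x - y‖ * ‖v‖)

lemma EulerBounds.lipschitz {H : ℝ} (h : EulerBounds w p T H f Z) {s t : ℝ} (h0 : 0 ≤ s)
    (h1 : s ≤ t) (h2 : t ≤ T) (hr : rho w p s t ≤ 1) (x y : Eu N) :
    ‖eulerIncr f Z s t x - eulerIncr f Z s t y‖ ≤ H * rho w p s t * ‖x - y‖ := by
  simpa using h.four_point s t h0 h1 h2 hr y (x - y) y 0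

lemma exists_eulerBounds (hw : IsControl T w) (hf : IsTame f)
    (hZ : IsWG p w T Z) : ∃ H, EulerBounds w p T H f Z := by
  obtain ⟨J, hJ, hZb⟩ := hZ.exists_bound hw le_rfl
  obtain ⟨K₀, hK₀, hf0⟩ := hf.bound
  obtain ⟨K₁, hK₁, hf1⟩ := hf.four_point
  obtain ⟨K₂, hK₂, hg0⟩ := hf.secondOrder.bound
  obtain ⟨K₃, hK₃, hg1⟩ := hf.secondOrder.four_point
  have hsq : ∀ s t, 0 ≤ s → s ≤ t → t ≤ T → rho w p s t ≤ 1 →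
      rho w p s t ^ 2 ≤ rho w p s t := fun s t h0 h1 h2 hr => by
    have := hw.rho_nonneg (p := p) h0 h1 h2
    rw [pow_two]
    exact mul_le_of_le_one_right this hr
  refine ⟨max (K₀ * J + (d : ℝ) ^ 2 * K₂ * J) (K₁ * J + (d : ℝ) ^ 2 * K₃ * J),
    le_max_of_le_left (by positivity), ?_, ?_⟩
  · intro s t h0 h1 h2 hr x
    have hr0 := hw.rho_nonneg (p := p) h0 h1 h2
    have n1 : ‖f x (Z.incr s t)‖ ≤ K₀ * (J * rho w p s t) :=
      ((f x).le_opNorm _).trans (mul_le_mul (hf0 x) (hZb s t h0 h1 h2).1 (norm_nonneg _) hK₀)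
    have n2 : ‖tensorLift (secondOrder f x) (Z.area s t)‖ ≤
        (d : ℝ) ^ 2 * K₂ * (J * rho w p s t) :=
      (norm_tensorLift_le _ _).trans (by
        have := hg0 x
        have := (hZb s t h0 h1 h2).2.trans (mul_le_mul_of_nonneg_left (hsq s t h0 h1 h2 hr) hJ)
        gcongr)
    calc ‖eulerIncr f Z s t x‖ ≤ K₀ * (J * rho w p s t) + (d : ℝ) ^ 2 * K₂ * (J * rho w p s t) :=
          (norm_add_le _ _).trans (add_le_add n1 n2)
      _ = (K₀ * J + (d : ℝ) ^ 2 * K₂ * J) * rho w p s t := by ring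
      _ ≤ _ := by gcongr; exact le_max_left _ _
  · intro s t h0 h1 h2 hr x u y v
    have hr0 := hw.rho_nonneg (p := p) h0 h1 h2
    have e : (eulerIncr f Z s t (x + u) - eulerIncr f Z s t x) -
        (eulerIncr f Z s t (y + v) - eulerIncr f Z s t y) =
        ((f (x + u) - f x) - (f (y + v) - f y)) (Z.incr s t) +
        tensorLift ((secondOrder f (x + u) - secondOrder f x) -
          (secondOrder f (y + v) - secondOrder f y)) (Z.area s t) := by
      simp only [eulerIncr, tensorLift_sub, sub_apply]
      abel
    set D := ‖u - v‖ + ‖x - y‖ * ‖v‖ with hD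
    have hD0 : 0 ≤ D := by positivity
    have n1 : ‖((f (x + u) - f x) - (f (y + v) - f y)) (Z.incr s t)‖ ≤
        K₁ * D * (J * rho w p s t) :=
      (((f (x + u) - f x) - (f (y + v) - f y)).le_opNorm _).trans
        (mul_le_mul (hf1 x u y v) (hZb s t h0 h1 h2).1 (norm_nonneg _) (by positivity))
    have n2 : ‖tensorLift ((secondOrder f (x + u) - secondOrder f x) -
          (secondOrder f (y + v) - secondOrder f y)) (Z.area s t)‖ ≤
        (d : ℝ) ^ 2 * (K₃ * D) * (J * rho w p s t) :=
      (norm_tensorLift_le _ _).trans (by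
        have := hg1 x u y v
        have := (hZb s t h0 h1 h2).2.trans (mul_le_mul_of_nonneg_left (hsq s t h0 h1 h2 hr) hJ)
        gcongr)
    rw [e]
    calc _ ≤ K₁ * D * (J * rho w p s t) + (d : ℝ) ^ 2 * (K₃ * D) * (J * rho w p s t) :=
          (norm_add_le _ _).trans (add_le_add n1 n2)
      _ = (K₁ * J + (d : ℝ) ^ 2 * K₃ * J) * rho w p s t * D := by ring
      _ ≤ _ := by gcongr; exact le_max_right _ _

/-- The error made in replacing two steps of the Euler scheme by one. -/
noncomputable def eulerDefect (f : Eu N → Eu d →L[ℝ] Eu N) (Z : PathData (Eu d)) (s u t : ℝ)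
    (x : Eu N) : Eu N :=
  (x + eulerIncr f Z s u x + eulerIncr f Z u t (x + eulerIncr f Z s u x)) -
    (x + eulerIncr f Z s t x)

/-- By Chen's identity the terms of order two in the defect cancel. -/
lemma eulerDefect_eq {s u t : ℝ} (hchen : Z.area s t = Z.area s u + Z.area u t +
    Z.incr s u ⊗ₜ[ℝ] Z.incr u t) (x : Eu N) :
    eulerDefect f Z s u t x =
      (f (x + eulerIncr f Z s u x) - f x - fderiv ℝ f x (eulerIncr f Z s u x)) (Z.incr u t) +
      fderiv ℝ f x (tensorLift (secondOrder f x) (Z.area s u)) (Z.incr u t) +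
      tensorLift (secondOrder f (x + eulerIncr f Z s u x) - secondOrder f x) (Z.area u t) := by
  simp only [eulerDefect]
  have e1 : fderiv ℝ f x (eulerIncr f Z s u x) (Z.incr u t) =
      tensorLift (secondOrder f x) (Z.incr s u ⊗ₜ[ℝ] Z.incr u t) +
      fderiv ℝ f x (tensorLift (secondOrder f x) (Z.area s u)) (Z.incr u t) := by
    rw [tensorLift_tmul]
    nth_rw 1 [eulerIncr]
    simp [secondOrder]
  have e2 : eulerIncr f Z s t x = eulerIncr f Z s u x + f x (Z.incr u t) +
      tensorLift (secondOrder f x) (Z.area u t) +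
      tensorLift (secondOrder f x) (Z.incr s u ⊗ₜ[ℝ] Z.incr u t) := by
    simp only [eulerIncr, hchen, Z.incr_add s u t, map_add]
    abel
  rw [e2]
  simp only [sub_apply, e1, tensorLift_sub]
  nth_rw 2 [eulerIncr]
  abel

lemma exists_eulerDefect_bound (hw : IsControl T w) (hp : 0 < p) (hf : IsTame f)
    (hZ : IsWG p w T Z) : ∃ C, 0 ≤ C ∧ ∀ s u t, 0 ≤ s → s ≤ u → u ≤ t → t ≤ T → rho w p s t ≤ 1 →
      ∀ x, ‖eulerDefect f Z s u t x‖ ≤ C * rho w p s t ^ 3 := by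
  obtain ⟨J, hJ, hZb⟩ := hZ.exists_bound hw le_rfl
  obtain ⟨H, hH⟩ := exists_eulerBounds hw hf hZ
  have hH0 := hH.nonneg
  obtain ⟨K₁, hK₁, hf1⟩ := hf.taylor
  obtain ⟨K₂, hK₂, hg0⟩ := hf.secondOrder.bound
  obtain ⟨K₃, hK₃, hg1⟩ := hf.secondOrder.lipschitz
  obtain ⟨K₄, hK₄, hf4⟩ := hf.fderiv.bound
  refine ⟨K₁ * H ^ 2 * J + K₄ * ((d : ℝ) ^ 2 * K₂ * J) * J + (d : ℝ) ^ 2 * (K₃ * H) * J,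
    by positivity, fun s u t h1 h2 h3 h4 hr x => ?_⟩
  rw [eulerDefect_eq (hZ.chen s u t h1 h2 h3 h4)]
  have r1 : rho w p s u ≤ rho w p s t := hw.rho_mono hp h1 le_rfl h2 h3 h4
  have r2 : rho w p u t ≤ rho w p s t := hw.rho_mono hp h1 h2 h3 le_rfl h4
  have r10 := hw.rho_nonneg (p := p) h1 h2 (h3.trans h4)
  have r20 := hw.rho_nonneg (p := p) (h1.trans h2) h3 h4
  have r0 := r10.trans r1
  have bh := (hH.bound s u h1 h2 (h3.trans h4) (r1.trans hr) x).trans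
    (mul_le_mul_of_nonneg_left r1 hH0)
  have b2 := (hZb u t (h1.trans h2) h3 h4).1.trans (mul_le_mul_of_nonneg_left r2 hJ)
  have b3 := (hZb u t (h1.trans h2) h3 h4).2.trans
    (mul_le_mul_of_nonneg_left (pow_le_pow_left₀ r20 r2 2) hJ)
  have b4 := (hZb s u h1 h2 (h3.trans h4)).2.trans
    (mul_le_mul_of_nonneg_left (pow_le_pow_left₀ r10 r1 2) hJ)
  set r := rho w p s t
  set h := eulerIncr f Z s u x
  have t1 : ‖f (x + h) - f x - fderiv ℝ f x h‖ ≤ K₁ * (H * r) ^ 2 := by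
    have := hf1 x (x + h)
    rw [add_sub_cancel_left] at this
    exact this.trans (by gcongr)
  have t2 : ‖secondOrder f (x + h) - secondOrder f x‖ ≤ K₃ * (H * r) := by
    have := hg1 x (x + h)
    rw [add_sub_cancel_left] at this
    exact this.trans (by gcongr)
  have t3 : ‖tensorLift (secondOrder f x) (Z.area s u)‖ ≤ (d : ℝ) ^ 2 * K₂ * (J * r ^ 2) :=
    (norm_tensorLift_le _ _).trans (by have := hg0 x; gcongr)
  have n1 := ((f (x + h) - f x - fderiv ℝ f x h).le_opNorm (Z.incr u t)).trans
    (mul_le_mul t1 b2 (norm_nonneg _) (by positivity))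
  have n2 := ((fderiv ℝ f x).le_opNorm₂ (tensorLift (secondOrder f x) (Z.area s u))
    (Z.incr u t)).trans (mul_le_mul (mul_le_mul (hf4 x) t3 (norm_nonneg _) hK₄) b2
      (norm_nonneg _) (by positivity))
  have n3 : ‖tensorLift (secondOrder f (x + h) - secondOrder f x) (Z.area u t)‖ ≤
      (d : ℝ) ^ 2 * (K₃ * (H * r)) * (J * r ^ 2) := (norm_tensorLift_le _ _).trans (by gcongr)
  refine norm_add₃_le.trans ((add_le_add (add_le_add n1 n2) n3).trans_eq ?_)
  ring

/-- The defect depends on the starting point in a Lipschitz way; uniqueness of solutions rests on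
this. -/
lemma exists_eulerDefect_lipschitz (hw : IsControl T w) (hp : 0 < p) (hf : IsTame f)
    (hZ : IsWG p w T Z) : ∃ C, 0 ≤ C ∧ ∀ s u t, 0 ≤ s → s ≤ u → u ≤ t → t ≤ T → rho w p s t ≤ 1 →
      ∀ x y, ‖eulerDefect f Z s u t x - eulerDefect f Z s u t y‖ ≤
        C * rho w p s t ^ 3 * ‖x - y‖ := by
  obtain ⟨J, hJ, hZb⟩ := hZ.exists_bound hw le_rfl
  obtain ⟨H, hH⟩ := exists_eulerBounds hw hf hZ
  have hH0 := hH.nonneg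
  obtain ⟨K₁, hK₁, hf1⟩ := hf.remainder
  obtain ⟨K₂, hK₂, hg0⟩ := hf.secondOrder.bound
  obtain ⟨K₃, hK₃, hg1⟩ := hf.secondOrder.four_point
  obtain ⟨K₄, hK₄, hf4⟩ := hf.fderiv.bound
  obtain ⟨K₅, hK₅, hf5⟩ := hf.fderiv.lipschitz
  obtain ⟨K₆, hK₆, hg6⟩ := hf.secondOrder.lipschitz
  refine ⟨K₁ * (H ^ 2 + H * H) * J + (K₅ * ((d : ℝ) ^ 2 * K₂ * J) * J +
    K₄ * ((d : ℝ) ^ 2 * K₆ * J) * J) + (d : ℝ) ^ 2 * (K₃ * (H + H)) * J,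
    by positivity, fun s u t h1 h2 h3 h4 hr x y => ?_⟩
  rw [eulerDefect_eq (hZ.chen s u t h1 h2 h3 h4), eulerDefect_eq (hZ.chen s u t h1 h2 h3 h4)]
  have r1 : rho w p s u ≤ rho w p s t := hw.rho_mono hp h1 le_rfl h2 h3 h4
  have r2 : rho w p u t ≤ rho w p s t := hw.rho_mono hp h1 h2 h3 le_rfl h4
  have r10 := hw.rho_nonneg (p := p) h1 h2 (h3.trans h4)
  have r20 := hw.rho_nonneg (p := p) (h1.trans h2) h3 h4
  have r0 := r10.trans r1
  have bx := (hH.bound s u h1 h2 (h3.trans h4) (r1.trans hr) x).trans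
    (mul_le_mul_of_nonneg_left r1 hH0)
  have by' := (hH.bound s u h1 h2 (h3.trans h4) (r1.trans hr) y).trans
    (mul_le_mul_of_nonneg_left r1 hH0)
  have bd := (hH.lipschitz h1 h2 (h3.trans h4) (r1.trans hr) x y).trans
    (mul_le_mul_of_nonneg_right (mul_le_mul_of_nonneg_left r1 hH0) (norm_nonneg _))
  have b2 := (hZb u t (h1.trans h2) h3 h4).1.trans (mul_le_mul_of_nonneg_left r2 hJ)
  have b3 := (hZb u t (h1.trans h2) h3 h4).2.trans
    (mul_le_mul_of_nonneg_left (pow_le_pow_left₀ r20 r2 2) hJ)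
  have b4 := (hZb s u h1 h2 (h3.trans h4)).2.trans
    (mul_le_mul_of_nonneg_left (pow_le_pow_left₀ r10 r1 2) hJ)
  set r := rho w p s t
  set h := eulerIncr f Z s u x
  set k := eulerIncr f Z s u y
  set D := ‖x - y‖ with hD
  have hD0 : 0 ≤ D := norm_nonneg _
  have t1 : ‖(f (x + h) - f x - fderiv ℝ f x h) - (f (y + k) - f y - fderiv ℝ f y k)‖ ≤
      K₁ * ((H * r) ^ 2 * D + H * r * (H * r * D)) :=
    (hf1 x y h k (H * r) bx by').trans (by gcongr)
  have t2 : ‖(secondOrder f (x + h) - secondOrder f x) - (secondOrder f (y + k) - secondOrder f y)‖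
      ≤ K₃ * (H * r * D + D * (H * r)) := (hg1 x h y k).trans (by gcongr)
  have t3 : ‖tensorLift (secondOrder f x) (Z.area s u)‖ ≤ (d : ℝ) ^ 2 * K₂ * (J * r ^ 2) :=
    (norm_tensorLift_le _ _).trans (by have := hg0 x; gcongr)
  have t4 : ‖tensorLift (secondOrder f x - secondOrder f y) (Z.area s u)‖ ≤
      (d : ℝ) ^ 2 * (K₆ * D) * (J * r ^ 2) :=
    (norm_tensorLift_le _ _).trans (by have := hg6 y x; gcongr)
  have t5 : ‖fderiv ℝ f x - fderiv ℝ f y‖ ≤ K₅ * D := hf5 y x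
  have n1 := (((f (x + h) - f x - fderiv ℝ f x h) -
    (f (y + k) - f y - fderiv ℝ f y k)).le_opNorm (Z.incr u t)).trans
    (mul_le_mul t1 b2 (norm_nonneg _) (by positivity))
  have n2 := ((fderiv ℝ f x - fderiv ℝ f y).le_opNorm₂ (tensorLift (secondOrder f x) (Z.area s u))
    (Z.incr u t)).trans (mul_le_mul (mul_le_mul t5 t3 (norm_nonneg _) (by positivity)) b2
      (norm_nonneg _) (by positivity))
  have n2' := ((fderiv ℝ f y).le_opNorm₂
    (tensorLift (secondOrder f x - secondOrder f y) (Z.area s u))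
    (Z.incr u t)).trans (mul_le_mul (mul_le_mul (hf4 y) t4 (norm_nonneg _) (by positivity)) b2
      (norm_nonneg _) (by positivity))
  have n3 : ‖tensorLift ((secondOrder f (x + h) - secondOrder f x) -
      (secondOrder f (y + k) - secondOrder f y)) (Z.area u t)‖ ≤
      (d : ℝ) ^ 2 * (K₃ * (H * r * D + D * (H * r))) * (J * r ^ 2) :=
    (norm_tensorLift_le _ _).trans (by gcongr)
  have e : ∀ A A' B B' C C' : Eu N, A + B + C - (A' + B' + C') =
      (A - A') + (B - B') + (C - C') := fun _ _ _ _ _ _ => by abel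
  have e1 : fderiv ℝ f x (tensorLift (secondOrder f x) (Z.area s u)) (Z.incr u t) -
      fderiv ℝ f y (tensorLift (secondOrder f y) (Z.area s u)) (Z.incr u t) =
      (fderiv ℝ f x - fderiv ℝ f y) (tensorLift (secondOrder f x) (Z.area s u)) (Z.incr u t) +
      fderiv ℝ f y (tensorLift (secondOrder f x - secondOrder f y) (Z.area s u)) (Z.incr u t) := by
    simp only [tensorLift_sub, sub_apply, map_sub]
    abel
  rw [e, e1, ← sub_apply, ← tensorLift_sub]
  refine norm_add₃_le.trans ((add_le_add (add_le_add n1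
    ((norm_add_le _ _).trans (add_le_add n2 n2'))) n3).trans_eq ?_)
  ring

/-- As `p < 3`, halving the control shrinks `rho ^ 3` by more than a factor of two; so sewing
converges for flows with Lipschitz constant close to one. -/
lemma exists_small_lipschitz (hp : 0 < p) (hp3 : p < 3) :
    ∃ κ > 0, (1 + (1 + κ) ^ 2) * halving p < 1 := by
  have h1 := halving_lt hp hp3
  have h0 := halving_pos (p := p)
  have hc : Tendsto (fun κ : ℝ => (1 + (1 + κ) ^ 2) * halving p) (𝓝[>] 0)
      (𝓝 ((1 + (1 + 0) ^ 2) * halving p)) := by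
    have : Continuous fun κ : ℝ => (1 + (1 + κ) ^ 2) * halving p := by fun_prop
    exact (this.tendsto 0).mono_left nhdsWithin_le_nhds
  have h2 : (1 + (1 + (0 : ℝ)) ^ 2) * halving p < 1 := by norm_num; linarith
  obtain ⟨κ, hκ, hκ'⟩ := ((hc.eventually_lt_const h2).and self_mem_nhdsWithin).exists
  exact ⟨κ, hκ', hκ⟩

/-- Local existence, on time intervals whose length does not depend on the starting point. -/
theorem exists_local_solution (hw : IsControl T w) (hp : 0 < p) (hp3 : p < 3) (hf : IsTame f)
    (hZ : IsWG p w T Z) : ∃ ε > 0, ∀ a b, 0 ≤ a → a ≤ b → b ≤ T → rho w p a b ≤ ε → ∀ c₀ : Eu N,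
      ∃ c : ℝ → Eu N, c a = c₀ ∧
        IsO w p a b 3 (fun s t => c t - c s - eulerIncr f Z s t (c s)) := by
  obtain ⟨H, hH⟩ := exists_eulerBounds hw hf hZ
  have hH0 := hH.nonneg
  obtain ⟨C, hC, hCb⟩ := exists_eulerDefect_bound hw hp hf hZ
  obtain ⟨κ, hκ, hκ1⟩ := exists_small_lipschitz hp hp3
  refine ⟨min 1 (κ / (H + 1)), by positivity, fun a b ha hab hb hr c₀ => ?_⟩
  have hr' : ∀ s t, a ≤ s → s ≤ t → t ≤ b → rho w p s t ≤ 1 ∧ H * rho w p s t ≤ κ := by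
    intro s t h1 h2 h3
    have h4 := (hw.rho_mono (p := p) hp ha h1 h2 h3 hb).trans hr
    have h5 := h4.trans (min_le_right _ _)
    have h6 := hw.rho_nonneg (p := p) (ha.trans h1) h2 (h3.trans hb)
    refine ⟨h4.trans (min_le_left _ _), ?_⟩
    rw [le_div_iff₀ (by positivity)] at h5
    linarith
  obtain ⟨c, hc0, L, hL, hc⟩ := exists_path_of_almostFlow hw hp ha hab hb
    (μ := fun s t x => x + eulerIncr f Z s t x) (κ := κ) (C := C) hκ.le hκ1
    (fun s x h1 h2 => by
      simp [eulerIncr, PathData.incr, hZ.area_diag (ha.trans h1) (h2.trans hb)])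
    (fun s t h1 h2 h3 x y => by
      have := hH.lipschitz (ha.trans h1) h2 (h3.trans hb) (hr' s t h1 h2 h3).1 x y
      rw [add_sub_add_comm, one_add_mul]
      refine (norm_add_le _ _).trans (add_le_add_right (this.trans ?_) _)
      gcongr
      exact (hr' s t h1 h2 h3).2)
    (fun s u t h1 h2 h3 h4 x => hCb s u t (ha.trans h1) h2 h3 (h4.trans hb)
      (hr' s t h1 (h2.trans h3) h4).1 x)
    (fun x => by
      have m0 : {q : ℝ × ℝ | a ≤ q.1 ∧ q.1 ≤ q.2 ∧ q.2 ≤ b} ⊆ simplex T :=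
        fun q hq => ⟨ha.trans hq.1, hq.2.1, hq.2.2.trans hb⟩
      have m1 : MapsTo (fun r : ℝ × ℝ => r.1) (simplex T) (Icc 0 T) :=
        fun r hr => ⟨hr.1, hr.2.1.trans hr.2.2⟩
      have m2 : MapsTo (fun r : ℝ × ℝ => r.2) (simplex T) (Icc 0 T) :=
        fun r hr => ⟨hr.1.trans hr.2.1, hr.2.2⟩
      have c1 := hZ.path_continuous.comp continuousOn_fst m1
      have c2 := hZ.path_continuous.comp continuousOn_snd m2
      refine ContinuousOn.mono ?_ m0
      exact continuousOn_const.add (((f x).continuous.comp_continuousOn (c2.sub c1)).add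
        (continuousOn_tensorLift continuousOn_const hZ.area_continuous))) c₀
  refine ⟨c, hc0, hw.isO_of_bound ha hb L fun s t h1 h2 h3 => ?_⟩
  rw [sub_sub]
  exact hc s t h1 h2 h3

lemma isO_eulerIncr (hw : IsControl T w) (hp : 0 < p) (hf : IsTame f) (hZ : IsWG p w T Z)
    (ha : 0 ≤ a) (hb : b ≤ T) (c : ℝ → Eu N) :
    IsO w p a b 1 (fun s t => eulerIncr f Z s t (c s)) := by
  obtain ⟨H, hH⟩ := exists_eulerBounds hw hf hZ
  obtain ⟨δ, hδ, h⟩ := eventually_nearDiag.1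
    ((hw.tendsto_nearDiag (p := p) hp ha hb).eventually_le_const one_pos)
  refine (hw.isO_iff ha hb).2 ⟨δ, hδ, H, fun s t h1 h2 h3 h4 => ?_⟩
  rw [pow_one]
  exact hH.bound s t (ha.trans h1) h2 (h3.trans hb) (h s t h1 h2 h3 h4) _

/-- Increments of solutions of a rough differential equation are of order one. -/
lemma isO_of_solution (hw : IsControl T w) (hp : 0 < p) (hf : IsTame f) (hZ : IsWG p w T Z)
    (ha : 0 ≤ a) (hb : b ≤ T) {c : ℝ → Eu N}
    (hc : IsO w p a b 3 (fun s t => c t - c s - eulerIncr f Z s t (c s))) :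
    IsO w p a b 1 (fun s t => c t - c s) :=
  ((hc.weaken hw hp ha hb (l := 1) (by norm_num)).add
    (isO_eulerIncr hw hp hf hZ ha hb c)).congr fun _ _ _ _ _ => sub_add_cancel _ _

/-- The difference of the errors of two paths `c`, `c'` with respect to the Euler scheme. -/
noncomputable def eulerGap (f : Eu N → Eu d →L[ℝ] Eu N) (Z : PathData (Eu d)) (c c' : ℝ → Eu N)
    (s t : ℝ) : Eu N :=
  (c t - c s - eulerIncr f Z s t (c s)) - (c' t - c' s - eulerIncr f Z s t (c' s))

/-- The gap over an interval is bounded by its values over two parts of the interval, up to the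
distance of the paths. -/
lemma norm_eulerGap_le (hw : IsControl T w) (hp : 0 < p) {H C L κ K Δ : ℝ}
    (hH : EulerBounds w p T H f Z) (hK : 0 ≤ K) (hΔ0 : 0 ≤ Δ)
    (hC : 0 ≤ C) {s u t : ℝ} (h1 : 0 ≤ s) (h2 : s ≤ u) (h3 : u ≤ t) (h4 : t ≤ T)
    (rle : rho w p s t ≤ 1) (rκ : H * rho w p s t ≤ κ) {c c' : ℝ → Eu N}
    (hdef : ‖eulerDefect f Z s u t (c s) - eulerDefect f Z s u t (c' s)‖ ≤
      C * rho w p s t ^ 3 * ‖c s - c' s‖)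
    (hc' : ‖c' u - c' s - eulerIncr f Z s u (c' s)‖ ≤ L * rho w p s t ^ 3)
    (hD : ‖c s - c' s‖ ≤ Δ)
    (h6 : ‖eulerGap f Z c c' s u‖ ≤ K) (h7 : ‖eulerGap f Z c c' u t‖ ≤ K) :
    ‖eulerGap f Z c c' s t‖ ≤
      (1 + (1 + κ) ^ 2) * K + (H * (1 + H) * L + C) * Δ * rho w p s t ^ 3 := by
  have hH0 := hH.nonneg
  have r1 : rho w p s u ≤ rho w p s t := hw.rho_mono hp h1 le_rfl h2 h3 h4
  have r2 : rho w p u t ≤ rho w p s t := hw.rho_mono hp h1 h2 h3 le_rfl h4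
  have r10 := hw.rho_nonneg (p := p) h1 h2 (h3.trans h4)
  have r20 := hw.rho_nonneg (p := p) (h1.trans h2) h3 h4
  have r0 := r10.trans r1
  have hκ : 0 ≤ κ := (mul_nonneg hH0 r0).trans rκ
  obtain ⟨x, hx⟩ : ∃ x, x = c s + eulerIncr f Z s u (c s) := ⟨_, rfl⟩
  obtain ⟨y, hy⟩ : ∃ y, y = c' s + eulerIncr f Z s u (c' s) := ⟨_, rfl⟩
  obtain ⟨e, he⟩ : ∃ e, e = c u - c s - eulerIncr f Z s u (c s) := ⟨_, rfl⟩
  obtain ⟨e', he'⟩ : ∃ e', e' = c' u - c' s - eulerIncr f Z s u (c' s) := ⟨_, rfl⟩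
  have hcu : c u = x + e := by rw [hx, he]; abel
  have hcu' : c' u = y + e' := by rw [hy, he']; abel
  have hfour := hH.four_point u t (h1.trans h2) h3 h4 (r2.trans rle) x e y e'
  have hid : eulerGap f Z c c' s t = eulerGap f Z c c' u t + eulerGap f Z c c' s u +
      ((eulerIncr f Z u t (x + e) - eulerIncr f Z u t x) -
        (eulerIncr f Z u t (y + e') - eulerIncr f Z u t y)) +
      (eulerDefect f Z s u t (c s) - eulerDefect f Z s u t (c' s)) := by
    rw [← hcu, ← hcu', hx, hy]
    simp only [eulerGap, eulerDefect]
    abel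
  have hee : ‖e - e'‖ ≤ K := by rw [he, he']; exact h6
  rw [← he'] at hc'
  have hxy : ‖x - y‖ ≤ (1 + H) * Δ := by
    have := hH.lipschitz h1 h2 (h3.trans h4) (r1.trans rle) (c s) (c' s)
    rw [hx, hy, add_sub_add_comm, one_add_mul]
    refine (norm_add_le _ _).trans (add_le_add hD (this.trans ?_))
    calc H * rho w p s u * ‖c s - c' s‖ ≤ H * 1 * Δ := by
          gcongr; exact r1.trans rle
      _ = H * Δ := by ring
  have q1 : H * rho w p u t * ‖e - e'‖ ≤ κ * K := by
    have : H * rho w p u t ≤ κ := (mul_le_mul_of_nonneg_left r2 hH0).trans rκ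
    gcongr
  have q2 : H * rho w p u t * (‖x - y‖ * ‖e'‖) ≤ H * 1 * ((1 + H) * Δ * (L * rho w p s t ^ 3)) := by
    gcongr
    exact r2.trans rle
  have hdef' : C * rho w p s t ^ 3 * ‖c s - c' s‖ ≤ C * rho w p s t ^ 3 * Δ := by gcongr
  rw [mul_add] at hfour
  have hκK : 0 ≤ κ ^ 2 * K + κ * K := by positivity
  rw [hid]
  refine (norm_add_le _ _).trans ?_
  refine (add_le_add_left norm_add₃_le _).trans ?_
  refine (add_le_add (add_le_add (add_le_add h7 h6) (hfour.trans (add_le_add q1 q2)))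
    (hdef.trans hdef')).trans ?_
  linear_combination hκK

/-- Uniqueness of solutions. The difference of two solutions is compared with its own Euler
increment; halving of the control shows that the error is at most a small multiple of the
supremum of the difference. -/
theorem eq_of_solution (hw : IsControl T w) (hp : 0 < p) (hp3 : p < 3) (hf : IsTame f)
    (hZ : IsWG p w T Z) (ha : 0 ≤ a) (hb : b ≤ T) {c c' : ℝ → Eu N} (hcc : c a = c' a)
    (hc : IsO w p a b 3 (fun s t => c t - c s - eulerIncr f Z s t (c s)))
    (hc' : IsO w p a b 3 (fun s t => c' t - c' s - eulerIncr f Z s t (c' s))) :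
    ∀ t, a ≤ t → t ≤ b → c t = c' t := by
  obtain ⟨H, hH⟩ := exists_eulerBounds hw hf hZ
  have hH0 := hH.nonneg
  obtain ⟨C, hC, hCb⟩ := exists_eulerDefect_lipschitz hw hp hf hZ
  obtain ⟨κ, hκ, hκ1⟩ := exists_small_lipschitz hp hp3
  have hcont : ContinuousOn (fun t => c t - c' t) (Icc a b) :=
    (continuousOn_of_isO (k := 0) hw hp ha hb (isO_of_solution hw hp hf hZ ha hb hc)).sub
      (continuousOn_of_isO (k := 0) hw hp ha hb (isO_of_solution hw hp hf hZ ha hb hc'))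
  obtain ⟨δ₁, hδ₁, L₁, hL₁⟩ := (hw.isO_iff ha hb).1 hc
  obtain ⟨δ₂, hδ₂, L₂, hL₂⟩ := (hw.isO_iff ha hb).1 hc'
  set L := max 0 L₂ with hL
  have hL0 : 0 ≤ L := le_max_left _ _
  set m := (1 + (1 + κ) ^ 2) * halving p with hm
  set G := (H * (1 + H) * L + C) / (1 - m) with hG
  have hm1 : 0 < 1 - m := by linarith
  have hG0 : 0 ≤ G := by positivity
  -- for `rho ≤ ε` the final bound on the supremum `Δ` of the difference is `Δ ≤ Δ / 2`
  set ε := min (min 1 (κ / (H + 1))) (1 / (2 * (G + 1))) with hε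
  have hε0 : 0 < ε := by positivity
  obtain ⟨δ₃, hδ₃, hρ⟩ := eventually_nearDiag.1
    ((hw.tendsto_nearDiag (p := p) hp ha hb).eventually_le_const hε0)
  set δ := min (min δ₁ δ₂) δ₃ with hδ
  have hδ0 : 0 < δ := by positivity
  have key : ∀ s t, a ≤ s → s ≤ t → t ≤ b → t - s ≤ δ → c s = c' s → c t = c' t := by
    intro s₀ t₀ k1 k2 k3 k4 hs0
    have hs00 := ha.trans k1
    have ht0T := k3.trans hb
    obtain ⟨τ, hτ, hτmax⟩ := isCompact_Icc.exists_isMaxOn (nonempty_Icc.2 k2)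
      (hcont.norm.mono (Icc_subset_Icc k1 k3))
    set Δ := ‖c τ - c' τ‖ with hΔ
    have hΔ0 : 0 ≤ Δ := norm_nonneg _
    have hΔb : ∀ u, s₀ ≤ u → u ≤ t₀ → ‖c u - c' u‖ ≤ Δ := fun u h1 h2 => hτmax ⟨h1, h2⟩
    have hρ' : ∀ s t, s₀ ≤ s → s ≤ t → t ≤ t₀ → 0 ≤ rho w p s t ∧ rho w p s t ≤ ε := by
      intro s t h1 h2 h3
      exact ⟨hw.rho_nonneg (hs00.trans h1) h2 (h3.trans ht0T),
        hρ s t (k1.trans h1) h2 (h3.trans k3) (by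
          have : δ ≤ δ₃ := min_le_right _ _
          linarith)⟩
    have hρ1 : ∀ s t, s₀ ≤ s → s ≤ t → t ≤ t₀ → rho w p s t ≤ 1 := fun s t h1 h2 h3 =>
      (hρ' s t h1 h2 h3).2.trans ((min_le_left _ _).trans (min_le_left _ _))
    have hρκ : ∀ s t, s₀ ≤ s → s ≤ t → t ≤ t₀ → H * rho w p s t ≤ κ := fun s t h1 h2 h3 => by
      have h5 := (hρ' s t h1 h2 h3).2.trans ((min_le_left _ _).trans (min_le_right _ _))
      have h6 := (hρ' s t h1 h2 h3).1
      rw [le_div_iff₀ (by positivity)] at h5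
      linarith
    have hRK : ∃ K, ∀ s t, s₀ ≤ s → s ≤ t → t ≤ t₀ → t - s ≤ δ →
        ‖eulerGap f Z c c' s t‖ ≤ K * rho w p s t ^ 3 := by
      refine ⟨L₁ + L₂, fun s t h1 h2 h3 h4 => ?_⟩
      have e1 := hL₁ s t (k1.trans h1) h2 (h3.trans k3)
        (h4.trans ((min_le_left _ _).trans (min_le_left _ _)))
      have e2 := hL₂ s t (k1.trans h1) h2 (h3.trans k3)
        (h4.trans ((min_le_left _ _).trans (min_le_right _ _)))
      rw [add_mul]
      exact (norm_sub_le _ _).trans (add_le_add e1 e2)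
    have hstep : ∀ K, 0 ≤ K → ∀ s u t, s₀ ≤ s → s ≤ u → u ≤ t → t ≤ t₀ → t - s ≤ δ →
        ‖eulerGap f Z c c' s u‖ ≤ K → ‖eulerGap f Z c c' u t‖ ≤ K → ‖eulerGap f Z c c' s t‖ ≤
          (1 + (1 + κ) ^ 2) * K + (H * (1 + H) * L + C) * Δ * rho w p s t ^ 3 := by
      intro K hK s u t h1 h2 h3 h4 h5 h6 h7
      refine norm_eulerGap_le hw hp hH hK hΔ0 hC (hs00.trans h1) h2 h3 (h4.trans ht0T)
        (hρ1 s t h1 (h2.trans h3) h4) (hρκ s t h1 (h2.trans h3) h4)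
        (hCb s u t (hs00.trans h1) h2 h3 (h4.trans ht0T) (hρ1 s t h1 (h2.trans h3) h4) _ _)
        ?_ (hΔb s h1 (h2.trans (h3.trans h4))) h6 h7
      refine (hL₂ s u (k1.trans h1) h2 (h3.trans (h4.trans k3)) (le_trans (by linarith)
        (h5.trans ((min_le_left _ _).trans (min_le_right _ _))))).trans ?_
      have := (hρ' s u h1 h2 (h3.trans h4)).1
      refine mul_le_mul (le_max_right _ _) (pow_le_pow_left₀ this ?_ 3) (pow_nonneg this 3) hL0
      exact hw.rho_mono hp (hs00.trans h1) le_rfl h2 h3 (h4.trans ht0T)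
    have hfin := hw.halving_bound (p := p) hp hs00 ht0T (r := fun s t => ‖eulerGap f Z c c' s t‖)
      (A := 1 + (1 + κ) ^ 2) (m := m) (D := (H * (1 + H) * L + C) * Δ) (δ := δ) le_rfl
      (by positivity) (by linarith) hRK hstep s₀ τ le_rfl hτ.1 hτ.2 (by linarith [hτ.2])
    have hRs : eulerGap f Z c c' s₀ τ = c τ - c' τ := by
      simp only [eulerGap, hs0]
      abel
    rw [hRs, max_eq_left (by positivity), ← hΔ] at hfin
    have h3 : rho w p s₀ τ ^ 3 ≤ 1 / (2 * (G + 1)) := by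
      have h1 := hρ' s₀ τ le_rfl hτ.1 hτ.2
      have h2 := hρ1 s₀ τ le_rfl hτ.1 hτ.2
      calc rho w p s₀ τ ^ 3 ≤ rho w p s₀ τ ^ 1 := pow_le_pow_of_le_one h1.1 h2 (by norm_num)
        _ = rho w p s₀ τ := pow_one _
        _ ≤ _ := h1.2.trans (min_le_right _ _)
    have h4 : Δ ≤ G * Δ * (1 / (2 * (G + 1))) := by
      refine hfin.trans ?_
      have : (H * (1 + H) * L + C) * Δ / (1 - m) = G * Δ := by rw [hG]; ring
      rw [this]
      gcongr
    have h5 : Δ ≤ 0 := by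
      rw [mul_one_div, le_div_iff₀ (by positivity)] at h4
      nlinarith
    have := (hΔb t₀ k2 le_rfl).trans h5
    exact sub_eq_zero.1 (norm_le_zero_iff.1 this)
  intro t h1 h2
  exact forall_of_forall_short hδ0 (P := fun s t => c s = c' s → c t = c' t)
    (fun s u t _ _ _ _ h5 h6 h7 => h6 (h5 h7)) key a t le_rfl h1 h2 hcc

end RDE

/-! ### Parallelisms of embedded submanifolds -/

section Geometry

variable {N d : ℕ} {M : Set (Eu N)}

/-- By the implicit function theorem every vector in the kernel of the derivative of a local
defining function is a limit of directions of chords of `M`. -/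
lemma tangentVectors_subset_tangentConeAt {m : Eu N} (hm : m ∈ M) :
    tangentVectors d M m ⊆ tangentConeAt ℝ M m := by
  rintro v ⟨U, F, hmU, hF, hv⟩
  have hFm : F m = 0 := by
    have : m ∈ U ∩ M := ⟨hmU, hm⟩
    rw [hF.zero_set] at this
    exact this.2
  have hc : ContDiffAt ℝ ∞ F m := hF.smooth.contDiffAt (hF.isOpen.mem_nhds hmU)
  have hf : HasStrictFDerivAt F (fderiv ℝ F m) m := hc.hasStrictFDerivAt (by norm_num)
  have hr : (fderiv ℝ F m).range = ⊤ := LinearMap.range_eq_top.2 (hF.surjective m hmU)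
  set g := hf.implicitFunction _ _ hr (F m) with hg
  have hg' : HasStrictFDerivAt g (fderiv ℝ F m).ker.subtypeL 0 := hf.to_implicitFunction hr
  have hg0 : g 0 = m := by
    exact hf.implicitFunction_apply_image hr
  let W : Set (fderiv ℝ F m).ker := {y | F (g y) = 0 ∧ g y ∈ U}
  have hW : W ∈ 𝓝 0 := by
    have h1 : ∀ᶠ y in 𝓝 (0 : (fderiv ℝ F m).ker), F (g y) = F m := by
      have := hf.map_implicitFunction_eq hr
      have h2 : Tendsto (fun y : (fderiv ℝ F m).ker => (F m, y)) (𝓝 0) (𝓝 (F m, 0)) :=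
        (Continuous.prodMk_right (F m)).tendsto 0
      exact h2.eventually this
    have h2 : ∀ᶠ y in 𝓝 (0 : (fderiv ℝ F m).ker), g y ∈ U :=
      hg'.hasFDerivAt.continuousAt.eventually (by rw [hg0]; exact hF.isOpen.mem_nhds hmU)
    filter_upwards [h1, h2] with y hy hy'
    exact ⟨hy.trans hFm, hy'⟩
  have h3 := (hg'.hasFDerivAt.hasFDerivWithinAt (s := W)).mapsTo_tangent_cone
    (by rw [tangentConeAt_of_mem_nhds hW]; exact mem_univ (⟨v, hv⟩ : (fderiv ℝ F m).ker))
  rw [hg0] at h3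
  refine tangentConeAt_mono ?_ h3
  rintro _ ⟨y, hy, rfl⟩
  have : g y ∈ {x | x ∈ U ∧ F x = 0} := ⟨hy.2, hy.1⟩
  rw [← hF.zero_set] at this
  exact this.2

/-- Derivatives in tangent directions only depend on the values on `M`. -/
lemma fderiv_apply_eq_of_eqOn {W : Type*} [NormedAddCommGroup W] [NormedSpace ℝ W]
    {m v : Eu N} (hm : m ∈ M) (hv : v ∈ tangentVectors d M m) {f g : Eu N → W}
    (hf : DifferentiableAt ℝ f m) (hg : DifferentiableAt ℝ g m)
    (h : f =ᶠ[𝓝[M] m] g) : fderiv ℝ f m v = fderiv ℝ g m v := by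
  refine HasFDerivWithinAt.unique_on (s := M) (x := m) (f := f) hf.hasFDerivAt.hasFDerivWithinAt ?_
    (tangentVectors_subset_tangentConeAt hm hv)
  exact hg.hasFDerivAt.hasFDerivWithinAt.congr_of_eventuallyEq h (h.self_of_nhdsWithin hm)

lemma fderivWithin_apply_eq {W : Type*} [NormedAddCommGroup W] [NormedSpace ℝ W]
    {m v : Eu N} (hm : m ∈ M) (hv : v ∈ tangentVectors d M m) {f g : Eu N → W}
    (hg : DifferentiableAt ℝ g m)
    (h : f =ᶠ[𝓝[M] m] g) : fderivWithin ℝ f M m v = fderiv ℝ g m v := by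
  have h1 : HasFDerivWithinAt f (fderiv ℝ g m) M m :=
    hg.hasFDerivAt.hasFDerivWithinAt.congr_of_eventuallyEq h (h.self_of_nhdsWithin hm)
  exact HasFDerivWithinAt.unique_on h1.differentiableWithinAt.hasFDerivWithinAt h1
    (tangentVectors_subset_tangentConeAt hm hv)

variable {Y f : Eu N → Eu d →L[ℝ] Eu N}

lemma IsParallelism.mem_tangentVectors (hY : IsParallelism d M Y) {m : Eu N} (hm : m ∈ M)
    (a : Eu d) : Y m a ∈ tangentVectors d M m :=
  hY.range_eq m hm ▸ mem_range_self a

/-- The derivative of `Y` along `M` can be computed with any extension `f` of `Y`. -/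
lemma IsParallelism.dirDeriv_eq (hY : IsParallelism d M Y) {m : Eu N} (hm : m ∈ M)
    (hf : DifferentiableAt ℝ f m) (h : Y =ᶠ[𝓝[M] m] f) :
    dirDeriv M Y m = tensorLift (secondOrder f m) := by
  refine TensorProduct.ext' fun a b => ?_
  have h1 := fderivWithin_apply_eq hm (hY.mem_tangentVectors hm a) hf h
  have h2 : Y m = f m := h.self_of_nhdsWithin hm
  simp only [dirDeriv, secondOrder, tensorLift_tmul, TensorProduct.lift.tmul]
  simp [h1, ← h2]

/-- Differentiating `α ∘ Y = const` along `M`. -/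
lemma IsParallelism.fderiv_comp (hY : IsParallelism d M Y) {m : Eu N} (hm : m ∈ M)
    {W : Type*} [NormedAddCommGroup W] [InnerProductSpace ℝ W] {α : Eu N → Eu N →L[ℝ] W}
    (hα : DifferentiableAt ℝ α m) (hf : DifferentiableAt ℝ f m) (h : Y =ᶠ[𝓝[M] m] f)
    {A : Eu d →L[ℝ] W} (hA : ∀ᶠ x in 𝓝[M] m, (α x).comp (Y x) = A) (t : Eu d ⊗[ℝ] Eu d) :
    tensorLift (fderiv ℝ α m) (TensorProduct.map (Y m).toLinearMap (Y m).toLinearMap t) +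
      α m (tensorLift (secondOrder f m) t) = 0 := by
  have h2 : Y m = f m := h.self_of_nhdsWithin hm
  rw [tensorLift_map]
  have hd : HasFDerivAt (fun x => (α x).comp (f x))
    ((ContinuousLinearMap.compL ℝ (Eu d) (Eu N) W (α m)).comp (fderiv ℝ f m) +
      ((ContinuousLinearMap.compL ℝ (Eu d) (Eu N) W).flip (f m)).comp (fderiv ℝ α m)) m :=
    hα.hasFDerivAt.clm_comp hf.hasFDerivAt
  have key : ∀ a b, fderiv ℝ α m (Y m a) (Y m b) + α m (secondOrder f m a b) = 0 := by
    intro a b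
    have h3 := fderiv_apply_eq_of_eqOn hm (hY.mem_tangentVectors hm a) hd.differentiableAt
      (differentiableAt_const A) (by
        filter_upwards [h, hA] with x hx hx'
        rw [← hx, hx'])
    rw [hd.fderiv] at h3
    have h4 := congrArg (fun L : Eu d →L[ℝ] W => L b) h3
    simp at h4
    rw [← h4, h2, add_comm]
    simp [secondOrder]
  induction t with
  | zero => simp
  | tmul a b => simpa using key a b
  | add x y hx hy =>
    rw [map_add, map_add, map_add, add_add_add_comm, hx, hy, add_zero]

lemma IsParallelism.exists_local_extension (hY : IsParallelism d M Y) {m : Eu N} (hm : m ∈ M) :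
    ∃ (U : Set (Eu N)) (f : Eu N → Eu d →L[ℝ] Eu N), IsOpen U ∧ m ∈ U ∧ ContDiffOn ℝ ∞ f U ∧
      EqOn Y f (M ∩ U) := by
  choose U g hU hmU hg hgY using fun i : Fin d =>
    (hY.vectorField (EuclideanSpace.single i (1 : ℝ))).1 m hm
  refine ⟨⋂ i, U i, fun x => ∑ i, (EuclideanSpace.proj i : Eu d →L[ℝ] ℝ).smulRight (g i x),
    isOpen_iInter_of_finite hU, mem_iInter.2 hmU, ?_, fun x hx => ?_⟩
  · refine ContDiffOn.sum fun i _ => ?_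
    exact (ContinuousLinearMap.smulRightL ℝ (Eu d) (Eu N)
      (EuclideanSpace.proj i)).contDiff.comp_contDiffOn ((hg i).mono (iInter_subset _ i))
  · ext1 a
    have h1 : a = ∑ i, a i • EuclideanSpace.single i (1 : ℝ) := by
      have := (EuclideanSpace.basisFun (Fin d) ℝ).sum_repr a
      simpa using this.symm
    conv_lhs => rw [h1]
    rw [map_sum, sum_apply]
    refine Finset.sum_congr rfl fun i _ => ?_
    rw [map_smul, ContinuousLinearMap.smulRight_apply, PiLp.proj_apply,
      ← hgY i ⟨hx.1, mem_iInter.1 hx.2 i⟩]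

lemma IsParallelism.exists_local_pair (hY : IsParallelism d M Y) {m : Eu N} (hm : m ∈ M) :
    ∃ (U : Set (Eu N)) (β : Eu N → Eu N →L[ℝ] Eu d) (f : Eu N → Eu d →L[ℝ] Eu N), IsOpen U ∧
      m ∈ U ∧ ContDiffOn ℝ ∞ β U ∧ ContDiffOn ℝ ∞ f U ∧
      ∀ x ∈ U, x ∈ M → (β x).comp (Y x) = ContinuousLinearMap.id ℝ (Eu d) ∧ f x = Y x := by
  obtain ⟨U, f, hU, hmU, hf, hfY⟩ := hY.exists_local_extension hm
  -- with `L` a left inverse of `Y m`, the function `(L f)⁻¹ L` is a left inverse of `f`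
  obtain ⟨L, hL⟩ := (Y m).toLinearMap.exists_leftInverse_of_injective
    (LinearMap.ker_eq_bot.2 (hY.injective m hm))
  let L' : Eu N →L[ℝ] Eu d := LinearMap.toContinuousLinearMap L
  let g : Eu N → Eu d →L[ℝ] Eu d := fun x => L'.comp (f x)
  have hg : ContDiffOn ℝ ∞ g U := contDiffOn_const.clm_comp hf
  have hgm : g m = 1 := by
    ext1 a
    have := LinearMap.congr_fun hL a
    simp only [g, ← hfY ⟨hm, hmU⟩]
    exact this
  let U' := U ∩ g ⁻¹' {x | IsUnit x}
  have hU' : IsOpen U' := hg.continuousOn.isOpen_inter_preimage hU Units.isOpen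
  refine ⟨U', fun x => (Ring.inverse (g x)).comp L', f, hU', ⟨hmU, by simp [hgm]⟩, ?_,
    hf.mono inter_subset_left, fun x hx hxM => ⟨?_, (hfY ⟨hxM, hx.1⟩).symm⟩⟩
  · refine ContDiffOn.clm_comp (fun x hx => ?_) contDiffOn_const
    obtain ⟨u, hu⟩ := hx.2
    have h1 : ContDiffAt ℝ ∞ Ring.inverse (g x) := hu ▸ contDiffAt_ringInverse ℝ u
    exact h1.comp_contDiffWithinAt x ((hg.mono inter_subset_left) x hx)
  · rw [hfY ⟨hxM, hx.1⟩]
    exact Ring.inverse_mul_cancel _ hx.2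

/-- A parallelism and its inverse extend to an open neighbourhood of `M`. The conditions on the two
extensions are affine at each point, so that a partition of unity glues local extensions. -/
lemma IsParallelism.exists_pair (hY : IsParallelism d M Y) :
    ∃ (U : Set (Eu N)) (β : Eu N → Eu N →L[ℝ] Eu d) (f : Eu N → Eu d →L[ℝ] Eu N), IsOpen U ∧
      M ⊆ U ∧ ContDiffOn ℝ ∞ β U ∧ ContDiffOn ℝ ∞ f U ∧
      ∀ x ∈ M, (β x).comp (Y x) = ContinuousLinearMap.id ℝ (Eu d) ∧ f x = Y x := by
  choose V β f hV hmV hβ hf h using fun m : M => hY.exists_local_pair m.2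
  let U : TopologicalSpace.Opens (Eu N) := ⟨⋃ m, V m, isOpen_iUnion hV⟩
  let t : U → Set ((Eu N →L[ℝ] Eu d) × (Eu d →L[ℝ] Eu N)) := fun x =>
    {q | (x : Eu N) ∈ M → q.1.comp (Y x) = ContinuousLinearMap.id ℝ (Eu d) ∧ q.2 = Y x}
  have ht : ∀ x, Convex ℝ (t x) := by
    intro x q hq q' hq' a b _ _ hab hx
    obtain ⟨h1, h2⟩ := hq hx
    obtain ⟨h3, h4⟩ := hq' hx
    constructor
    · change (a • q.1 + b • q'.1).comp (Y x) = _
      rw [ContinuousLinearMap.add_comp, ContinuousLinearMap.smul_comp,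
        ContinuousLinearMap.smul_comp, h1, h3]
      exact Convex.combo_self hab _
    · change a • q.2 + b • q'.2 = _
      rw [h2, h4]
      exact Convex.combo_self hab _
  have hloc : ∀ x : U, ∃ W ∈ 𝓝 x, ∃ g : U → (Eu N →L[ℝ] Eu d) × (Eu d →L[ℝ] Eu N),
      ContMDiffOn (modelWithCornersSelf ℝ (Eu N))
          (modelWithCornersSelf ℝ ((Eu N →L[ℝ] Eu d) × (Eu d →L[ℝ] Eu N))) ∞ g W ∧
        ∀ y ∈ W, g y ∈ t y := by
    intro x
    obtain ⟨m, hm⟩ := mem_iUnion.1 x.2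
    refine ⟨Subtype.val ⁻¹' V m, ((hV m).preimage continuous_subtype_val).mem_nhds hm,
      fun y => (β m y, f m y), fun y hy => ContMDiffAt.contMDiffWithinAt ?_,
      fun y hy hyM => h m y hy hyM⟩
    refine (contMDiffAt_subtype_iff (f := fun y : Eu N => (β m y, f m y))).2 ?_
    exact (((hβ m).contDiffAt ((hV m).mem_nhds hy)).prodMk
      ((hf m).contDiffAt ((hV m).mem_nhds hy))).contMDiffAt
  have : LocallyCompactSpace U := U.2.locallyCompactSpace
  have : SigmaCompactSpace U := sigmaCompactSpace_of_locallyCompact_secondCountable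
  obtain ⟨g, hg⟩ := exists_contMDiffMap_forall_mem_convex_of_local
    (modelWithCornersSelf ℝ (Eu N)) ht hloc
  classical
  let G : Eu N → (Eu N →L[ℝ] Eu d) × (Eu d →L[ℝ] Eu N) := fun x =>
    if hx : x ∈ U then g ⟨x, hx⟩ else 0
  have hG : ContDiffOn ℝ ∞ G U := by
    intro x hx
    have h1 : ContMDiffAt (modelWithCornersSelf ℝ (Eu N))
        (modelWithCornersSelf ℝ ((Eu N →L[ℝ] Eu d) × (Eu d →L[ℝ] Eu N))) ∞
        (fun y : U => G y) ⟨x, hx⟩ := by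
      have : (fun y : U => G y) = g := by
        funext y
        simp only [G, dif_pos y.2]
      rw [this]
      exact g.contMDiff _
    exact (contMDiffAt_iff_contDiffAt.1 (contMDiffAt_subtype_iff.1 h1)).contDiffWithinAt
  have hMU : M ⊆ U := fun x hx => mem_iUnion.2 ⟨⟨x, hx⟩, hmV _⟩
  refine ⟨U, fun x => (G x).1, fun x => (G x).2, U.2, hMU, hG.fst, hG.snd, fun x hx => ?_⟩
  have e : G x = g ⟨x, hMU hx⟩ := dif_pos (hMU hx)
  simp only [e]
  exact hg ⟨x, hMU hx⟩ hx

/-- Smooth cutoff: near a compact subset of its domain, a smooth function agrees with a smooth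
function with compact support. -/
lemma exists_isTame_eventuallyEq {n : ℕ} {F : Type*} [NormedAddCommGroup F]
    [NormedSpace ℝ F] {K U : Set (Eu n)} (hK : IsCompact K) (hU : IsOpen U)
    (hKU : K ⊆ U) {g : Eu n → F} (hg : ContDiffOn ℝ ∞ g U) :
    ∃ g', IsTame g' ∧ (∀ x ∈ K, g' =ᶠ[𝓝 x] g) ∧ ∀ x, ∃ c : ℝ, g' x = c • g x := by
  obtain ⟨K', hK', hKK', hK'U⟩ := exists_compact_between hK hU hKU
  obtain ⟨χ, hχ1, hχ0, -⟩ := exists_contMDiffMap_one_nhds_of_subset_interior (n := (⊤ : ℕ∞))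
    (modelWithCornersSelf ℝ (Eu n)) hK.isClosed hKK'
  have hχs : ContDiff ℝ ∞ χ := contMDiff_iff_contDiff.1 χ.contMDiff
  refine ⟨fun x => χ x • g x, ⟨contDiff_iff_contDiffAt.2 fun x => ?_, ?_⟩, fun x hx => ?_,
    fun x => ⟨χ x, rfl⟩⟩
  · by_cases hx : x ∈ U
    · exact hχs.contDiffAt.smul (hg.contDiffAt (hU.mem_nhds hx))
    · have : (fun x => χ x • g x) =ᶠ[𝓝 x] fun _ => 0 := by
        filter_upwards [hK'.isClosed.isOpen_compl.mem_nhds fun h => hx (hK'U h)] with y hy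
        rw [hχ0 y hy, zero_smul]
      exact contDiffAt_const.congr_of_eventuallyEq this
  · exact HasCompactSupport.intro hK' fun x hx => by rw [hχ0 x hx, zero_smul]
  · filter_upwards [(eventually_nhdsSet_iff_forall.1 hχ1) x hx] with y hy
    rw [hy, one_smul]

lemma IsLocalDefining.fderiv_apply_eq_zero {U : Set (Eu N)} {F : Eu N → Eu (N - d)}
    (hF : IsLocalDefining d M U F) {m v : Eu N} (hm : m ∈ M) (hmU : m ∈ U)
    (hv : v ∈ tangentVectors d M m) : fderiv ℝ F m v = 0 := by
  have h := fderiv_apply_eq_of_eqOn (f := F) (g := fun _ => 0) hm hv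
    ((hF.smooth.contDiffAt (hF.isOpen.mem_nhds hmU)).differentiableAt (by norm_num))
    (differentiableAt_const _) (by
      filter_upwards [self_mem_nhdsWithin, mem_nhdsWithin_of_mem_nhds (hF.isOpen.mem_nhds hmU)]
        with x hx hxU
      have : x ∈ U ∩ M := ⟨hxU, hx⟩
      rw [hF.zero_set] at this
      exact this.2)
  simpa using h

/-- Near every point of `M` the vector fields `Y_a` extend to compactly supported vector fields
which are tangent to all the level sets of a defining function of `M`. -/
lemma IsParallelism.exists_tangent_extension (hY : IsParallelism d M Y)
    (hM : IsEmbeddedSubmanifold d M) {m : Eu N} (hm : m ∈ M) :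
    ∃ (B : Set (Eu N)) (f : Eu N → Eu d →L[ℝ] Eu N) (F : Eu N → Eu (N - d)), IsOpen B ∧ m ∈ B ∧
      IsTame f ∧ IsTame F ∧ EqOn Y f (M ∩ B) ∧ (∀ x ∈ B, x ∈ M ↔ F x = 0) ∧
      ∀ x ∈ B, (fderiv ℝ F x).comp (f x) = 0 := by
  obtain ⟨U₀, f, hU₀, hmU₀, hf, hfY⟩ := hY.exists_local_extension hm
  obtain ⟨U₁, F, hmU₁, hF⟩ := hM.locally_defined m hm
  -- with `L` a right inverse of `F'(m)`, the operator `L (F' L)⁻¹ F'` is a projection with the same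
  -- kernel as `F'`; it is subtracted from the identity to make `f` tangent to the level sets
  obtain ⟨L, hL⟩ := (fderiv ℝ F m).toLinearMap.exists_rightInverse_of_surjective
    (LinearMap.range_eq_top.2 (hF.surjective m hmU₁))
  let L' : Eu (N - d) →L[ℝ] Eu N := LinearMap.toContinuousLinearMap L
  let h : Eu N → Eu (N - d) →L[ℝ] Eu (N - d) := fun x => (fderiv ℝ F x).comp L'
  have hF' : ContDiffOn ℝ ∞ (fderiv ℝ F) U₁ := hF.smooth.fderiv_of_isOpen hF.isOpen (by norm_num)
  have hh : ContDiffOn ℝ ∞ h U₁ := hF'.clm_comp contDiffOn_const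
  have hhm : h m = 1 := by
    ext1 a
    exact LinearMap.congr_fun hL a
  let U := U₀ ∩ (U₁ ∩ h ⁻¹' {x | IsUnit x})
  have hU : IsOpen U := hU₀.inter (hh.continuousOn.isOpen_inter_preimage hF.isOpen Units.isOpen)
  have hmU : m ∈ U := ⟨hmU₀, hmU₁, by simp [hhm]⟩
  have hU1 : U ⊆ U₁ := fun x hx => hx.2.1
  let g : Eu N → Eu d →L[ℝ] Eu N := fun x =>
    f x - (L'.comp (Ring.inverse (h x))).comp ((fderiv ℝ F x).comp (f x))
  have hg : ContDiffOn ℝ ∞ g U := by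
    have hf' := hf.mono (inter_subset_left : U ⊆ U₀)
    refine hf'.sub (ContDiffOn.clm_comp (contDiffOn_const.clm_comp fun x hx => ?_)
      ((hF'.mono hU1).clm_comp hf'))
    obtain ⟨u, hu⟩ := hx.2.2
    have h1 : ContDiffAt ℝ ∞ Ring.inverse (h x) := hu ▸ contDiffAt_ringInverse ℝ u
    exact h1.comp_contDiffWithinAt x ((hh.mono hU1) x hx)
  have hFg : ∀ x ∈ U, (fderiv ℝ F x).comp (g x) = 0 := by
    intro x hx
    have h1 : (h x).comp (Ring.inverse (h x)) = ContinuousLinearMap.id ℝ _ :=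
      Ring.mul_inverse_cancel _ hx.2.2
    ext1 a
    have h2 := congrArg (fun A : Eu (N - d) →L[ℝ] Eu (N - d) => A (fderiv ℝ F x (f x a))) h1
    simp only [h, ContinuousLinearMap.comp_apply, ContinuousLinearMap.id_apply] at h2
    simp only [g, h, ContinuousLinearMap.comp_apply, sub_apply, map_sub, h2,
      sub_self, zero_apply]
  have hgY : EqOn Y g (M ∩ U) := by
    intro x hx
    have h1 : (fderiv ℝ F x).comp (Y x) = 0 := by
      ext1 a
      exact hF.fderiv_apply_eq_zero hx.1 (hU1 hx.2) (hY.mem_tangentVectors hx.1 a)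
    simp only [g, ← hfY ⟨hx.1, hx.2.1⟩, h1, ContinuousLinearMap.comp_zero, sub_zero]
  obtain ⟨r, hr, hrU⟩ := Metric.nhds_basis_closedBall.mem_iff.1 (hU.mem_nhds hmU)
  obtain ⟨g', hg', hgg', -⟩ := exists_isTame_eventuallyEq (isCompact_closedBall m r) hU hrU hg
  obtain ⟨F₁, hF₁, hFF₁, -⟩ := exists_isTame_eventuallyEq (isCompact_closedBall m r) hF.isOpen
    (hrU.trans hU1) hF.smooth
  have hb : Metric.ball m r ⊆ Metric.closedBall m r := Metric.ball_subset_closedBall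
  refine ⟨Metric.ball m r, g', F₁, Metric.isOpen_ball, Metric.mem_ball_self hr, hg', hF₁,
    fun x hx => ?_, fun x hx => ?_, fun x hx => ?_⟩
  · rw [(hgg' x (hb hx.2)).self_of_nhds]
    exact hgY ⟨hx.1, hrU (hb hx.2)⟩
  · rw [(hFF₁ x (hb hx)).self_of_nhds]
    have hxU := hU1 (hrU (hb hx))
    have := Set.ext_iff.1 hF.zero_set x
    constructor
    · exact fun h => (this.1 ⟨hxU, h⟩).2
    · exact fun h => (this.2 ⟨hxU, h⟩).2
  · rw [(hgg' x (hb hx)).self_of_nhds, (hFF₁ x (hb hx)).fderiv_eq]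
    exact hFg x (hrU (hb hx))

end Geometry

/-! ### Integrals of one-forms along rough paths on a submanifold -/

section Forms

variable {N d k : ℕ} {T p S : ℝ} {w : ℝ → ℝ → ℝ} {M U : Set (Eu N)} {X : PathData (Eu N)}

lemma Approx.congr {W : Type*} [NormedAddCommGroup W] {g h g' h' : ℝ → ℝ → W}
    (H : Approx p w S g h) (hg : ∀ s t, 0 ≤ s → s ≤ t → t ≤ S → g s t = g' s t)
    (hh : ∀ s t, 0 ≤ s → s ≤ t → t ≤ S → h s t = h' s t) : Approx p w S g' h' := by
  obtain ⟨δ, hδ, C, H⟩ := H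
  refine ⟨δ, hδ, C, fun s t h0 h1 h2 h3 => ?_⟩
  rw [← hg s t h0 h1 h2, ← hh s t h0 h1 h2]
  exact H s t h0 h1 h2 h3

lemma Approx.mono {W : Type*} [NormedAddCommGroup W] {g h : ℝ → ℝ → W} {S' : ℝ}
    (H : Approx p w S g h) (hS : S' ≤ S) : Approx p w S' g h := by
  obtain ⟨δ, hδ, C, H⟩ := H
  exact ⟨δ, hδ, C, fun s t h0 h1 h2 h3 => H s t h0 h1 (h2.trans hS) h3⟩

lemma IsO.sum {ι W : Type*} [NormedAddCommGroup W] {a b : ℝ} {k : ℕ} {g : ι → ℝ → ℝ → W}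
    (s : Finset ι) (h : ∀ i ∈ s, IsO w p a b k (g i)) :
    IsO w p a b k (fun u v => ∑ i ∈ s, g i u v) :=
  IsBigO.fun_sum h

lemma isO_zero_comp {W : Type*} [NormedAddCommGroup W] {a b : ℝ} {x : ℝ → Eu N}
    (hx : ContinuousOn x (Icc a b)) {A : Eu N → W}
    (hA : ∀ t, a ≤ t → t ≤ b → ContinuousAt A (x t)) :
    IsO w p a b 0 (fun s _ : ℝ => A (x s)) := by
  have hc : ContinuousOn (fun s => A (x s)) (Icc a b) := fun t ht =>
    (hA t ht.1 ht.2).comp_continuousWithinAt (hx t ht)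
  obtain ⟨B, -, hB⟩ := exists_bound_path hc
  exact isO_of_bounded B fun s t h0 h1 h2 => hB s h0 (h1.trans h2)

lemma isO_const {W : Type*} [NormedAddCommGroup W] {a b : ℝ} (c : W) :
    IsO w p a b 0 (fun _ _ : ℝ => c) :=
  isO_of_bounded ‖c‖ fun _ _ _ _ _ => le_rfl

lemma map_id_eq_sum (A : Eu N →L[ℝ] Eu k) (t : Eu N ⊗[ℝ] Eu N) :
    TensorProduct.map (ContinuousLinearMap.id ℝ (Eu N)).toLinearMap A.toLinearMap t =
      ∑ i, EuclideanSpace.single i (1 : ℝ) ⊗ₜ[ℝ]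
        tensorLift ((EuclideanSpace.proj i : Eu N →L[ℝ] ℝ).smulRight A) t := by
  induction t with
  | zero => simp
  | tmul a b =>
    have h1 : a = ∑ i, a i • EuclideanSpace.single i (1 : ℝ) := by
      have := (EuclideanSpace.basisFun (Fin N) ℝ).sum_repr a
      simpa using this.symm
    simp only [tensorLift_tmul, TensorProduct.map_tmul]
    change a ⊗ₜ[ℝ] A b = ∑ i, EuclideanSpace.single i (1 : ℝ) ⊗ₜ[ℝ] (a i • A b)
    conv_lhs => rw [h1]
    rw [TensorProduct.sum_tmul]
    exact Finset.sum_congr rfl fun i _ => TensorProduct.smul_tmul _ _ _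
  | add x y hx hy => simp only [map_add, hx, hy, TensorProduct.tmul_add, Finset.sum_add_distrib]

/-- The germ of the integral of a one-form which vanishes on `TM` is negligible, also if the
one-form is only defined near `M`: a cutoff of it still vanishes on `TM`. -/
lemma IsWGOn.isO_of_vanishing (hw : IsControl T w) (hS : S ≤ T)
    (hX : IsWGOn d p w M S X) (hU : IsOpen U) (hMU : M ⊆ U) {α : Eu N → Eu N →L[ℝ] Eu k}
    (hα : ContDiffOn ℝ ∞ α U) (h0 : ∀ m ∈ M, ∀ v ∈ tangentVectors d M m, α m v = 0) :
    IsO w p 0 S 3 (fun s t => α (X.path s) (X.incr s t) +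
      tensorLift (fderiv ℝ α (X.path s)) (X.area s t)) := by
  have hK : IsCompact (X.path '' Icc 0 S) := isCompact_Icc.image_of_continuousOn
    hX.isWG.path_continuous
  have hKM : X.path '' Icc 0 S ⊆ M := by
    rintro _ ⟨t, ht, rfl⟩
    exact hX.trace_mem t ht.1 ht.2
  obtain ⟨α', hα', he, hc⟩ := exists_isTame_eventuallyEq hK hU (hKM.trans hMU) hα
  have h1 := (hX.integral_zero k α' hα'.smooth fun m hm v hv => by
    obtain ⟨c, hc⟩ := hc m
    rw [hc, smul_apply, h0 m hm v hv, smul_zero]).level_one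
  refine (isO_zero.sub ((hw.approx_iff hS).1 h1) (W := Eu k)).congr fun s t hs hst ht => ?_
  have he' := he (X.path s) (mem_image_of_mem _ ⟨hs, hst.trans ht⟩)
  rw [he'.fderiv_eq, he'.self_of_nhds]
  simp [PathData.zero, PathData.incr]

/-- The second level of a rough path on `M` is tangent to `M` in its second factor. -/
lemma IsWGOn.isO_map_id_left (hw : IsControl T w) (hS : S ≤ T)
    (hX : IsWGOn d p w M S X) (hU : IsOpen U) (hMU : M ⊆ U) {α : Eu N → Eu N →L[ℝ] Eu k}
    (hα : ContDiffOn ℝ ∞ α U) (h0 : ∀ m ∈ M, ∀ v ∈ tangentVectors d M m, α m v = 0) :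
    IsO w p 0 S 3 (fun s t => TensorProduct.map (ContinuousLinearMap.id ℝ (Eu N)).toLinearMap
      (α (X.path s)).toLinearMap (X.area s t)) := by
  have h1 := hX.isO_of_vanishing hw hS hU hMU hα h0
  have h2 : ∀ i : Fin N, IsO w p 0 S 3 (fun s t =>
      tensorLift ((EuclideanSpace.proj i : Eu N →L[ℝ] ℝ).smulRight (α (X.path s)))
        (X.area s t)) := by
    intro i
    -- the one-form `x ↦ xᵢ α(x)` vanishes on `TM` as well
    have h3 := hX.isO_of_vanishing hw hS hU hMU
      (α := fun x => (EuclideanSpace.proj i : Eu N →L[ℝ] ℝ) x • α x)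
      ((EuclideanSpace.proj i : Eu N →L[ℝ] ℝ).contDiff.contDiffOn.smul hα) fun m hm v hv => by
        rw [smul_apply, h0 m hm v hv, smul_zero]
    have h4 : IsO w p 0 S 0 (fun s _ : ℝ =>
        ContinuousLinearMap.lsmul ℝ ℝ (E := Eu k)
          ((EuclideanSpace.proj i : Eu N →L[ℝ] ℝ) (X.path s))) :=
      isO_zero_comp hX.isWG.path_continuous
        (A := fun x => ContinuousLinearMap.lsmul ℝ ℝ (E := Eu k)
          ((EuclideanSpace.proj i : Eu N →L[ℝ] ℝ) x))
        fun t _ _ => ((ContinuousLinearMap.lsmul ℝ ℝ (E := Eu k)).continuous.comp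
          (EuclideanSpace.proj i : Eu N →L[ℝ] ℝ).continuous).continuousAt
    have h5 := h4.clm_apply h1
    rw [zero_add] at h5
    refine (h3.sub h5).congr fun s t hs hst ht => ?_
    have hm : X.path s ∈ U := hMU (hX.trace_mem s hs (hst.trans ht))
    have hd : fderiv ℝ (fun x => (EuclideanSpace.proj i : Eu N →L[ℝ] ℝ) x • α x) (X.path s) =
        (EuclideanSpace.proj i : Eu N →L[ℝ] ℝ) (X.path s) • fderiv ℝ α (X.path s) +
        (EuclideanSpace.proj i : Eu N →L[ℝ] ℝ).smulRight (α (X.path s)) :=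
      ((EuclideanSpace.proj i : Eu N →L[ℝ] ℝ).hasFDerivAt.smul
        (((hα.contDiffAt (hU.mem_nhds hm)).differentiableAt (by norm_num)).hasFDerivAt)).fderiv
    have hsm : ∀ (c : ℝ) (B : Eu N →L[ℝ] Eu N →L[ℝ] Eu k) (t : Eu N ⊗[ℝ] Eu N),
        tensorLift (c • B) t = c • tensorLift B t := by
      intro c B t
      induction t with
      | zero => simp
      | tmul a b => simp
      | add x y hx hy => simp only [map_add, hx, hy, smul_add]
    rw [hd, tensorLift_add, hsm, smul_apply, ContinuousLinearMap.lsmul_apply,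
      smul_add]
    abel
  have h6 : IsO w p 0 S 3 (fun s t => ∑ i : Fin N, EuclideanSpace.single i (1 : ℝ) ⊗ₜ[ℝ]
      tensorLift ((EuclideanSpace.proj i : Eu N →L[ℝ] ℝ).smulRight (α (X.path s)))
        (X.area s t)) := IsO.sum Finset.univ fun i _ => by
    have := (isO_const (w := w) (p := p) (a := 0) (b := S)
      (EuclideanSpace.single i (1 : ℝ))).tmul (h2 i)
    rwa [zero_add] at this
  exact h6.congr fun s t _ _ _ => (map_id_eq_sum _ _).symm

/-- Along a path in `M`, a function which is continuous near `M` is bounded. -/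
lemma IsWGOn.isO_zero_comp (hX : IsWGOn d p w M S X) (hU : IsOpen U) (hMU : M ⊆ U)
    {W : Type*} [NormedAddCommGroup W] {A : Eu N → W} (hA : ContinuousOn A U) :
    IsO w p 0 S 0 (fun s _ : ℝ => A (X.path s)) :=
  RoughManifold.isO_zero_comp hX.isWG.path_continuous fun t h0 h1 =>
    hA.continuousAt (hU.mem_nhds (hMU (hX.trace_mem t h0 h1)))

/-- The second level of a rough path on `M` is tangent to `M` in its first factor. This follows from
the statement on the second factor as the symmetric part is given by the first level. -/
lemma IsWGOn.isO_map_id_right (hw : IsControl T w) (hp : 0 < p) (hS : S ≤ T)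
    (hX : IsWGOn d p w M S X) (hU : IsOpen U) (hMU : M ⊆ U) {α : Eu N → Eu N →L[ℝ] Eu k}
    (hα : ContDiffOn ℝ ∞ α U) (h0 : ∀ m ∈ M, ∀ v ∈ tangentVectors d M m, α m v = 0) :
    IsO w p 0 S 3 (fun s t => TensorProduct.map (α (X.path s)).toLinearMap
      (ContinuousLinearMap.id ℝ (Eu N)).toLinearMap (X.area s t)) := by
  have h1 := hX.isO_of_vanishing hw hS hU hMU hα h0
  have hX2 := hX.isWG.isO_area hw hS
  have hα' := hX.isO_zero_comp (w := w) (p := p) hU hMU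
    (hα.fderiv_of_isOpen hU (m := ∞) (by norm_num)).continuousOn
  have h2 : IsO w p 0 S 2 (fun s t => α (X.path s) (X.incr s t)) :=
    ((h1.weaken hw hp le_rfl hS (l := 2) (by norm_num)).sub
      (hα'.tensorLift hX2)).congr fun s t _ _ _ => add_sub_cancel_right _ _
  have h3 := ((hX.isWG.isO_incr hw hS).tmul h2).sub (hX.isO_map_id_left hw hS hU hMU hα h0)
  refine h3.comm.congr fun s t hs hst ht => ?_
  have e : X.incr s t ⊗ₜ[ℝ] α (X.path s) (X.incr s t) = TensorProduct.map
      (ContinuousLinearMap.id ℝ (Eu N)).toLinearMap (α (X.path s)).toLinearMap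
      (X.incr s t ⊗ₜ[ℝ] X.incr s t) := rfl
  rw [e, ← map_sub, ← hX.isWG.symm' hs hst ht, add_sub_cancel_left]
  rw [comm_map]
  congr 1
  exact (TensorProduct.comm ℝ (Eu N) (Eu N)).symm_apply_apply (X.area s t)

/-- Rough integrals along a rough path on `M` depend only on the restriction of the one-form to
`TM`. -/
lemma IsWGOn.isRoughIntegral_of_agree (hw : IsControl T w) (hp : 0 < p) (hS : S ≤ T)
    (hX : IsWGOn d p w M S X) {U' : Set (Eu N)} (hU : IsOpen U) (hMU : M ⊆ U) (hU' : IsOpen U')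
    (hMU' : M ⊆ U') {β β' : Eu N → Eu N →L[ℝ] Eu k} (hβ : ContDiffOn ℝ ∞ β U)
    (hβ' : ContDiffOn ℝ ∞ β' U') (h : ∀ m ∈ M, ∀ v ∈ tangentVectors d M m, β' m v = β m v)
    {Z : PathData (Eu k)} (hZ : IsRoughIntegral p w S β X Z) : IsRoughIntegral p w S β' X Z := by
  let α : Eu N → Eu N →L[ℝ] Eu k := fun x => β' x - β x
  have hV : IsOpen (U ∩ U') := hU.inter hU'
  have hMV : M ⊆ U ∩ U' := subset_inter hMU hMU'
  have hα : ContDiffOn ℝ ∞ α (U ∩ U') :=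
    (hβ'.mono inter_subset_right).sub (hβ.mono inter_subset_left)
  have h0 : ∀ m ∈ M, ∀ v ∈ tangentVectors d M m, α m v = 0 := fun m hm v hv => by
    rw [sub_apply, h m hm v hv, sub_self]
  have o1 := hX.isO_of_vanishing hw hS hV hMV hα h0
  have o2 := hX.isO_map_id_left hw hS hV hMV hα h0
  have o3 := hX.isO_map_id_right hw hp hS hV hMV hα h0
  have ob := hX.isO_zero_comp (w := w) (p := p) hU hMU hβ.continuousOn
  have ob' := hX.isO_zero_comp (w := w) (p := p) hU' hMU' hβ'.continuousOn
  have oi := isO_const (w := w) (p := p) (a := 0) (b := S) (ContinuousLinearMap.id ℝ (Eu N))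
  have oi' := isO_const (w := w) (p := p) (a := 0) (b := S) (ContinuousLinearMap.id ℝ (Eu k))
  refine ⟨hZ.isWG, hZ.start, (hw.approx_iff hS).2 ?_, (hw.approx_iff hS).2 ?_⟩
  · refine (((hw.approx_iff hS).1 hZ.level_one).sub o1).congr fun s t hs hst ht => ?_
    have hm := hX.trace_mem s hs (hst.trans ht)
    have hd : fderiv ℝ α (X.path s) = fderiv ℝ β' (X.path s) - fderiv ℝ β (X.path s) :=
      fderiv_fun_sub ((hβ'.contDiffAt (hU'.mem_nhds (hMU' hm))).differentiableAt (by norm_num))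
        ((hβ.contDiffAt (hU.mem_nhds (hMU hm))).differentiableAt (by norm_num))
    rw [hd, tensorLift_sub, sub_apply]
    abel
  · refine (((hw.approx_iff hS).1 hZ.level_two).sub ((oi'.map ob' o3).add
      (ob.map oi' o2))).congr fun s t hs hst ht => ?_
    rw [map_map, map_map]
    simp only [ContinuousLinearMap.id_comp, ContinuousLinearMap.comp_id, α, map_sub_left,
      map_sub_right]
    abel

variable {Y f : Eu N → Eu d →L[ℝ] Eu N} {β : Eu N → Eu N →L[ℝ] Eu d} {Z : PathData (Eu d)}

/-- A rough path on `M` solves the differential equation driven by its own development. -/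
lemma IsWGOn.isO_of_integral (hw : IsControl T w) (hp : 0 < p) (hS : S ≤ T)
    (hY : IsParallelism d M Y) (hX : IsWGOn d p w M S X) (hU : IsOpen U) (hMU : M ⊆ U)
    (hβ : ContDiffOn ℝ ∞ β U) (hf : ContDiffOn ℝ ∞ f U)
    (hβY : ∀ x ∈ M, (β x).comp (Y x) = ContinuousLinearMap.id ℝ (Eu d)) (hfY : ∀ x ∈ M, f x = Y x)
    (hZ : IsRoughIntegral p w S β X Z) :
    IsO w p 0 S 3 (fun s t => X.incr s t - (f (X.path s) (Z.incr s t) +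
        tensorLift (secondOrder f (X.path s)) (Z.area s t))) ∧
      IsO w p 0 S 3 (fun s t => X.area s t - TensorProduct.map (f (X.path s)).toLinearMap
        (f (X.path s)).toLinearMap (Z.area s t)) := by
  -- `f β` projects onto the tangent space at points of `M`, so that `Q` vanishes on `TM`
  let Q : Eu N → Eu N →L[ℝ] Eu N := fun x =>
    ContinuousLinearMap.id ℝ (Eu N) - (f x).comp (β x)
  have hQ : ContDiffOn ℝ ∞ Q U := contDiffOn_const.sub (hf.clm_comp hβ)
  have h0 : ∀ m ∈ M, ∀ v ∈ tangentVectors d M m, Q m v = 0 := fun m hm v hv => by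
    rw [← hY.range_eq m hm] at hv
    obtain ⟨a, rfl⟩ := hv
    have := congrArg (fun A : Eu d →L[ℝ] Eu d => A a) (hβY m hm)
    simp only [ContinuousLinearMap.comp_apply, ContinuousLinearMap.id_apply] at this
    simp only [Q, sub_apply, ContinuousLinearMap.comp_apply, ContinuousLinearMap.id_apply, this,
      hfY m hm, sub_self]
  have o1 := hX.isO_of_vanishing hw hS hU hMU hQ h0
  have o2 := hX.isO_map_id_left hw hS hU hMU hQ h0
  have o3 := hX.isO_map_id_right hw hp hS hU hMU hQ h0
  have hf' : ContDiffOn ℝ ∞ (fderiv ℝ f) U := hf.fderiv_of_isOpen hU (by norm_num)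
  let D : Eu N → Eu N →L[ℝ] Eu N →L[ℝ] Eu N := fun x =>
    ((ContinuousLinearMap.compL ℝ (Eu N) (Eu d) (Eu N)).flip (β x)).comp (fderiv ℝ f x)
  have hD : ContinuousOn D U := ContinuousOn.clm_comp
    ((ContinuousLinearMap.compL ℝ (Eu N) (Eu d) (Eu N)).flip.continuous.comp_continuousOn
      hβ.continuousOn) hf'.continuousOn
  have of := hX.isO_zero_comp (w := w) (p := p) hU hMU hf.continuousOn
  have ofβ := hX.isO_zero_comp (w := w) (p := p) hU hMU (hf.clm_comp hβ).continuousOn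
  have oD := hX.isO_zero_comp (w := w) (p := p) hU hMU (A := D) hD
  have os := hX.isO_zero_comp (w := w) (p := p) hU hMU (A := secondOrder f)
    (hf'.clm_comp hf).continuousOn
  have oi := isO_const (w := w) (p := p) (a := 0) (b := S) (ContinuousLinearMap.id ℝ (Eu N))
  have z1 := (hw.approx_iff hS).1 hZ.level_one
  have z2 := (hw.approx_iff hS).1 hZ.level_two
  constructor
  · have e1 := ((o1.sub (((of.clm_apply z1).weaken hw hp le_rfl hS (l := 3) (by norm_num)))).sub
      ((os.tensorLift z2).weaken hw hp le_rfl hS (l := 3) (by norm_num))).add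
      ((oD.tensorLift o3).weaken hw hp le_rfl hS (l := 3) (by norm_num))
    refine e1.congr fun s t hs hst ht => ?_
    have hm := hX.trace_mem s hs (hst.trans ht)
    have hd : fderiv ℝ Q (X.path s) = - ((ContinuousLinearMap.compL ℝ (Eu N) (Eu d) (Eu N)
        (f (X.path s))).comp (fderiv ℝ β (X.path s)) + D (X.path s)) := by
      have h1 := ((hf.contDiffAt (hU.mem_nhds (hMU hm))).differentiableAt
        (by norm_num)).hasFDerivAt.clm_comp ((hβ.contDiffAt (hU.mem_nhds (hMU hm))).differentiableAt
        (by norm_num)).hasFDerivAt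
      exact (h1.const_sub (ContinuousLinearMap.id ℝ (Eu N))).fderiv
    have hq : tensorLift (fderiv ℝ Q (X.path s)) (X.area s t) =
        - (f (X.path s) (tensorLift (fderiv ℝ β (X.path s)) (X.area s t)) +
          tensorLift (D (X.path s)) (X.area s t)) := by
      rw [hd]
      induction X.area s t with
      | zero => simp
      | tmul a b => simp
      | add x y hx hy => simp only [map_add, hx, hy]; abel
    have hsD : (secondOrder f (X.path s)).bilinearComp (β (X.path s)) (β (X.path s)) =
        D (X.path s) - (D (X.path s)).bilinearComp (Q (X.path s))
          (ContinuousLinearMap.id ℝ (Eu N)) := by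
      ext a b
      simp [D, Q, secondOrder]
    rw [hq, map_sub (tensorLift (secondOrder f (X.path s))), tensorLift_map, hsD, tensorLift_map,
      tensorLift_sub]
    simp only [Q, sub_apply, ContinuousLinearMap.comp_apply, ContinuousLinearMap.id_apply, map_sub,
      map_add]
    abel
  · have e2 := (o3.add ((ofβ.map oi o2).weaken hw hp le_rfl hS (l := 3) (by norm_num))).sub
      ((of.map of z2).weaken hw hp le_rfl hS (l := 3) (by norm_num))
    refine e2.congr fun s t hs hst ht => ?_
    have hid : TensorProduct.map (ContinuousLinearMap.id ℝ (Eu N)).toLinearMap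
        (ContinuousLinearMap.id ℝ (Eu N)).toLinearMap (X.area s t) = X.area s t := by
      have : (ContinuousLinearMap.id ℝ (Eu N)).toLinearMap = LinearMap.id := rfl
      rw [this, TensorProduct.map_id, LinearMap.id_apply]
    rw [map_map, map_sub, map_map]
    simp only [Q, ContinuousLinearMap.id_comp, ContinuousLinearMap.comp_id, map_sub_left,
      map_sub_right, hid]
    abel

/-- Along solutions of the differential equation driven by `Z`, one-forms are integrated by
pulling them back with `Y`; here the pulled back form is constant. -/
lemma IsParallelism.isRoughIntegral_of_solution (hw : IsControl T w) (hp : 0 < p) (hS : S ≤ T)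
    (hY : IsParallelism d M Y) (hU : IsOpen U) (hMU : M ⊆ U) (hf : ContDiffOn ℝ ∞ f U)
    (hfY : ∀ x ∈ M, f x = Y x) (hXc : ContinuousOn X.path (Icc 0 S))
    (hXM : ∀ t, 0 ≤ t → t ≤ S → X.path t ∈ M)
    (h1 : Approx p w S X.incr
      (fun s t => Y (X.path s) (Z.incr s t) + dirDeriv M Y (X.path s) (Z.area s t)))
    (h2 : Approx p w S X.area (fun s t => TensorProduct.map (Y (X.path s)).toLinearMap
      (Y (X.path s)).toLinearMap (Z.area s t)))
    {U' : Set (Eu N)} (hU' : IsOpen U') (hMU' : M ⊆ U')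
    {α : Eu N → Eu N →L[ℝ] Eu k} (hα : ContDiffOn ℝ ∞ α U') {A : Eu d →L[ℝ] Eu k}
    (hA : ∀ x ∈ M, (α x).comp (Y x) = A) {Z' : PathData (Eu k)} (hZ' : IsWG p w S Z')
    (h0 : Z'.path 0 = 0) (hi : ∀ s t, 0 ≤ s → s ≤ t → t ≤ S → Z'.incr s t = A (Z.incr s t))
    (ha : ∀ s t, 0 ≤ s → s ≤ t → t ≤ S → Z'.area s t =
      TensorProduct.map A.toLinearMap A.toLinearMap (Z.area s t)) :
    IsRoughIntegral p w S α X Z' := by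
  have oz : ∀ {G : Type} [NormedAddCommGroup G] {B : Eu N → G}, ContinuousOn B U' →
      IsO w p 0 S 0 (fun s _ : ℝ => B (X.path s)) := fun hB =>
    isO_zero_comp hXc fun t h0 h1 => hB.continuousAt (hU'.mem_nhds (hMU' (hXM t h0 h1)))
  have oα := oz hα.continuousOn
  have oα' := oz (hα.fderiv_of_isOpen hU' (m := ∞) (by norm_num)).continuousOn
  have i1 := (hw.approx_iff hS).1 h1
  have i2 := (hw.approx_iff hS).1 h2
  refine ⟨hZ', h0, (hw.approx_iff hS).2 ?_, (hw.approx_iff hS).2 ?_⟩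
  · have e1 := isO_zero.sub (((oα.clm_apply i1).weaken hw hp le_rfl hS (l := 3) (by norm_num)).add
      ((oα'.tensorLift i2).weaken hw hp le_rfl hS (l := 3) (by norm_num)))
    refine e1.congr fun s t hs hst ht => ?_
    have hm := hXM s hs (hst.trans ht)
    have hdf : DifferentiableAt ℝ f (X.path s) :=
      (hf.contDiffAt (hU.mem_nhds (hMU hm))).differentiableAt (by norm_num)
    have hYf : Y =ᶠ[𝓝[M] (X.path s)] f := by
      filter_upwards [self_mem_nhdsWithin] with x hx
      exact (hfY x hx).symm
    have key := hY.fderiv_comp hm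
      ((hα.contDiffAt (hU'.mem_nhds (hMU' hm))).differentiableAt (by norm_num)) hdf hYf
      (A := A) (by filter_upwards [self_mem_nhdsWithin] with x hx using hA x hx) (Z.area s t)
    have hz : α (X.path s) (Y (X.path s) (Z.incr s t)) = Z'.incr s t := by
      rw [hi s t hs hst ht, ← hA _ hm]; rfl
    rw [hY.dirDeriv_eq hm hdf hYf]
    simp only [map_sub, map_add, hz]
    rw [eq_neg_of_add_eq_zero_left key]
    abel
  · have e1 := isO_zero.sub ((oα.map oα i2).weaken hw hp le_rfl hS (l := 3) (by norm_num))
    refine e1.congr fun s t hs hst ht => ?_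
    have hm := hXM s hs (hst.trans ht)
    rw [map_sub, map_map, hA _ hm, ha s t hs hst ht]
    abel

end Forms

/-! ### Rough differential equations on a parallelized submanifold -/

section Equation

variable {N d : ℕ} {T p S : ℝ} {w : ℝ → ℝ → ℝ} {M U : Set (Eu N)} {X : PathData (Eu N)}
  {Y f : Eu N → Eu d →L[ℝ] Eu N} {o : Eu N} {Z : PathData (Eu d)}

lemma isWG_zero {V : Type*} [NormedAddCommGroup V] [InnerProductSpace ℝ V] :
    IsWG p w S (PathData.zero V) where
  path_continuous := continuousOn_const
  area_continuous := continuousOn_const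
  chen := fun _ _ _ _ _ _ _ => by simp [PathData.zero, PathData.incr]
  path_bound := ⟨0, fun _ _ _ _ _ => by simp [PathData.zero, PathData.incr]⟩
  area_bound := ⟨0, fun _ _ _ _ _ => by simp [PathData.zero]⟩
  symm := fun _ _ _ _ _ => by simp [PathData.zero, PathData.incr]

/-- For the equation driven by `Z`, membership in the class of rough paths on `M` is automatic. -/
lemma IsParallelism.solvesRDE (hw : IsControl T w) (hp : 0 < p) (hS : S ≤ T)
    (hY : IsParallelism d M Y) (hX : IsWG p w S X)
    (hXM : ∀ t, 0 ≤ t → t ≤ S → X.path t ∈ M) (h0 : X.path 0 = o)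
    (h1 : Approx p w S X.incr
      (fun s t => Y (X.path s) (Z.incr s t) + dirDeriv M Y (X.path s) (Z.area s t)))
    (h2 : Approx p w S X.area (fun s t => TensorProduct.map (Y (X.path s)).toLinearMap
      (Y (X.path s)).toLinearMap (Z.area s t))) : SolvesRDE p w M Y o Z S X := by
  obtain ⟨U, β, f, hU, hMU, hβ, hf, hpair⟩ := hY.exists_pair
  refine ⟨⟨hX, hXM, fun k α hα hα0 => ?_⟩, h0, h1, h2⟩
  refine hY.isRoughIntegral_of_solution hw hp hS hU hMU hf (fun x hx => (hpair x hx).2)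
    hX.path_continuous hXM h1 h2 isOpen_univ (subset_univ M) hα.contDiffOn (A := 0)
    (fun x hx => ?_) isWG_zero rfl (fun s t _ _ _ => ?_) (fun s t _ _ _ => ?_)
  · ext1 a
    exact hα0 x hx _ (hY.mem_tangentVectors hx a)
  · simp [PathData.zero, PathData.incr]
  · simp [PathData.zero]

lemma IsParallelism.parallelForm_apply (hY : IsParallelism d M Y) {m : Eu N} (hm : m ∈ M)
    (a : Eu d) : parallelForm Y m (Y m a) = a :=
  Function.leftInverse_invFun (hY.injective m hm) a

lemma IsParallelism.exists_isExtension (hY : IsParallelism d M Y) :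
    ∃ (U : Set (Eu N)) (β : Eu N → Eu N →L[ℝ] Eu d), IsExtension d M (parallelForm Y) U β := by
  obtain ⟨U, β, f, hU, hMU, hβ, hf, hpair⟩ := hY.exists_pair
  refine ⟨U, β, hU, hMU, hβ, fun m hm v hv => ?_⟩
  rw [← hY.range_eq m hm] at hv
  obtain ⟨a, rfl⟩ := hv
  rw [hY.parallelForm_apply hm]
  exact congrArg (fun A : Eu d →L[ℝ] Eu d => A a) (hpair m hm).1

lemma IsParallelism.comp_of_isExtension (hY : IsParallelism d M Y) {β : Eu N → Eu N →L[ℝ] Eu d}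
    (hβ : IsExtension d M (parallelForm Y) U β) {m : Eu N} (hm : m ∈ M) :
    (β m).comp (Y m) = ContinuousLinearMap.id ℝ (Eu d) := by
  ext1 a
  change β m (Y m a) = a
  rw [hβ.agree m hm _ (hY.mem_tangentVectors hm a), hY.parallelForm_apply hm]

lemma SolvesRDE.isIntegralOn (hw : IsControl T w) (hp : 0 < p) (hS : S ≤ T)
    (hY : IsParallelism d M Y) (hX : SolvesRDE p w M Y o Z S X) (hZ : IsWG p w S Z)
    (hZ0 : Z.path 0 = 0) : IsIntegralOn d p w M S (parallelForm Y) X Z := by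
  refine ⟨hY.exists_isExtension, fun U' β hβ => ?_⟩
  obtain ⟨U, _, f, hU, hMU, _, hf, hpair⟩ := hY.exists_pair
  refine hY.isRoughIntegral_of_solution hw hp hS hU hMU hf (fun x hx => (hpair x hx).2)
    hX.isWGOn.isWG.path_continuous hX.isWGOn.trace_mem hX.level_one hX.level_two hβ.isOpen
    hβ.subset hβ.smooth (A := ContinuousLinearMap.id ℝ (Eu d))
    (fun x hx => hY.comp_of_isExtension hβ hx) hZ hZ0 (fun s t _ _ _ => rfl) (fun s t _ _ _ => ?_)
  have : (ContinuousLinearMap.id ℝ (Eu d)).toLinearMap = LinearMap.id := rfl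
  rw [this, TensorProduct.map_id, LinearMap.id_apply]

/-- Existence and uniqueness of the development of a rough path on `M`. -/
theorem IsWGOn.exists_isIntegralOn (hw : IsControl T w) (hp : 0 < p) (hp3 : p < 3) (h0S : 0 ≤ S)
    (hS : S ≤ T) (hY : IsParallelism d M Y) (hX : IsWGOn d p w M S X) :
    ∃ Z : PathData (Eu d), IsWG p w S Z ∧ Z.path 0 = 0 ∧
      IsIntegralOn d p w M S (parallelForm Y) X Z ∧
      ∀ Z' : PathData (Eu d), IsIntegralOn d p w M S (parallelForm Y) X Z' → EqUpTo S Z Z' := by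
  obtain ⟨U, β, hβ⟩ := hY.exists_isExtension
  have hK : IsCompact (X.path '' Icc 0 S) := isCompact_Icc.image_of_continuousOn
    hX.isWG.path_continuous
  have hKM : X.path '' Icc 0 S ⊆ M := by
    rintro _ ⟨t, ht, rfl⟩
    exact hX.trace_mem t ht.1 ht.2
  obtain ⟨β', hβ', he, -⟩ := exists_isTame_eventuallyEq hK hβ.isOpen (hKM.trans hβ.subset)
    hβ.smooth
  obtain ⟨Z, hZ'⟩ := exists_roughIntegral hw hp hp3 h0S hS hβ' hX.isWG
  have hZ : IsRoughIntegral p w S β X Z := by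
    refine ⟨hZ'.isWG, hZ'.start, hZ'.level_one.congr (fun _ _ _ _ _ => rfl) fun s t h0 h1 h2 => ?_,
      hZ'.level_two.congr (fun _ _ _ _ _ => rfl) fun s t h0 h1 h2 => ?_⟩
    all_goals have := he (X.path s) (mem_image_of_mem _ ⟨h0, h1.trans h2⟩)
    · rw [this.fderiv_eq, this.self_of_nhds]
    · rw [this.self_of_nhds]
  have hI : IsIntegralOn d p w M S (parallelForm Y) X Z :=
    ⟨⟨U, β, hβ⟩, fun U' β' hβ' => hX.isRoughIntegral_of_agree hw hp hS hβ.isOpen hβ.subset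
      hβ'.isOpen hβ'.subset hβ.smooth hβ'.smooth
      (fun m hm v hv => by rw [hβ.agree m hm v hv, hβ'.agree m hm v hv]) hZ⟩
  exact ⟨Z, hZ.isWG, hZ.start, hI, fun Z' hZ' => hZ.eqUpTo hw hp hp3 hS (hZ'.2 U β hβ)⟩

/-- A rough path on `M` solves the equation driven by its development. -/
theorem IsWGOn.solvesRDE (hw : IsControl T w) (hp : 0 < p) (hS : S ≤ T)
    (hY : IsParallelism d M Y) (hX : IsWGOn d p w M S X) (h0 : X.path 0 = o)
    (hZ : IsIntegralOn d p w M S (parallelForm Y) X Z) : SolvesRDE p w M Y o Z S X := by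
  obtain ⟨U, β, f, hU, hMU, hβ, hf, hpair⟩ := hY.exists_pair
  have hext : IsExtension d M (parallelForm Y) U β := ⟨hU, hMU, hβ, fun m hm v hv => by
    rw [← hY.range_eq m hm] at hv
    obtain ⟨a, rfl⟩ := hv
    rw [hY.parallelForm_apply hm]
    exact congrArg (fun A : Eu d →L[ℝ] Eu d => A a) (hpair m hm).1⟩
  obtain ⟨h1, h2⟩ := hX.isO_of_integral hw hp hS hY hU hMU hβ hf (fun x hx => (hpair x hx).1)
    (fun x hx => (hpair x hx).2) (hZ.2 U β hext)
  refine ⟨hX, h0, (hw.approx_iff hS).2 (h1.congr fun s t hs hst ht => ?_),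
    (hw.approx_iff hS).2 (h2.congr fun s t hs hst ht => ?_)⟩
  all_goals have hm := hX.trace_mem s hs (hst.trans ht)
  · rw [hY.dirDeriv_eq hm ((hf.contDiffAt (hU.mem_nhds (hMU hm))).differentiableAt (by norm_num))
      (by filter_upwards [self_mem_nhdsWithin] with x hx using ((hpair x hx).2).symm),
      (hpair _ hm).2]
  · rw [(hpair _ hm).2]

/-- The first level of a solution of the equation `dX = Y_{dZ}(x)`, `x_0 = o` over `[0, S]`. -/
structure IsPathSolution (p : ℝ) (w : ℝ → ℝ → ℝ) (M : Set (Eu N)) (Y : Eu N → Eu d →L[ℝ] Eu N)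
    (o : Eu N) (Z : PathData (Eu d)) (S : ℝ) (x : ℝ → Eu N) : Prop where
  start : x 0 = o
  mem : ∀ t, 0 ≤ t → t ≤ S → x t ∈ M
  continuousOn : ContinuousOn x (Icc 0 S)
  isO : IsO w p 0 S 3 (fun s t => x t - x s -
    (Y (x s) (Z.incr s t) + dirDeriv M Y (x s) (Z.area s t)))

lemma SolvesRDE.isPathSolution (hw : IsControl T w) (hS : S ≤ T)
    (h : SolvesRDE p w M Y o Z S X) : IsPathSolution p w M Y o Z S X.path :=
  ⟨h.start, h.isWGOn.trace_mem, h.isWGOn.isWG.path_continuous, (hw.approx_iff hS).1 h.level_one⟩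

lemma IsParallelism.eulerIncr_eq (hY : IsParallelism d M Y) {m : Eu N} (hm : m ∈ M)
    (hf : DifferentiableAt ℝ f m) (h : Y =ᶠ[𝓝[M] m] f) (s t : ℝ) :
    eulerIncr f Z s t m = Y m (Z.incr s t) + dirDeriv M Y m (Z.area s t) := by
  rw [eulerIncr, hY.dirDeriv_eq hm hf h, h.self_of_nhdsWithin hm]

/-- Near a compact subset of `M`, a parallelism extends to a compactly supported function. -/
lemma IsParallelism.exists_isTame (hY : IsParallelism d M Y) {K : Set (Eu N)} (hK : IsCompact K)
    (hKM : K ⊆ M) : ∃ f : Eu N → Eu d →L[ℝ] Eu N, IsTame f ∧ ∀ x ∈ K, Y =ᶠ[𝓝[M] x] f := by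
  obtain ⟨U, β, f, hU, hMU, hβ, hf, hpair⟩ := hY.exists_pair
  obtain ⟨g, hg, he, -⟩ := exists_isTame_eventuallyEq hK hU (hKM.trans hMU) hf
  refine ⟨g, hg, fun x hx => ?_⟩
  filter_upwards [self_mem_nhdsWithin, mem_nhdsWithin_of_mem_nhds (he x hx)] with y hy hy'
  rw [hy', (hpair y hy).2]

lemma IsPathSolution.eq (hw : IsControl T w) (hp : 0 < p) (hp3 : p < 3) (hS : S ≤ T)
    (hY : IsParallelism d M Y) (hZ : IsWG p w T Z) {x x' : ℝ → Eu N}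
    (h : IsPathSolution p w M Y o Z S x) (h' : IsPathSolution p w M Y o Z S x') :
    ∀ t, 0 ≤ t → t ≤ S → x t = x' t := by
  obtain ⟨f, hf, he⟩ := hY.exists_isTame (K := x '' Icc 0 S ∪ x' '' Icc 0 S)
    ((isCompact_Icc.image_of_continuousOn h.continuousOn).union
      (isCompact_Icc.image_of_continuousOn h'.continuousOn)) (by
    rintro _ (⟨t, ht, rfl⟩ | ⟨t, ht, rfl⟩)
    · exact h.mem t ht.1 ht.2
    · exact h'.mem t ht.1 ht.2)
  refine eq_of_solution hw hp hp3 hf hZ le_rfl hS (h.start.trans h'.start.symm)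
    (h.isO.congr fun s t h0 h1 h2 => ?_) (h'.isO.congr fun s t h0 h1 h2 => ?_)
  · rw [hY.eulerIncr_eq (h.mem s h0 (h1.trans h2)) (hf.differentiable _)
      (he _ (Or.inl (mem_image_of_mem _ ⟨h0, h1.trans h2⟩)))]
  · rw [hY.eulerIncr_eq (h'.mem s h0 (h1.trans h2)) (hf.differentiable _)
      (he _ (Or.inr (mem_image_of_mem _ ⟨h0, h1.trans h2⟩)))]

/-- The second level of the solution is the lift of the path. -/
lemma IsPathSolution.exists_solvesRDE (hw : IsControl T w) (hp : 0 < p) (hp3 : p < 3) (h0S : 0 ≤ S)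
    (hS : S ≤ T) (hY : IsParallelism d M Y) (hZ : IsWG p w T Z) {x : ℝ → Eu N}
    (h : IsPathSolution p w M Y o Z S x) : ∃ X, SolvesRDE p w M Y o Z S X := by
  obtain ⟨f, hf, he⟩ := hY.exists_isTame (K := x '' Icc 0 S)
    (isCompact_Icc.image_of_continuousOn h.continuousOn) (by
    rintro _ ⟨t, ht, rfl⟩
    exact h.mem t ht.1 ht.2)
  have hfx : ∀ s, 0 ≤ s → s ≤ S → Y =ᶠ[𝓝[M] x s] f := fun s h0 h1 =>
    he _ (mem_image_of_mem _ ⟨h0, h1⟩)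
  have hfY : ∀ s, 0 ≤ s → s ≤ S → Y (x s) = f (x s) := fun s h0 h1 =>
    (hfx s h0 h1).self_of_nhdsWithin (h.mem s h0 h1)
  have hZS := hZ.mono hS
  have hsol : IsO w p 0 S 3 (fun s t => x t - x s - eulerIncr f Z s t (x s)) :=
    h.isO.congr fun s t h0 h1 h2 => by
      rw [hY.eulerIncr_eq (h.mem s h0 (h1.trans h2)) (hf.differentiable _)
        (hfx s h0 (h1.trans h2))]
  obtain ⟨B, hB0, hB⟩ := exists_bound_path h.continuousOn
  obtain ⟨B', hB'0, hB'⟩ := exists_bound_path hZS.path_continuous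
  have hx2 : ∀ s t, 0 ≤ s → s ≤ t → t ≤ S → ‖x t - x s‖ ≤ B + B := fun s t h0 h1 h2 =>
    (norm_sub_le _ _).trans (add_le_add (hB t (h0.trans h1) h2) (hB s h0 (h1.trans h2)))
  obtain ⟨C₁, hC₁, hx1⟩ := (isO_of_solution hw hp hf hZ le_rfl hS hsol).exists_bound hw hp le_rfl
    hS hx2
  obtain ⟨K₀, hK₀, hf0⟩ := hf.bound
  obtain ⟨K₁, hK₁, hf1⟩ := hf.lipschitz
  have o2 : IsO w p 0 S 2 (fun s t => x t - x s - f (x s) (Z.incr s t)) := by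
    have os : IsO w p 0 S 0 (fun s _ : ℝ => secondOrder f (x s)) :=
      isO_zero_comp h.continuousOn fun t _ _ => hf.secondOrder.smooth.continuous.continuousAt
    refine ((hsol.weaken hw hp le_rfl hS (l := 2) (by norm_num)).add
      ((os.tensorLift (hZS.isO_area hw hS)).weaken hw hp le_rfl hS (l := 2)
        (by norm_num))).congr fun s t _ _ _ => ?_
    rw [eulerIncr]
    abel
  obtain ⟨C₂, hC₂, hx3⟩ := o2.exists_bound hw hp le_rfl hS (B := B + B + K₀ * (B' + B'))
    fun s t h0 h1 h2 => by
      refine (norm_sub_le _ _).trans (add_le_add (hx2 s t h0 h1 h2)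
        (((f (x s)).le_opNorm _).trans (mul_le_mul (hf0 _) ?_ (norm_nonneg _) hK₀)))
      exact (norm_sub_le _ _).trans (add_le_add (hB' t (h0.trans h1) h2) (hB' s h0 (h1.trans h2)))
  let K := max K₀ (max (K₁ * C₁) C₂)
  obtain ⟨X, hXx, hX, hXa⟩ := exists_lift hw hp hp3 h0S hS hZS (L := fun s => f (x s)) (x := x)
    (K := K) (fun s _ _ => (hf0 _).trans (le_max_left _ _))
    (fun s t h0 h1 h2 => (hf1 _ _).trans (by
      have r0 := hw.rho_nonneg (p := p) h0 h1 (h2.trans hS)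
      refine (mul_le_mul_of_nonneg_left (hx1 s t h0 h1 h2) hK₁).trans ?_
      rw [pow_one, ← mul_assoc]
      exact mul_le_mul_of_nonneg_right ((le_max_left _ _).trans (le_max_right _ _)) r0))
    (fun s t h0 h1 h2 => (hx3 s t h0 h1 h2).trans (mul_le_mul_of_nonneg_right
      ((le_max_right _ _).trans (le_max_right _ _)) (sq_nonneg _)))
  subst hXx
  refine ⟨X, hY.solvesRDE hw hp hS hX h.mem h.start ((hw.approx_iff hS).2 h.isO)
    (hXa.congr (fun _ _ _ _ _ => rfl) fun s t h0 h1 h2 => ?_)⟩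
  rw [hfY s h0 (h1.trans h2)]

end Equation

/-! ### Continuation and explosion -/

section Continuation

variable {N d : ℕ} {T p S : ℝ} {w : ℝ → ℝ → ℝ} {M : Set (Eu N)}
  {Y : Eu N → Eu d →L[ℝ] Eu N} {o : Eu N} {Z : PathData (Eu d)}

/-- If all the vector fields `f(·)a` are tangent to the level sets of `F` then `F` is constant
along solutions. The second order term of `f` cancels against the second derivative of `F`
because the driving rough path is weakly geometric. -/
lemma eq_of_tangent {k : ℕ} {a b : ℝ} (hw : IsControl T w) (hp : 0 < p) (hp3 : p < 3) (ha : 0 ≤ a)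
    (hb : b ≤ T) {f : Eu N → Eu d →L[ℝ] Eu N} {F : Eu N → Eu k} (hf : IsTame f) (hF : IsTame F)
    (hZ : IsWG p w T Z) {B : Set (Eu N)} (hB : IsOpen B)
    (hFf : ∀ x ∈ B, (fderiv ℝ F x).comp (f x) = 0) {c : ℝ → Eu N}
    (hc : IsO w p a b 3 (fun s t => c t - c s - eulerIncr f Z s t (c s)))
    (hcB : ∀ t, a ≤ t → t ≤ b → c t ∈ B) : ∀ t, a ≤ t → t ≤ b → F (c t) = F (c a) := by
  have hcc : ContinuousOn c (Icc a b) :=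
    continuousOn_of_isO (k := 0) hw hp ha hb (isO_of_solution hw hp hf hZ ha hb hc)
  have oF : ∀ {G : Type} [NormedAddCommGroup G] {A : Eu N → G}, Continuous A →
      IsO w p a b 0 (fun s _ : ℝ => A (c s)) := fun hA =>
    isO_zero_comp hcc fun t _ _ => hA.continuousAt
  have o1 := isO_of_solution hw hp hf hZ ha hb hc
  have oz := (hZ.isO_incr hw le_rfl).mono_interval ha hb
  have oZ := (hZ.isO_area hw le_rfl).mono_interval ha hb
  have of := oF hf.smooth.continuous
  have os := oF hf.secondOrder.smooth.continuous
  have oF1 := oF hF.fderiv.smooth.continuous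
  have oF2 := oF hF.fderiv.fderiv.smooth.continuous
  obtain ⟨K, hK, hT⟩ := hF.taylor_two
  -- the third order remainder of the Taylor expansion of `F`
  have r1 : IsO w p a b 3 (fun s t => F (c t) - F (c s) - fderiv ℝ F (c s) (c t - c s) -
      (1 / 2 : ℝ) • fderiv ℝ (fderiv ℝ F) (c s) (c t - c s) (c t - c s)) :=
    (((o1.tmul o1).tmul o1).of_le K fun s t _ _ _ => by
      rw [TensorProduct.norm_tmul, TensorProduct.norm_tmul]
      refine (hT (c s) (c t)).trans (le_of_eq ?_)
      ring)
  have r2 := oF1.clm_apply hc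
  have oE : IsO w p a b 2 (fun s t => c t - c s - f (c s) (Z.incr s t)) := by
    refine ((hc.weaken hw hp ha hb (l := 2) (by norm_num)).add
      ((os.tensorLift oZ).weaken hw hp ha hb (l := 2) (by norm_num))).congr fun s t _ _ _ => ?_
    rw [eulerIncr]
    abel
  have r3 := (oF2.clm_apply oE).clm_apply o1
  have r4 := (oF2.clm_apply (of.clm_apply oz)).clm_apply oE
  have r : IsO w p a b 3 (fun s t => F (c t) - F (c s)) := by
    have half : IsO w p a b 0 (fun _ _ : ℝ => (1 / 2 : ℝ) • ContinuousLinearMap.id ℝ (Eu k)) :=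
      isO_const _
    have q1 := (half.clm_apply ((r3.weaken hw hp ha hb (l := 3) (by norm_num)).add
      (r4.weaken hw hp ha hb (l := 3) (by norm_num)))).weaken hw hp ha hb (l := 3) (by norm_num)
    refine ((r1.add (r2.weaken hw hp ha hb (l := 3) (by norm_num))).add q1).congr
      fun s t h0 h1 h2 => ?_
    set x := c s with hx
    have hxB : x ∈ B := hcB s h0 (h1.trans h2)
    have hsymm : ∀ u v, fderiv ℝ (fderiv ℝ F) x u v = fderiv ℝ (fderiv ℝ F) x v u := fun u v =>
      second_derivative_symmetric (f := F) (f' := fderiv ℝ F)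
        (fun z => (hF.differentiable z).hasFDerivAt) (hF.fderiv.differentiable x).hasFDerivAt u v
    have hz : ∀ v, fderiv ℝ F x (f x v) = 0 := fun v =>
      congrArg (fun A : Eu d →L[ℝ] Eu k => A v) (hFf x hxB)
    have hd : ∀ u v, fderiv ℝ F x (fderiv ℝ f x u v) = - fderiv ℝ (fderiv ℝ F) x u (f x v) := by
      intro u v
      have h3 := (hF.fderiv.differentiable x).hasFDerivAt.clm_comp (hf.differentiable x).hasFDerivAt
      have h4 : (fun y => (fderiv ℝ F y).comp (f y)) =ᶠ[𝓝 x] fun _ => 0 := by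
        filter_upwards [hB.mem_nhds hxB] with y hy using hFf y hy
      have h5 := h4.fderiv_eq (𝕜 := ℝ)
      rw [h3.fderiv] at h5
      have h6 := congrArg (fun A : Eu N →L[ℝ] Eu d →L[ℝ] Eu k => A u v) h5
      simp at h6
      exact eq_neg_of_add_eq_zero_left h6
    let Q : Eu d →L[ℝ] Eu d →L[ℝ] Eu k := (fderiv ℝ (fderiv ℝ F) x).bilinearComp (f x) (f x)
    have hs : ∀ z : Eu d ⊗[ℝ] Eu d, fderiv ℝ F x (tensorLift (secondOrder f x) z) =
        - tensorLift Q z := by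
      intro z
      induction z with
      | zero => simp
      | tmul u v => simp [secondOrder, hd, Q]
      | add y z hy hz => simp only [map_add, hy, hz]; abel
    have hQc : ∀ z : Eu d ⊗[ℝ] Eu d, tensorLift Q (TensorProduct.comm ℝ _ _ z) =
        tensorLift Q z := by
      intro z
      induction z with
      | zero => simp
      | tmul u v => simp [Q, hsymm (f x v)]
      | add y z hy hz => simp only [map_add, hy, hz]
    have hQ : fderiv ℝ (fderiv ℝ F) x (f x (Z.incr s t)) (f x (Z.incr s t)) =
        (2 : ℝ) • tensorLift Q (Z.area s t) := by
      have := congrArg (tensorLift Q) (hZ.symm' (ha.trans h0) h1 (h2.trans hb))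
      rw [map_add, hQc, tensorLift_tmul] at this
      rw [two_smul, this]
      rfl
    have hE : fderiv ℝ F x (eulerIncr f Z s t x) = - tensorLift Q (Z.area s t) := by
      rw [eulerIncr, map_add, hz, hs, zero_add]
    have hE2 : fderiv ℝ (fderiv ℝ F) x (c t - x - f x (Z.incr s t)) (c t - x) +
        fderiv ℝ (fderiv ℝ F) x (f x (Z.incr s t)) (c t - x - f x (Z.incr s t)) =
        fderiv ℝ (fderiv ℝ F) x (c t - x) (c t - x) - (2 : ℝ) • tensorLift Q (Z.area s t) := by
      have polar : ∀ (G : Eu N →L[ℝ] Eu N →L[ℝ] Eu k) (v e : Eu N),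
          G (v - e) v + G e (v - e) = G v v - G e e := fun G v e => by
        simp only [map_sub, sub_apply]
        abel
      rw [polar, hQ]
    rw [hE2, map_sub (fderiv ℝ F x) (c t - x), hE]
    simp only [smul_apply, ContinuousLinearMap.id_apply, smul_sub, smul_smul]
    norm_num
    abel
  intro t h1 h2
  have := r.eq_zero_of_additive hw hp hp3 ha hb (fun s u t _ _ _ _ => by abel) a t le_rfl h1 h2
  exact sub_eq_zero.1 this

/-- A solution over `[0, S]` with `S < T` can be continued: a solution of the equation extended to
a neighbourhood of `x_S` starts at a time `a` before `S`, it agrees with the given solution up to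
time `S` by uniqueness, and it stays in `M` since the extended vector fields are tangent to the
level sets of a defining function. -/
lemma IsPathSolution.exists_continuation (hw : IsControl T w) (hp : 0 < p) (hp3 : p < 3)
    (h0S : 0 ≤ S) (hS : S < T) (hM : IsEmbeddedSubmanifold d M) (hY : IsParallelism d M Y)
    (hZ : IsWG p w T Z) {x : ℝ → Eu N} (h : IsPathSolution p w M Y o Z S x) :
    ∃ S' x', S < S' ∧ S' ≤ T ∧ IsPathSolution p w M Y o Z S' x' := by
  obtain ⟨B, f, F, hB, hmB, hf, hF, hfY, hFM, hFf⟩ :=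
    hY.exists_tangent_extension hM (h.mem S h0S le_rfl)
  obtain ⟨ε, hε, hloc⟩ := exists_local_solution hw hp hp3 hf hZ
  obtain ⟨δ, hδ, hδε⟩ := eventually_nearDiag.1
    ((hw.tendsto_nearDiag (p := p) hp le_rfl le_rfl).eventually_le_const hε)
  have hev : ∀ᶠ t in 𝓝[Icc 0 S] S, x t ∈ B :=
    (h.continuousOn S ⟨h0S, le_rfl⟩).eventually (hB.mem_nhds hmB)
  obtain ⟨η, hη, hηB⟩ := Metric.mem_nhdsWithin_iff.1 hev
  let a := max 0 (S - min δ η / 2)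
  let b := min T (S + δ / 2)
  have hmin : 0 < min δ η := lt_min hδ hη
  have ha0 : 0 ≤ a := le_max_left _ _
  have haS : a ≤ S := max_le h0S (by linarith)
  have hSb : S < b := lt_min hS (by linarith)
  have hbT : b ≤ T := min_le_left _ _
  have hba : b - a ≤ δ := by
    have h1 : b ≤ S + δ / 2 := min_le_right _ _
    have h2 : S - min δ η / 2 ≤ a := le_max_right _ _
    have h3 := min_le_left δ η
    linarith
  have hxB : ∀ t, a ≤ t → t ≤ S → x t ∈ B := fun t h1 h2 => by
    refine hηB ⟨?_, ha0.trans h1, h2⟩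
    have h3 : S - min δ η / 2 ≤ a := le_max_right _ _
    have h4 := min_le_right δ η
    rw [Metric.mem_ball, Real.dist_eq, abs_sub_comm, abs_of_nonneg (by linarith)]
    linarith
  have hYf : ∀ y ∈ M ∩ B, Y =ᶠ[𝓝[M] y] f := fun y hy => by
    filter_upwards [self_mem_nhdsWithin, mem_nhdsWithin_of_mem_nhds (hB.mem_nhds hy.2)]
      with z hz hz' using hfY ⟨hz, hz'⟩
  obtain ⟨c, hca, hc⟩ := hloc a b ha0 (haS.trans hSb.le) hbT
    (hδε a b ha0 (haS.trans hSb.le) hbT hba) (x a)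
  have hxc : ∀ t, a ≤ t → t ≤ S → x t = c t := by
    refine eq_of_solution hw hp hp3 hf hZ ha0 hS.le hca.symm
      ((h.isO.mono_interval ha0 le_rfl).congr fun s t h0 h1 h2 => ?_)
      (hc.mono_interval le_rfl hSb.le)
    rw [hY.eulerIncr_eq (h.mem s (ha0.trans h0) (h1.trans h2)) (hf.differentiable _)
      (hYf _ ⟨h.mem s (ha0.trans h0) (h1.trans h2), hxB s h0 (h1.trans h2)⟩)]
  have hcc : ContinuousOn c (Icc a b) :=
    continuousOn_of_isO (k := 0) hw hp ha0 hbT (isO_of_solution hw hp hf hZ ha0 hbT hc)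
  -- the local solution stays in the chart for a short time after `S`
  obtain ⟨η', hη', hη'B⟩ := Metric.mem_nhdsWithin_iff.1
    ((hcc S ⟨haS, hSb.le⟩).eventually (hB.mem_nhds (by rwa [← hxc S haS le_rfl])))
  let S' := min b (S + η' / 2)
  have hSS' : S < S' := lt_min hSb (by linarith)
  have hS'b : S' ≤ b := min_le_left _ _
  have hcB : ∀ t, a ≤ t → t ≤ S' → c t ∈ B := fun t h1 h2 => by
    rcases le_total t S with h3 | h3
    · rw [← hxc t h1 h3]
      exact hxB t h1 h3
    · refine hη'B ⟨?_, h1, h2.trans hS'b⟩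
      have h4 : S' ≤ S + η' / 2 := min_le_right _ _
      rw [Metric.mem_ball, Real.dist_eq, abs_of_nonneg (by linarith)]
      linarith
  have hc' := hc.mono_interval le_rfl hS'b
  have hcM : ∀ t, a ≤ t → t ≤ S' → c t ∈ M := fun t h1 h2 => by
    rw [hFM _ (hcB t h1 h2), eq_of_tangent hw hp hp3 ha0 (hS'b.trans hbT) hf hF hZ hB hFf hc' hcB t
      h1 h2, ← hFM _ (hcB a le_rfl (haS.trans hSS'.le)), hca]
    exact h.mem a ha0 haS
  let y : ℝ → Eu N := fun t => if t ≤ S then x t else c t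
  have hyx : ∀ t, t ≤ S → y t = x t := fun t ht => if_pos ht
  have hyc : ∀ t, a ≤ t → y t = c t := fun t ht => by
    by_cases h3 : t ≤ S
    · rw [hyx t h3, hxc t ht h3]
    · exact if_neg h3
  have o1 : IsO w p 0 S 3 (fun s t => y t - y s -
      (Y (y s) (Z.incr s t) + dirDeriv M Y (y s) (Z.area s t))) :=
    h.isO.congr fun s t _ h1 h2 => by rw [hyx s (h1.trans h2), hyx t h2]
  have o2 : IsO w p a S' 3 (fun s t => y t - y s -
      (Y (y s) (Z.incr s t) + dirDeriv M Y (y s) (Z.area s t))) :=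
    hc'.congr fun s t h0 h1 h2 => by
      rw [hyc s h0, hyc t (h0.trans h1), hY.eulerIncr_eq (hcM s h0 (h1.trans h2))
        (hf.differentiable _) (hYf _ ⟨hcM s h0 (h1.trans h2), hcB s h0 (h1.trans h2)⟩)]
  have hyM : ∀ t, 0 ≤ t → t ≤ S' → y t ∈ M := fun t h0 h1 => by
    rcases le_total t S with h3 | h3
    · rw [hyx t h3]
      exact h.mem t h0 h3
    · rw [hyc t (haS.trans h3)]
      exact hcM t (haS.trans h3) h1
  -- a short interval in `[0, S']` lies in `[0, S]` or in `[a, S']`; if `S = 0` then `a = 0`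
  have o3 : IsO w p 0 S' 3 (fun s t => y t - y s -
      (Y (y s) (Z.incr s t) + dirDeriv M Y (y s) (Z.area s t))) := by
    obtain ⟨δ₁, hδ₁, C₁, hC₁⟩ := (hw.isO_iff le_rfl hS.le).1 o1
    obtain ⟨δ₂, hδ₂, C₂, hC₂⟩ := (hw.isO_iff ha0 (hS'b.trans hbT)).1 o2
    refine (hw.isO_iff le_rfl (hS'b.trans hbT)).2 ⟨min (min δ₁ δ₂) (min δ η / 2), by positivity,
      max C₁ C₂, fun s t h0 h1 h2 h3 => ?_⟩
    have r0 := pow_nonneg (hw.rho_nonneg (p := p) h0 h1 (h2.trans (hS'b.trans hbT))) 3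
    have h4 : t - s ≤ δ₁ := h3.trans ((min_le_left _ _).trans (min_le_left _ _))
    have h5 : t - s ≤ δ₂ := h3.trans ((min_le_left _ _).trans (min_le_right _ _))
    have h6 : t - s ≤ min δ η / 2 := h3.trans (min_le_right _ _)
    rcases le_total t S with h7 | h7
    · exact (hC₁ s t h0 h1 h7 h4).trans (mul_le_mul_of_nonneg_right (le_max_left _ _) r0)
    · exact (hC₂ s t (max_le h0 (by linarith)) h1 h2 h5).trans
        (mul_le_mul_of_nonneg_right (le_max_right _ _) r0)
  refine ⟨S', y, hSS', hS'b.trans hbT, (hyx 0 h0S).trans h.start, hyM, ?_, o3⟩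
  rw [← Icc_union_Icc_eq_Icc h0S hSS'.le]
  exact (h.continuousOn.congr fun t ht => hyx t ht.2).union_of_isClosed
    ((hcc.mono (Icc_subset_Icc haS hS'b)).congr fun t ht => hyc t (haS.trans ht.1))
    isClosed_Icc isClosed_Icc

/-- Uniqueness of solutions over a given interval. -/
lemma SolvesRDE.eqUpTo (hw : IsControl T w) (hp : 0 < p) (hp3 : p < 3) (hS : S ≤ T)
    (hY : IsParallelism d M Y) (hZ : IsWG p w T Z) {X X' : PathData (Eu N)}
    (h : SolvesRDE p w M Y o Z S X) (h' : SolvesRDE p w M Y o Z S X') : EqUpTo S X X' := by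
  have hx := (h.isPathSolution hw hS).eq hw hp hp3 hS hY hZ (h'.isPathSolution hw hS)
  refine ⟨hx, area_eq_of_approx hw hp hp3 hS h.isWGOn.isWG h'.isWGOn.isWG hx h.level_two
    (h'.level_two.congr (fun _ _ _ _ _ => rfl) fun s t h0 h1 h2 => ?_)⟩
  rw [hx s h0 (h1.trans h2)]

lemma SolvesRDE.mono (hw : IsControl T w) (hp : 0 < p) (hS : S ≤ T)
    (hY : IsParallelism d M Y) {X : PathData (Eu N)}
    (h : SolvesRDE p w M Y o Z S X) {S' : ℝ} (hS' : S' ≤ S) : SolvesRDE p w M Y o Z S' X :=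
  hY.solvesRDE hw hp (hS'.trans hS) (h.isWGOn.isWG.mono hS')
    (fun t h0 h1 => h.isWGOn.trace_mem t h0 (h1.trans hS')) h.start (h.level_one.mono hS')
    (h.level_two.mono hS')

lemma IsWG.congr {V : Type*} [NormedAddCommGroup V] [InnerProductSpace ℝ V] {X X' : PathData V}
    (h : IsWG p w S X) (hXX' : EqUpTo S X X') : IsWG p w S X' := by
  have hi : ∀ s t, 0 ≤ s → s ≤ t → t ≤ S → X'.incr s t = X.incr s t := fun s t h0 h1 h2 => by
    rw [PathData.incr, PathData.incr, hXX'.1 s h0 (h1.trans h2), hXX'.1 t (h0.trans h1) h2]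
  refine ⟨h.path_continuous.congr fun t ht => (hXX'.1 t ht.1 ht.2).symm,
    h.area_continuous.congr fun q hq => (hXX'.2 q.1 q.2 hq.1 hq.2.1 hq.2.2).symm,
    fun s u t h0 h1 h2 h3 => ?_, ?_, ?_, fun s t h0 h1 h2 => ?_⟩
  · rw [← hXX'.2 s t h0 (h1.trans h2) h3, ← hXX'.2 s u h0 h1 (h2.trans h3),
      ← hXX'.2 u t (h0.trans h1) h2 h3, hi s u h0 h1 (h2.trans h3), hi u t (h0.trans h1) h2 h3]
    exact h.chen s u t h0 h1 h2 h3
  · obtain ⟨C, hC⟩ := h.path_bound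
    exact ⟨C, fun s t h0 h1 h2 => by rw [hi s t h0 h1.le h2]; exact hC s t h0 h1 h2⟩
  · obtain ⟨C, hC⟩ := h.area_bound
    exact ⟨C, fun s t h0 h1 h2 => by rw [← hXX'.2 s t h0 h1.le h2]; exact hC s t h0 h1 h2⟩
  · rw [hi s t h0 h1 h2, ← hXX'.2 s t h0 h1 h2]
    exact h.symm s t h0 h1 h2

lemma SolvesRDE.congr (hw : IsControl T w) (hp : 0 < p) (h0S : 0 ≤ S) (hS : S ≤ T)
    (hY : IsParallelism d M Y) {X X' : PathData (Eu N)}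
    (h : SolvesRDE p w M Y o Z S X) (hXX' : EqUpTo S X X') : SolvesRDE p w M Y o Z S X' := by
  have hi : ∀ s t, 0 ≤ s → s ≤ t → t ≤ S → X.incr s t = X'.incr s t := fun s t h0 h1 h2 => by
    rw [PathData.incr, PathData.incr, hXX'.1 s h0 (h1.trans h2), hXX'.1 t (h0.trans h1) h2]
  refine hY.solvesRDE hw hp hS (h.isWGOn.isWG.congr hXX') (fun t h0 h1 => ?_) ?_
    (h.level_one.congr hi fun s t h0 h1 h2 => ?_)
    (h.level_two.congr hXX'.2 fun s t h0 h1 h2 => ?_)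
  · rw [← hXX'.1 t h0 h1]
    exact h.isWGOn.trace_mem t h0 h1
  · rw [← hXX'.1 0 le_rfl h0S]
    exact h.start
  · rw [hXX'.1 s h0 (h1.trans h2)]
  · rw [hXX'.1 s h0 (h1.trans h2)]

lemma isPathSolution_zero (hT : 0 ≤ T) (ho : o ∈ M) (hZ : IsWG p w T Z) :
    IsPathSolution p w M Y o Z 0 (fun _ => o) where
  start := rfl
  mem := fun _ _ _ => ho
  continuousOn := continuousOn_const
  isO := isO_zero.congr fun s t h0 h1 h2 => by
    obtain rfl : s = 0 := le_antisymm (h1.trans h2) h0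
    obtain rfl : t = 0 := le_antisymm h2 h1
    simp [PathData.incr, hZ.area_diag le_rfl hT]

/-- Existence of the solution up to explosion. -/
theorem exists_isMaximalSolution (hT : 0 < T) (hw : IsControl T w) (hp : 0 < p) (hp3 : p < 3)
    (hM : IsEmbeddedSubmanifold d M) (hY : IsParallelism d M Y) (ho : o ∈ M)
    (hZ : IsWG p w T Z) :
    ∃ (J : Set ℝ) (X : PathData (Eu N)), IsMaximalSolution T p w M Y o Z J X := by
  let J : Set ℝ := {S | 0 ≤ S ∧ S ≤ T ∧ ∃ X, SolvesRDE p w M Y o Z S X}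
  have hJ0 : (0 : ℝ) ∈ J :=
    ⟨le_rfl, hT.le, (isPathSolution_zero hT.le ho hZ).exists_solvesRDE hw hp hp3 le_rfl hT.le hY hZ⟩
  have hJdown : ∀ S ∈ J, ∀ S', 0 ≤ S' → S' ≤ S → S' ∈ J := by
    rintro S ⟨h0, h1, X, hX⟩ S' h0' h1'
    exact ⟨h0', h1'.trans h1, X, hX.mono hw hp h1 hY h1'⟩
  have hJup : ∀ S ∈ J, S < T → ∃ S' ∈ J, S < S' := by
    rintro S ⟨h0, h1, X, hX⟩ hST
    obtain ⟨S', x, h2, h3, hx⟩ := (hX.isPathSolution hw h1).exists_continuation hw hp hp3 h0 hST hM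
      hY hZ
    exact ⟨S', ⟨h0.trans h2.le, h3, hx.exists_solvesRDE hw hp hp3 (h0.trans h2.le) h3 hY hZ⟩, h2⟩
  have hbdd : BddAbove J := ⟨T, fun S hS => hS.2.1⟩
  have hint : J = Icc 0 T ∨ ∃ τ, 0 < τ ∧ τ ≤ T ∧ J = Ico 0 τ := by
    by_cases hTJ : T ∈ J
    · exact Or.inl (Subset.antisymm (fun S hS => ⟨hS.1, hS.2.1⟩)
        fun S hS => hJdown T hTJ S hS.1 hS.2)
    · have hlt : ∀ S ∈ J, S < T := fun S hS => lt_of_le_of_ne hS.2.1 fun h => hTJ (h ▸ hS)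
      have hlt' : ∀ S ∈ J, S < sSup J := fun S hS => by
        obtain ⟨S', hS', h⟩ := hJup S hS (hlt S hS)
        exact h.trans_le (le_csSup hbdd hS')
      refine Or.inr ⟨sSup J, hlt' 0 hJ0, csSup_le ⟨0, hJ0⟩ fun S hS => hS.2.1,
        Subset.antisymm (fun S hS => ⟨hS.1, hlt' S hS⟩) fun S hS => ?_⟩
      obtain ⟨S', hS', h⟩ := exists_lt_of_lt_csSup ⟨0, hJ0⟩ hS.2
      exact hJdown S' hS' S hS.1 h.le
  have : Nonempty (PathData (Eu N)) := ⟨PathData.zero _⟩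
  choose! G hG using fun S (hS : S ∈ J) => hS.2.2
  -- the solutions over the intervals `[0, S]`, `S ∈ J`, are restrictions of a single one
  let X : PathData (Eu N) := ⟨fun t => (G t).path t, fun s t => (G t).area s t⟩
  have hGX : ∀ S ∈ J, EqUpTo S (G S) X := by
    intro S hS
    have h : ∀ t, 0 ≤ t → t ≤ S → EqUpTo t (G S) (G t) := fun t h0 h1 =>
      have ht := hJdown S hS t h0 h1
      ((hG S hS).mono hw hp hS.2.1 hY h1).eqUpTo hw hp hp3 ht.2.1 hY hZ (hG t ht)
    exact ⟨fun t h0 h1 => (h t h0 h1).1 t h0 le_rfl,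
      fun s t h0 h1 h2 => (h t (h0.trans h1) h2).2 s t h0 h1 le_rfl⟩
  exact ⟨J, X, hint, fun S hS => (hG S hS).congr hw hp hS.1 hS.2.1 hY (hGX S hS),
    fun S h0 h1 X' hX' => ⟨h0, h1, X', hX'⟩⟩

end Continuation

end RoughManifold

open RoughManifold in
theorem theorem6p11 (N d : ℕ) (T p : ℝ) (hT : 0 < T) (hp2 : 2 ≤ p) (hp3 : p < 3)
    (w : ℝ → ℝ → ℝ) (hw : IsControl T w)
    (M : Set (Eu N)) (hM : IsEmbeddedSubmanifold d M)
    (Y : Eu N → Eu d →L[ℝ] Eu N) (hY : IsParallelism d M Y) (o : Eu N) (ho : o ∈ M) :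
    -- the unrolling map `X ↦ Z = ∫ θ^Y(dX)` from `WG_p(M, o)` to `WG_p(ℝ^d, 0)` is well defined
    (∀ X : PathData (Eu N), IsWGOn d p w M T X → X.path 0 = o →
      ∃ Z : PathData (Eu d), IsWG p w T Z ∧ Z.path 0 = 0 ∧
        IsIntegralOn d p w M T (parallelForm Y) X Z ∧
        ∀ Z' : PathData (Eu d), IsIntegralOn d p w M T (parallelForm Y) X Z' → EqUpTo T Z Z') ∧
    -- the equation `dX = Y_{dZ}(x)`, `x_0 = o` has a unique solution up to explosion, which lies
    -- in `WG_p([0, τ), M, o)` and integrates back to `Z`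
    (∀ Z : PathData (Eu d), IsWG p w T Z → Z.path 0 = 0 →
      (∃ (J : Set ℝ) (X : PathData (Eu N)), IsMaximalSolution T p w M Y o Z J X) ∧
      (∀ (S : ℝ) (X X' : PathData (Eu N)), 0 ≤ S → S ≤ T →
        SolvesRDE p w M Y o Z S X → SolvesRDE p w M Y o Z S X' → EqUpTo S X X') ∧
      (∀ (J : Set ℝ) (X : PathData (Eu N)), IsMaximalSolution T p w M Y o Z J X →
        ∀ S ∈ J, IsWGOn d p w M S X ∧ X.path 0 = o ∧
          IsIntegralOn d p w M S (parallelForm Y) X Z)) ∧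
    -- every `X` solves the equation driven by `∫ θ^Y(dX)`, and hence agrees with the solution `W`
    -- of that equation up to explosion
    (∀ (X : PathData (Eu N)) (Z : PathData (Eu d)), IsWGOn d p w M T X → X.path 0 = o →
      IsIntegralOn d p w M T (parallelForm Y) X Z →
      SolvesRDE p w M Y o Z T X ∧
      ∀ (J : Set ℝ) (W : PathData (Eu N)), IsMaximalSolution T p w M Y o Z J W →
        ∀ S ∈ J, EqUpTo S W X) := by
  have hp : 0 < p := by linarith
  have hJT : ∀ {Z : PathData (Eu d)} {J : Set ℝ} {W : PathData (Eu N)},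
      IsMaximalSolution T p w M Y o Z J W → ∀ S ∈ J, 0 ≤ S ∧ S ≤ T := by
    intro Z J W hW S hS
    rcases hW.interval with h | ⟨τ, -, hτ, h⟩
    · rw [h] at hS
      exact hS
    · rw [h] at hS
      exact ⟨hS.1, hS.2.le.trans hτ⟩
  refine ⟨fun X hX _ => hX.exists_isIntegralOn hw hp hp3 hT.le le_rfl hY,
    fun Z hZ hZ0 => ⟨exists_isMaximalSolution hT hw hp hp3 hM hY ho hZ,
      fun S X X' _ hS h h' => h.eqUpTo hw hp hp3 hS hY hZ h', fun J X hX S hS => ?_⟩,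
    fun X Z hX h0 hI => ?_⟩
  · have h := hX.solves S hS
    have hST := (hJT hX S hS).2
    exact ⟨h.isWGOn, h.start, h.isIntegralOn hw hp hST hY (hZ.mono hST) hZ0⟩
  · have h := hX.solvesRDE hw hp le_rfl hY h0 hI
    obtain ⟨U, β, hβ⟩ := hI.1
    have hZ := (hI.2 U β hβ).isWG
    refine ⟨h, fun J W hW S hS => ?_⟩
    have hST := (hJT hW S hS).2
    exact (hW.solves S hS).eqUpTo hw hp hp3 hST hY hZ (h.mono hw hp le_rfl hY hST)
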